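/- **Theorem (Recurrence for multirooted hypermaps).** A hypermap is a triple $(X,R,L)$ with $X$ a finite set of darts and $R,L$ permutations of $X$ generating a group that acts transitively on $X$; its vertices, hyperedges and faces are the orbits of $R$, $L$ and $RL$ ($L$ followed by $R$), and the degree of a vertex is its number of darts. There is one empty hypermap; by convention it has one vertex (of degree $0$, serving as root vertex), one face and no hyperedge. The genus $g$ of a hypermap with $t$ darts, $v$ vertices, $e$ hyperedges and $f$ faces is given by $v+e+f=t+2(1-g)$. Objects are counted up to isomorphism (bijections of the darts preserving $R$, $L$ and all distinguished data). Let $H(g,t,f,e,n,D)$ be the number of sequenced rooted hypermaps (a hypermap with a root dart if it is non-empty, and a sequence of pairwise distinct distinguished vertices other than the root vertex) of genus $g$ with $t$ darts, $f$ faces and $e$ hyperedges, with root vertex of degree $n$ and with list $D=(d_1,\dots,d_{|D|})$ of degrees of the distinguished vertices. Let $H_m(g,t,f,e,D)$ be the number of multirooted hypermaps (a hypermap with a non-empty sequence of distinguished darts with pairwise distinct initial vertices) of genus $g$ with $t$ darts, $f$ faces and $e$ hyperedges, where $D$ is the list of degrees of the initial vertices of the distinguished darts; the empty hypermap is counted as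 a multirooted hypermap with list $[0]$. Here $n.D$ is the list $D$ with $n$ put in front. All parameters are non-negative integers (lists of such). Then 1. $H_m(g,t,f,e,n.D)=H(g,t,f,e,n,D)\,\prod_{j=1}^{|D|} d_j$ for all $g,t,f,e,n,D$. 2. $H_m(0,0,1,0,[0])=1$, and for $t\ge 1$ and $n\ge 1$ and all $g,f,e,D$, $$\begin{aligned} H_m(g,t,f,e,n.D)={}&\sum_{\substack{g_1+g_2=g,\ t_1+t_2=t-1\\ f_1+e_2=e,\ f_2+e_1=f\\ n_1+n_2=n-1,\ D_1\subseteq D}} H_m(g_1,t_1,f_1,e_1,n_1.D_1)\,H_m(g_2,t_2,f_2,e_2,n_2.(D-D_1))\\ &+\delta_{n\ge3}\,\delta_{g\ge1}\sum_{p=1}^{n-2}H_m(g-1,t-1,e,f,(n-1-p).p.D)\\ &+\sum_{p=n}^{t-1}H_m(g,t-1,e,f,p.D)\\ &+\sum_{j=1}^{|D|}d_j\,H_m(g,t-1,e,f,(d_j+n-1).(D-\{d_j\})), \end{aligned}$$ where $\delta_\varphi$ is $1$ if $\varphi$ holds and $0$ otherwise, empty sums are $0$, $D_1$ runs over the sublists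 of $D$ (one for each set of positions in $D$), $D-D_1$ is the complementary sublist, and $D-\{d_j\}$ is $D$ with its $j$-th entry removed. -/

import Mathlib

/-- A combinatorial hypermap on the set of darts `α`: two permutations `R`, `L` of `α` such that
the group they generate acts transitively on `α`. On an empty `α` there is exactly one,
the empty hypermap. -/
structure Hypermap (α : Type*) where
  R : Equiv.Perm α
  L : Equiv.Perm α
  transitive : ∀ x y : α, ∃ σ ∈ Subgroup.closure ({R, L} : Set (Equiv.Perm α)), σ x = y

/-- The orbit of `x` under (the cyclic group generated by) a permutation. -/
def permOrbit {α : Type*} (σ : Equiv.Perm α) (x : α) : Set α :=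
  {y | σ.SameCycle x y}

namespace Hypermap

variable {α β : Type*}

/-- The vertex containing the dart `x` (its initial vertex): the orbit of `x` under `R`. -/
def vertexOf (M : Hypermap α) (x : α) : Set α := permOrbit M.R x

/-- The vertices (orbits of `R`) of a nonempty hypermap. -/
def vertices (M : Hypermap α) : Set (Set α) := Set.range (permOrbit M.R)

/-- The hyperedges: orbits of `L`. -/
def hyperedges (M : Hypermap α) : Set (Set α) := Set.range (permOrbit M.L)

/-- The faces (orbits of `R ∘ L`, that is, `L` followed by `R`) of a nonempty hypermap. -/
def faces (M : Hypermap α) : Set (Set α) := Set.range (permOrbit (M.R * M.L))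

open Classical in
/-- The number of vertices; by convention the empty hypermap has one vertex. -/
noncomputable def numVertices (M : Hypermap α) : ℕ :=
  if IsEmpty α then 1 else M.vertices.ncard

/-- The number of hyperedges (`0` for the empty hypermap). -/
noncomputable def numHyperedges (M : Hypermap α) : ℕ := M.hyperedges.ncard

open Classical in
/-- The number of faces; by convention the empty hypermap has one face. -/
noncomputable def numFaces (M : Hypermap α) : ℕ :=
  if IsEmpty α then 1 else M.faces.ncard

/-- The genus is the number `g` determined by `v + e + f = t + 2 (1 - g)`. -/
def HasGenus (M : Hypermap α) (g : ℕ) : Prop :=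
  (M.numVertices : ℤ) + M.numHyperedges + M.numFaces = Nat.card α + 2 * (1 - (g : ℤ))

/-- A bijection of the darts is an isomorphism if it takes `R` into `R'` and `L` into `L'`. -/
def IsIso (M : Hypermap α) (M' : Hypermap β) (φ : α ≃ β) : Prop :=
  (∀ x, φ (M.R x) = M'.R (φ x)) ∧ (∀ x, φ (M.L x) = M'.L (φ x))

theorem IsIso.refl (M : Hypermap α) : M.IsIso M (Equiv.refl α) :=
  ⟨fun _ => rfl, fun _ => rfl⟩

theorem IsIso.symm {M : Hypermap α} {M' : Hypermap β} {φ : α ≃ β} (h : M.IsIso M' φ) :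
    M'.IsIso M φ.symm := by
  constructor <;> intro x <;> rw [Equiv.symm_apply_eq]
  · simp [h.1]
  · simp [h.2]

theorem IsIso.trans {γ : Type*} {M : Hypermap α} {M' : Hypermap β} {M'' : Hypermap γ}
    {φ : α ≃ β} {ψ : β ≃ γ} (h : M.IsIso M' φ) (h' : M'.IsIso M'' ψ) :
    M.IsIso M'' (φ.trans ψ) :=
  ⟨fun x => by simp [h.1, h'.1], fun x => by simp [h.2, h'.2]⟩

end Hypermap

/-- A sequenced rooted hypermap: a hypermap with a root dart (no root exactly when the hypermap
is empty) and a sequence of pairwise distinct distinguished vertices, all different from the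
root vertex. -/
structure SequencedHypermap (α : Type*) extends Hypermap α where
  root : Option α
  root_isSome : Nonempty α → root.isSome
  marked : List (Set α)
  marked_vertex : ∀ v ∈ marked, v ∈ toHypermap.vertices
  marked_nodup : marked.Nodup
  marked_ne_root : ∀ r ∈ root, toHypermap.vertexOf r ∉ marked

namespace SequencedHypermap

/-- The degree of the root vertex; it is `0` for the empty hypermap. -/
noncomputable def rootDegree {α : Type*} (S : SequencedHypermap α) : ℕ :=
  S.root.elim 0 fun r => (S.vertexOf r).ncard

/-- The list of degrees of the distinguished vertices. -/
noncomputable def degrees {α : Type*} (S : SequencedHypermap α) : List ℕ :=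
  S.marked.map Set.ncard

/-- Isomorphism of sequenced rooted hypermaps: an isomorphism of hypermaps that preserves the
root and the sequence of distinguished vertices. -/
instance isoSetoid (α : Type*) : Setoid (SequencedHypermap α) where
  r S S' := ∃ φ : α ≃ α, S.IsIso S'.toHypermap φ ∧ S'.root = S.root.map φ ∧
    S'.marked = S.marked.map (fun v => φ '' v)
  iseqv :=
    { refl := fun S => ⟨Equiv.refl α, Hypermap.IsIso.refl _, by simp, by simp⟩
      symm := by
        rintro S S' ⟨φ, h, hr, hm⟩
        refine ⟨φ.symm, h.symm, ?_, ?_⟩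
        · simp [hr, Option.map_map]
        · simp [hm, Function.comp_def, Set.image_image]
      trans := by
        rintro S S' S'' ⟨φ, h, hr, hm⟩ ⟨ψ, h', hr', hm'⟩
        refine ⟨φ.trans ψ, h.trans h', ?_, ?_⟩
        · simp [hr', hr, Option.map_map]
        · simp [hm', hm, Function.comp_def, Set.image_image] }

end SequencedHypermap

/-- A multirooted hypermap: a hypermap with a sequence of distinguished darts with pairwise
distinct initial vertices, nonempty unless the hypermap itself is empty. -/
structure MultirootedHypermap (α : Type*) extends Hypermap α where
  darts : List α
  darts_ne_nil : Nonempty α → darts ≠ []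
  darts_pairwise : darts.Pairwise fun x y => toHypermap.vertexOf x ≠ toHypermap.vertexOf y

namespace MultirootedHypermap

open Classical in
/-- The list of degrees of the initial vertices of the distinguished darts. The empty hypermap,
whose only vertex has degree `0` and serves as its root vertex, has the list `[0]`. -/
noncomputable def degrees {α : Type*} (M : MultirootedHypermap α) : List ℕ :=
  if IsEmpty α then [0] else M.darts.map fun x => (M.vertexOf x).ncard

/-- Isomorphism of multirooted hypermaps: an isomorphism of hypermaps that preserves the
sequence of distinguished darts. -/
instance isoSetoid (α : Type*) : Setoid (MultirootedHypermap α) where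
  r M M' := ∃ φ : α ≃ α, M.IsIso M'.toHypermap φ ∧ M'.darts = M.darts.map φ
  iseqv :=
    { refl := fun M => ⟨Equiv.refl α, Hypermap.IsIso.refl _, by simp⟩
      symm := by
        rintro M M' ⟨φ, h, hd⟩
        exact ⟨φ.symm, h.symm, by simp [hd]⟩
      trans := by
        rintro M M' M'' ⟨φ, h, hd⟩ ⟨ψ, h', hd'⟩
        exact ⟨φ.trans ψ, h.trans h', by simp [hd', hd]⟩ }

end MultirootedHypermap

/-- `H(g,t,f,e,n,D)`: the number, up to isomorphism, of sequenced rooted hypermaps of genus `g`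
with `t` darts, `f` faces, `e` hyperedges, root vertex of degree `n` and list `D` of degrees of
the distinguished vertices. -/
noncomputable def numSequenced (g t f e n : ℕ) (D : List ℕ) : ℕ :=
  Nat.card (Quotient ((SequencedHypermap.isoSetoid (Fin t)).comap
    (Subtype.val : {S : SequencedHypermap (Fin t) // S.HasGenus g ∧ S.numFaces = f ∧
      S.numHyperedges = e ∧ S.rootDegree = n ∧ S.degrees = D} → SequencedHypermap (Fin t))))

/-- `H_m(g,t,f,e,D)`: the number, up to isomorphism, of multirooted hypermaps of genus `g` with
`t` darts, `f` faces, `e` hyperedges and list `D` of degrees of the initial vertices of the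
distinguished darts. -/
noncomputable def numMultirooted (g t f e : ℕ) (D : List ℕ) : ℕ :=
  Nat.card (Quotient ((MultirootedHypermap.isoSetoid (Fin t)).comap
    (Subtype.val : {M : MultirootedHypermap (Fin t) // M.HasGenus g ∧ M.numFaces = f ∧
      M.numHyperedges = e ∧ M.degrees = D} → MultirootedHypermap (Fin t))))

/-- The sublist of `D` formed by the entries whose positions lie in `S`, in their order in `D`;
the complementary sublist is `subAt D Sᶜ`. -/
def subAt (D : List ℕ) (S : Finset (Fin D.length)) : List ℕ :=
  ((List.finRange D.length).filter (fun i => i ∈ S)).map D.get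

/-! Everything is counted on labelled darts. An isomorphism of connected hypermaps is determined by
the image of one dart, so a class with a distinguished dart has exactly `t!` labellings and
identities between numbers of classes can be checked after multiplication by factorials
(`card_eq_card_mul_card_quotient`, `mapHypermap_rigid`). A distinguished vertex of degree `d_j` can
be marked at any of its `d_j` darts, which gives the first assertion (`labelledCount_eq_prod_mul`).

For the recurrence the root dart is deleted. If the root is called `none`, a pair of permutations of
`Option β` is `(insertR R u w, insertL L u)` for exactly one pair `R`, `L` on `β` and exactly one
pair of positions `u`, `w` (`insert_bijective`). Here `u` tells where `none` enters the hyperedges,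
`w` where it enters the faces, and a position equal to `none` makes the root a hyperedge or a face
by itself. It remains to see what happens to the vertices.

If `u` or `w` is `none`, the root is spliced into one vertex, or is the only dart. Suppose that both
are darts `a`, `b`. If they lie in one vertex of `R`, the insertion splits it; the degree `n` of the
root determines `b` from `a`, and the remainder of the old vertex is either unmarked (the sum over
`p ≥ n`) or carries the `j`-th mark at one of its `d_j` darts (the sum over `j`). If they lie in
different vertices, these are joined. Then `R`, `L` are connected, of genus `g - 1`, with `a` and
`b` as two marks, or they have exactly two components, rooted at `a` and `b`, whose genera add up to
`g`.

The conventions for the empty hypermap (one face, no hyperedge, degree `0`) turn the cases with `u`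
or `w` equal to `none` into the terms of the product sum in which one factor has no darts. The
duality that replaces `L` by `(R * L)⁻¹` keeps the vertices and exchanges hyperedges and faces;
applied to the first factor of the product and to the three other sums, it produces the crossed
indices of the statement. Summing over the set of darts of the first component gives a binomial
coefficient, which the factorials absorb. -/

namespace HypermapCount

open Equiv

/-! ### Orbits of a permutation and the effect of a transposition -/

section Orbits

variable {α β γ : Type*}

/-- The number of orbits of a permutation. -/
noncomputable def numOrbits (σ : Perm α) : ℕ := (Set.range (permOrbit σ)).ncard

/-- The size of the orbit of `x` under a permutation. -/
noncomputable def orbitSize (σ : Perm α) (x : α) : ℕ := (permOrbit σ x).ncard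

theorem mem_permOrbit {σ : Perm α} {x y : α} : y ∈ permOrbit σ x ↔ σ.SameCycle x y := Iff.rfl

theorem permOrbit_eq_iff {σ : Perm α} {x y : α} :
    permOrbit σ x = permOrbit σ y ↔ σ.SameCycle x y := by
  constructor
  · intro h
    have : y ∈ permOrbit σ y := Perm.SameCycle.refl σ y
    rwa [← h] at this
  · intro h
    ext z
    exact ⟨fun hz => h.symm.trans hz, fun hz => h.trans hz⟩

/-- Serves to bound cycles from above: an invariant predicate that separates two points shows that
they lie in different cycles. -/
theorem sameCycle_invariant {σ : Perm α} {p : α → Prop} (h : ∀ z, p (σ z) ↔ p z) {x y : α}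
    (hxy : σ.SameCycle x y) : p x ↔ p y := by
  obtain ⟨k, rfl⟩ := hxy
  induction k using Int.induction_on with
  | zero => simp
  | succ i ih =>
    rw [ih, add_comm, zpow_add, zpow_one, Perm.mul_apply, h]
  | pred i ih =>
    rw [ih, ← h ((σ ^ (-(i : ℤ) - 1)) x), ← Perm.mul_apply, ← zpow_one_add]
    simp

theorem semiconj_zpow {σ : Perm α} {τ : Perm β} {ι : α → β} (h : ∀ x, ι (σ x) = τ (ι x))
    (k : ℤ) (x : α) : ι ((σ ^ k) x) = (τ ^ k) (ι x) := by
  have hn : ∀ (n : ℕ) (x : α), ι ((σ ^ n) x) = (τ ^ n) (ι x) := by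
    intro n
    induction n with
    | zero => simp
    | succ n ih => intro x; rw [pow_succ', pow_succ', Perm.mul_apply, Perm.mul_apply, h, ih]
  obtain ⟨n, rfl | rfl⟩ := k.eq_nat_or_neg
  · simpa using hn n x
  · rw [zpow_neg, zpow_neg, Perm.eq_inv_iff_eq, zpow_natCast, zpow_natCast, ← hn]
    simp

theorem sameCycle_map {σ : Perm α} {τ : Perm β} {ι : α → β} (hι : Function.Injective ι)
    (h : ∀ x, ι (σ x) = τ (ι x)) {x y : α} :
    τ.SameCycle (ι x) (ι y) ↔ σ.SameCycle x y := by
  constructor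
  · rintro ⟨k, hk⟩
    exact ⟨k, hι (by rw [semiconj_zpow h, hk])⟩
  · rintro ⟨k, hk⟩
    exact ⟨k, by rw [← semiconj_zpow h, hk]⟩

theorem permOrbit_map {σ : Perm α} {τ : Perm β} {ι : α → β}
    (h : ∀ x, ι (σ x) = τ (ι x)) (x : α) : permOrbit τ (ι x) = ι '' permOrbit σ x := by
  ext z
  constructor
  · rintro ⟨k, rfl⟩
    exact ⟨(σ ^ k) x, ⟨k, rfl⟩, semiconj_zpow h k x⟩
  · rintro ⟨w, ⟨k, rfl⟩, rfl⟩
    exact ⟨k, (semiconj_zpow h k x).symm⟩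

theorem orbitSize_map {σ : Perm α} {τ : Perm β} {ι : α → β} (hι : Function.Injective ι)
    (h : ∀ x, ι (σ x) = τ (ι x)) (x : α) : orbitSize τ (ι x) = orbitSize σ x := by
  rw [orbitSize, permOrbit_map h, Set.ncard_image_of_injective _ hι, orbitSize]

theorem orbitSize_congr {σ : Perm α} {x y : α} (h : σ.SameCycle x y) :
    orbitSize σ x = orbitSize σ y := by
  rw [orbitSize, orbitSize, permOrbit_eq_iff.2 h]

theorem orbitSize_pos [Finite α] (σ : Perm α) (x : α) : 0 < orbitSize σ x :=
  (Set.ncard_pos (Set.toFinite _)).2 ⟨x, Perm.SameCycle.refl σ x⟩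

theorem orbitSize_le [Finite α] (σ : Perm α) (x : α) : orbitSize σ x ≤ Nat.card α :=
  Set.ncard_le_card _

/-- Covers three uses at once: an added fixed point, two components side by side and, with `Empty`
as one side, transport along a bijection. -/
theorem numOrbits_add [Finite β] {σ : Perm α} {τ : Perm γ} {ρ : Perm β} {i : α → β} {j : γ → β}
    (hi : Function.Injective i) (hj : Function.Injective j) (hij : ∀ x y, i x ≠ j y)
    (hcover : ∀ z, (∃ x, i x = z) ∨ ∃ y, j y = z)
    (hσ : ∀ x, i (σ x) = ρ (i x)) (hτ : ∀ y, j (τ y) = ρ (j y)) :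
    numOrbits ρ = numOrbits σ + numOrbits τ := by
  have key : Set.range (permOrbit ρ) =
      (fun s => i '' s) '' Set.range (permOrbit σ) ∪
        (fun s => j '' s) '' Set.range (permOrbit τ) := by
    rw [← Set.range_comp, ← Set.range_comp]
    ext s
    constructor
    · rintro ⟨z, rfl⟩
      rcases hcover z with ⟨x, rfl⟩ | ⟨y, rfl⟩
      · exact Or.inl ⟨x, (permOrbit_map hσ x).symm⟩
      · exact Or.inr ⟨y, (permOrbit_map hτ y).symm⟩
    · rintro (⟨x, rfl⟩ | ⟨y, rfl⟩)
      · exact ⟨i x, permOrbit_map hσ x⟩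
      · exact ⟨j y, permOrbit_map hτ y⟩
  rw [numOrbits, key, Set.ncard_union_eq _ (Set.toFinite _) (Set.toFinite _),
    Set.ncard_image_of_injective _ hi.image_injective,
    Set.ncard_image_of_injective _ hj.image_injective, numOrbits, numOrbits]
  rw [← Set.range_comp, ← Set.range_comp, Set.disjoint_left]
  rintro _ ⟨x, rfl⟩ ⟨y, hy⟩
  have : i x ∈ i '' permOrbit σ x := ⟨x, Perm.SameCycle.refl σ x, rfl⟩
  have h2 : j '' permOrbit τ y = i '' permOrbit σ x := hy
  rw [← h2] at this
  obtain ⟨w, -, hw⟩ := this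
  exact hij _ _ hw.symm

theorem numOrbits_of_isEmpty [IsEmpty α] (σ : Perm α) : numOrbits σ = 0 := by
  rw [numOrbits, Set.range_eq_empty, Set.ncard_empty]

theorem numOrbits_map [Finite β] {σ : Perm α} {τ : Perm β} (e : α ≃ β)
    (h : ∀ x, e (σ x) = τ (e x)) : numOrbits τ = numOrbits σ := by
  have := numOrbits_add (σ := σ) (τ := (1 : Perm Empty)) (ρ := τ) (j := Empty.elim) e.injective
    (fun x => x.elim) (fun _ y => y.elim) (fun z => Or.inl ⟨e.symm z, by simp⟩) h (fun y => y.elim)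
  rw [this, numOrbits_of_isEmpty (1 : Perm Empty), add_zero]

theorem numOrbits_inv (σ : Perm α) : numOrbits σ⁻¹ = numOrbits σ := by
  have : permOrbit σ⁻¹ = permOrbit σ := by
    funext x; ext y; simp [mem_permOrbit]
  rw [numOrbits, this, numOrbits]

theorem numOrbits_conj [Finite α] (σ τ : Perm α) : numOrbits (τ * σ * τ⁻¹) = numOrbits σ :=
  numOrbits_map τ (by simp)

theorem orbitSize_of_apply_eq {σ : Perm α} {x : α} (h : σ x = x) : orbitSize σ x = 1 := by
  rw [orbitSize, Set.ncard_eq_one]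
  refine ⟨x, ?_⟩
  ext y
  have := sameCycle_invariant (σ := σ) (p := fun z => z = x) (x := x) (y := y)
    (fun z => ⟨fun hz => σ.injective (hz.trans h.symm), fun hz => by rw [hz, h]⟩)
  exact ⟨fun hy => (this hy).1 rfl, fun hy => by rw [hy]; exact Perm.SameCycle.refl σ x⟩

theorem pow_apply_eq_iff [Finite α] (σ : Perm α) (x : α) (k : ℕ) :
    (σ ^ k) x = x ↔ orbitSize σ x ∣ k := by
  classical
  have := Fintype.ofFinite α
  have hc : σ.IsCycleOn ((permOrbit σ x).toFinset : Finset α) := by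
    rw [Set.coe_toFinset]
    refine ⟨?_, fun y hy z hz => Perm.SameCycle.trans (Perm.SameCycle.symm hy) hz⟩
    refine ⟨fun y hy => Perm.sameCycle_apply_right.2 hy, σ.injective.injOn, fun y hy => ?_⟩
    exact ⟨σ⁻¹ y, Perm.sameCycle_symm_apply_right.2 hy, by simp⟩
  have := hc.pow_apply_eq (a := x) (by simp [mem_permOrbit, Perm.SameCycle.refl]) (n := k)
  rw [this, orbitSize, Set.ncard_eq_toFinset_card']

theorem exists_pow_eq_of_sameCycle [Finite α] {σ : Perm α} {x y : α} (h : σ.SameCycle x y) :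
    ∃ k < orbitSize σ x, (σ ^ k) x = y := by
  obtain ⟨k, rfl⟩ := h.exists_nat_pow_eq
  refine ⟨k % orbitSize σ x, Nat.mod_lt _ (orbitSize_pos σ x), ?_⟩
  conv_rhs => rw [← Nat.mod_add_div k (orbitSize σ x), pow_add, Perm.mul_apply,
    (pow_apply_eq_iff σ x _).2 (Dvd.intro _ rfl)]

theorem pow_injOn [Finite α] {σ : Perm α} {x : α} {i j : ℕ} (hi : i < orbitSize σ x)
    (hj : j < orbitSize σ x) (h : (σ ^ i) x = (σ ^ j) x) : i = j := by
  wlog hij : i ≤ j generalizing i j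
  · exact (this hj hi h.symm (le_of_not_ge hij)).symm
  obtain ⟨k, rfl⟩ := Nat.exists_eq_add_of_le hij
  rw [pow_add, Perm.mul_apply, EmbeddingLike.apply_eq_iff_eq] at h
  have := (pow_apply_eq_iff σ x k).1 h.symm
  have := Nat.eq_zero_of_dvd_of_lt this (by omega)
  omega

variable [DecidableEq α]

/-- The new permutation sends `x` to `σ y` and then follows the cycle of `y`, which never meets `x`,
until it arrives at `y`. -/
theorem sameCycle_mul_swap_self [Finite α] {σ : Perm α} {x y : α} (h : ¬σ.SameCycle x y) :
    (σ * swap x y).SameCycle x y := by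
  have hne : ∀ k : ℕ, (σ ^ k) y ≠ x := fun k hk => h (Perm.SameCycle.symm ⟨k, by simpa using hk⟩)
  have key : ∀ k : ℕ, (σ * swap x y).SameCycle x ((σ ^ (k + 1)) y) := by
    intro k
    induction k with
    | zero => exact ⟨1, by simp⟩
    | succ k ih =>
      -- Once the walk is back at `y`, its next point `σ y` is the image of `x`. Otherwise neither
      -- swapped point is met and both permutations take the same step.
      by_cases hk : (σ ^ (k + 1)) y = y
      · rw [pow_succ', Perm.mul_apply, hk]
        exact ⟨1, by simp⟩
      · rw [pow_succ' σ (k + 1), Perm.mul_apply]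
        have : σ ((σ ^ (k + 1)) y) = (σ * swap x y) ((σ ^ (k + 1)) y) := by
          rw [Perm.mul_apply, swap_apply_of_ne_of_ne (hne _) hk]
        rw [this]
        exact Perm.sameCycle_apply_right.2 ih
  have hpos := orderOf_pos σ
  have := key (orderOf σ - 1)
  rwa [Nat.sub_add_cancel hpos, pow_orderOf_eq_one] at this

/-- The transposition merges the two cycles and changes no other. All facts on insertion, splitting
included, are derived from this merging. -/
theorem sameCycle_mul_swap [Finite α] {σ : Perm α} {x y : α} (h : ¬σ.SameCycle x y) {z w : α} :
    (σ * swap x y).SameCycle z w ↔ σ.SameCycle z w ∨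
      (σ.SameCycle x z ∨ σ.SameCycle y z) ∧ (σ.SameCycle x w ∨ σ.SameCycle y w) := by
  have hxy := sameCycle_mul_swap_self h
  have step : ∀ z, (σ * swap x y).SameCycle z (σ z) := by
    intro z
    by_cases hx : z = x
    · subst hx
      refine hxy.trans ⟨1, by simp⟩
    by_cases hy : z = y
    · subst hy
      refine hxy.symm.trans ⟨1, by simp⟩
    · exact ⟨1, by simp [swap_apply_of_ne_of_ne hx hy]⟩
  have mono : ∀ {z w}, σ.SameCycle z w → (σ * swap x y).SameCycle z w := by
    intro z w hzw
    refine (sameCycle_invariant (σ := σ) (p := fun v => (σ * swap x y).SameCycle z v) ?_ hzw).1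
      (Perm.SameCycle.refl _ _)
    exact fun v => ⟨fun hv => hv.trans (step v).symm, fun hv => hv.trans (step v)⟩
  have toX : ∀ {z}, (σ.SameCycle x z ∨ σ.SameCycle y z) → (σ * swap x y).SameCycle x z := by
    rintro z (hz | hz)
    · exact mono hz
    · exact hxy.trans (mono hz)
  constructor
  · intro hzw
    by_cases hz : σ.SameCycle x z ∨ σ.SameCycle y z
    · refine Or.inr ⟨hz, ?_⟩
      refine (sameCycle_invariant (p := fun v => σ.SameCycle x v ∨ σ.SameCycle y v) ?_ hzw).1 hz
      intro v
      by_cases hx : v = x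
      · subst hx; simp [Perm.SameCycle.refl]
      by_cases hy : v = y
      · subst hy; simp [Perm.SameCycle.refl]
      · simp [swap_apply_of_ne_of_ne hx hy]
    · refine Or.inl ((sameCycle_invariant (p := fun v => σ.SameCycle z v) ?_ hzw).1
        (Perm.SameCycle.refl _ _))
      push Not at hz
      intro v
      have hx : ¬σ.SameCycle z x := fun h => hz.1 h.symm
      have hy : ¬σ.SameCycle z y := fun h => hz.2 h.symm
      by_cases hvx : v = x
      · subst hvx; simp [hx, hy]
      by_cases hvy : v = y
      · subst hvy; simp [hx, hy]
      · simp [swap_apply_of_ne_of_ne hvx hvy]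
  · rintro (h | ⟨hz, hw⟩)
    · exact mono h
    · exact (toX hz).symm.trans (toX hw)

theorem permOrbit_mul_swap [Finite α] {σ : Perm α} {x y : α} (h : ¬σ.SameCycle x y) :
    permOrbit (σ * swap x y) x = permOrbit σ x ∪ permOrbit σ y := by
  ext z
  rw [mem_permOrbit, sameCycle_mul_swap h, Set.mem_union, mem_permOrbit, mem_permOrbit]
  constructor
  · rintro (h | h)
    · exact Or.inl h
    · exact h.2
  · exact fun h => Or.inr ⟨Or.inl (Perm.SameCycle.refl _ _), h⟩

theorem orbitSize_mul_swap [Finite α] {σ : Perm α} {x y : α} (h : ¬σ.SameCycle x y) :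
    orbitSize (σ * swap x y) x = orbitSize σ x + orbitSize σ y := by
  rw [orbitSize, permOrbit_mul_swap h, Set.ncard_union_eq _ (Set.toFinite _) (Set.toFinite _)]
  · rfl
  · exact Set.disjoint_left.2 fun z hz hz' => h (Perm.SameCycle.trans hz (Perm.SameCycle.symm hz'))

theorem permOrbit_mul_swap_of_not [Finite α] {σ : Perm α} {x y z : α} (h : ¬σ.SameCycle x y)
    (hx : ¬σ.SameCycle x z) (hy : ¬σ.SameCycle y z) :
    permOrbit (σ * swap x y) z = permOrbit σ z := by
  ext w
  rw [mem_permOrbit, sameCycle_mul_swap h, mem_permOrbit]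
  tauto

theorem orbitSize_mul_swap_of_not [Finite α] {σ : Perm α} {x y z : α} (h : ¬σ.SameCycle x y)
    (hx : ¬σ.SameCycle x z) (hy : ¬σ.SameCycle y z) :
    orbitSize (σ * swap x y) z = orbitSize σ z := by
  rw [orbitSize, permOrbit_mul_swap_of_not h hx hy, orbitSize]

theorem numOrbits_mul_swap [Finite α] {σ : Perm α} {x y : α} (h : ¬σ.SameCycle x y) :
    numOrbits (σ * swap x y) + 1 = numOrbits σ := by
  have hne : permOrbit σ x ≠ permOrbit σ y := fun h' => h (permOrbit_eq_iff.1 h')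
  -- Outside the merged orbit the two permutations have the same orbits; one orbit is removed on the
  -- left and two on the right.
  have key : Set.range (permOrbit (σ * swap x y)) \ {permOrbit (σ * swap x y) x} =
      (Set.range (permOrbit σ) \ {permOrbit σ x}) \ {permOrbit σ y} := by
    ext s
    simp only [Set.mem_sdiff, Set.mem_range, Set.mem_singleton_iff]
    constructor
    · rintro ⟨⟨z, rfl⟩, hz⟩
      rw [permOrbit_eq_iff, sameCycle_mul_swap h] at hz
      have hx : ¬σ.SameCycle x z := fun h' => hz (Or.inl h'.symm)
      have hy : ¬σ.SameCycle y z := fun h' =>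
        hz (Or.inr ⟨Or.inr h', Or.inl (Perm.SameCycle.refl _ _)⟩)
      rw [permOrbit_mul_swap_of_not h hx hy, permOrbit_eq_iff, permOrbit_eq_iff]
      exact ⟨⟨⟨z, rfl⟩, fun h' => hx h'.symm⟩, fun h' => hy h'.symm⟩
    · rintro ⟨⟨⟨z, rfl⟩, hx⟩, hy⟩
      rw [permOrbit_eq_iff] at hx hy
      have hx' : ¬σ.SameCycle x z := fun h => hx h.symm
      have hy' : ¬σ.SameCycle y z := fun h => hy h.symm
      refine ⟨⟨z, permOrbit_mul_swap_of_not h hx' hy'⟩, ?_⟩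
      rw [permOrbit_mul_swap h]
      intro h'
      have : z ∈ permOrbit σ x ∪ permOrbit σ y := by
        rw [← h']; exact Perm.SameCycle.refl σ z
      exact this.elim hx' hy'
  have h1 := Set.ncard_sdiff_singleton_add_one
    (Set.mem_range_self (f := permOrbit (σ * swap x y)) x) (Set.toFinite _)
  have h2 := Set.ncard_sdiff_singleton_add_one
    (Set.mem_range_self (f := permOrbit σ) x) (Set.toFinite _)
  have h3 := Set.ncard_sdiff_singleton_add_one
    (s := Set.range (permOrbit σ) \ {permOrbit σ x}) (a := permOrbit σ y)
    ⟨Set.mem_range_self y, hne.symm⟩ (Set.toFinite _)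
  rw [key] at h1
  simp only [numOrbits]
  omega

end Orbits

/-! ### Transitivity in terms of invariant predicates -/

section Connected

variable {α β : Type*}

/-- `R` and `L` generate a transitive group: every predicate invariant under both is constant. -/
def Connected (R L : Perm α) : Prop :=
  ∀ p : α → Prop, (∀ x, p (R x) ↔ p x) → (∀ x, p (L x) ↔ p x) → ∀ x y, p x → p y

/-- Being reachable from `x` is itself an invariant predicate; conversely, invariance passes from
the generators to the whole group. -/
theorem connected_iff_transitive {R L : Perm α} : Connected R L ↔
    ∀ x y : α, ∃ σ ∈ Subgroup.closure ({R, L} : Set (Perm α)), σ x = y := by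
  constructor
  · intro h x
    have hR : R ∈ Subgroup.closure ({R, L} : Set (Perm α)) := Subgroup.subset_closure (by simp)
    have hL : L ∈ Subgroup.closure ({R, L} : Set (Perm α)) := Subgroup.subset_closure (by simp)
    have step : ∀ τ ∈ Subgroup.closure ({R, L} : Set (Perm α)), ∀ z,
        (∃ σ ∈ Subgroup.closure ({R, L} : Set (Perm α)), σ x = τ z) ↔
          ∃ σ ∈ Subgroup.closure ({R, L} : Set (Perm α)), σ x = z := by
      intro τ hτ z
      constructor
      · rintro ⟨σ, hσ, h⟩
        exact ⟨τ⁻¹ * σ, mul_mem (inv_mem hτ) hσ, by simp [h]⟩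
      · rintro ⟨σ, hσ, h⟩
        exact ⟨τ * σ, mul_mem hτ hσ, by simp [h]⟩
    exact fun y => h (fun z => ∃ σ ∈ Subgroup.closure ({R, L} : Set (Perm α)), σ x = z)
      (step R hR) (step L hL) x y ⟨1, one_mem _, rfl⟩
  · intro h p hR hL x y hx
    obtain ⟨σ, hσ, rfl⟩ := h x y
    have : ∀ z, p (σ z) ↔ p z := by
      induction hσ using Subgroup.closure_induction with
      | mem τ hτ =>
        rcases hτ with h | h
        · rw [h]; exact hR
        · rw [Set.mem_singleton_iff.1 h]; exact hL
      | one => simp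
      | mul σ τ _ _ h1 h2 => intro z; rw [Perm.mul_apply, h1, h2]
      | inv σ _ h1 => intro z; rw [← h1]; simp
    exact (this x).2 hx

theorem Connected.map {R L : Perm α} {R' L' : Perm β} (e : α ≃ β)
    (hR : ∀ x, e (R x) = R' (e x)) (hL : ∀ x, e (L x) = L' (e x)) (h : Connected R L) :
    Connected R' L' := by
  intro p h1 h2 x y hx
  have := h (fun z => p (e z)) (fun z => by rw [hR, h1]) (fun z => by rw [hL, h2])
    (e.symm x) (e.symm y)
  simpa [hx] using this

theorem connected_mul_inv {R L : Perm α} (h : Connected R L) : Connected R (R * L)⁻¹ := by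
  intro p h1 h2 x y hx
  refine h p h1 (fun z => ?_) x y hx
  rw [← h1, ← h2]
  simp

end Connected

/-! ### Insertion of a dart into a pair of permutations -/

section Insertion

variable {β : Type*}

/-- The permutation `σ` extended by the fixed point `none`. -/
def fixNone (σ : Perm β) : Perm (Option β) := optionCongr σ

@[simp] theorem fixNone_none (σ : Perm β) : fixNone σ none = none := rfl

@[simp] theorem fixNone_some (σ : Perm β) (x : β) : fixNone σ (some x) = some (σ x) := rfl

@[simp] theorem fixNone_mul (σ τ : Perm β) : fixNone (σ * τ) = fixNone σ * fixNone τ := by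
  ext1 (_ | z) <;> simp

@[simp] theorem fixNone_inv (σ : Perm β) : fixNone σ⁻¹ = (fixNone σ)⁻¹ := by
  rw [eq_inv_iff_mul_eq_one]
  ext1 (_ | z) <;> simp

theorem sameCycle_fixNone_some {σ : Perm β} {x y : β} :
    (fixNone σ).SameCycle (some x) (some y) ↔ σ.SameCycle x y :=
  sameCycle_map (Option.some_injective β) (fun _ => rfl)

theorem not_sameCycle_fixNone_none {σ : Perm β} {x : β} :
    ¬(fixNone σ).SameCycle none (some x) := by
  intro h
  have := sameCycle_invariant (p := fun z => z = none)
    (by rintro (_ | z) <;> simp) h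
  simp at this

theorem orbitSize_fixNone_some (σ : Perm β) (x : β) :
    orbitSize (fixNone σ) (some x) = orbitSize σ x :=
  orbitSize_map (Option.some_injective β) (fun _ => rfl) x

theorem orbitSize_fixNone_none (σ : Perm β) : orbitSize (fixNone σ) none = 1 :=
  orbitSize_of_apply_eq (by simp)

theorem numOrbits_fixNone [Finite β] (σ : Perm β) : numOrbits (fixNone σ) = numOrbits σ + 1 := by
  have h1 : numOrbits (1 : Perm Unit) = 1 := by
    rw [numOrbits, Set.ncard_eq_one]
    exact ⟨permOrbit 1 (), Set.range_unique⟩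
  rw [← h1]
  refine numOrbits_add (i := some) (j := fun _ => none) (Option.some_injective β)
    (fun _ _ _ => rfl) (fun _ _ => by simp) ?_ (fun _ => rfl) (fun _ => by simp)
  rintro (_ | z)
  · exact Or.inr ⟨(), rfl⟩
  · exact Or.inl ⟨z, rfl⟩

variable [DecidableEq β]

/-- Moves a transposition from the left to the right, where its effect on orbits is known. -/
theorem fixNone_mul_swap (σ : Perm β) (v : Option β) :
    swap none v * fixNone σ = fixNone σ * swap none (fixNone σ⁻¹ v) := by
  have := swap_apply_apply (fixNone σ)⁻¹ none v
  rw [← fixNone_inv, fixNone_none, fixNone_inv, inv_inv] at this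
  rw [fixNone_inv, this]
  simp only [← mul_assoc, mul_inv_cancel, one_mul]

/-- Adjoin the dart `none` to the permutation `L`, as the preimage of what maps to `u`. -/
def insertL (L : Perm β) (u : Option β) : Perm (Option β) := swap none u * fixNone L

/-- Adjoin the dart `none` to `R` in such a way that `insertR R u w * insertL L u` is `R * L` with
`none` adjoined. -/
def insertR (R : Perm β) (u w : Option β) : Perm (Option β) :=
  fixNone R * swap none w * swap none u

/-- The two factors `swap none u` cancel. Hence the hyperedges see only `u`, the faces only `w`, and
the vertices alone depend on both. -/
theorem insertR_mul_insertL (R L : Perm β) (u w : Option β) :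
    insertR R u w * insertL L u = fixNone (R * L) * swap none (fixNone L⁻¹ w) := by
  rw [fixNone_mul, mul_assoc (fixNone R), ← fixNone_mul_swap]
  ext1 z
  simp [insertR, insertL]

theorem insertR_none_none (R : Perm β) : insertR R none none = fixNone R := by
  ext1 z; simp [insertR]

theorem insertR_none_some (R : Perm β) (b : β) :
    insertR R none (some b) = fixNone R * swap none (some b) := by
  ext1 z; simp [insertR]

theorem insertR_some_none (R : Perm β) (a : β) :
    insertR R (some a) none = fixNone R * swap none (some a) := by
  ext1 z; simp [insertR]

theorem insertR_mul_swap (R : Perm β) (a b : β) :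
    insertR R (some a) (some b) * swap none (some a) = fixNone R * swap none (some b) := by
  rw [insertR, mul_assoc, swap_mul_self, mul_one]

/-- Every pair of permutations of `Option β` arises from exactly one insertion of `none`. -/
theorem insert_bijective : Function.Bijective
    (fun x : (Option β × Option β) × Perm β × Perm β =>
      ((insertR x.2.1 x.1.1 x.1.2, insertL x.2.2 x.1.1) :
        Perm (Option β) × Perm (Option β))) := by
  constructor
  · rintro ⟨⟨u, w⟩, R, L⟩ ⟨⟨u', w'⟩, R', L'⟩ h
    simp only [Prod.mk.injEq] at h
    obtain ⟨h1, h2⟩ := h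
    have h3 := Perm.decomposeOption.symm.injective (a₁ := (u, L)) (a₂ := (u', L'))
      h2
    simp only [Prod.mk.injEq] at h3
    obtain ⟨rfl, rfl⟩ := h3
    have h4 := mul_right_cancel h1
    -- The inverse of `fixNone R * swap none w` is `swap none w * fixNone R⁻¹`, which is again the
    -- normal form of `Perm.decomposeOption`.
    have h5 := Perm.decomposeOption.symm.injective (a₁ := (w, R⁻¹)) (a₂ := (w', R'⁻¹)) (by
      have := congrArg (fun σ => σ⁻¹) h4
      simp only [mul_inv_rev, swap_inv, ← fixNone_inv] at this
      exact this)
    simp only [Prod.mk.injEq, inv_inj] at h5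
    obtain ⟨rfl, rfl⟩ := h5
    rfl
  · rintro ⟨R, L⟩
    obtain ⟨⟨u, L'⟩, rfl⟩ := Perm.decomposeOption.symm.surjective L
    obtain ⟨⟨w, R'⟩, hw⟩ := Perm.decomposeOption.symm.surjective (R * swap none u)⁻¹
    refine ⟨((u, w), R'⁻¹, L'), ?_⟩
    simp only [Prod.mk.injEq]
    refine ⟨?_, rfl⟩
    have h : R * swap none u = (Perm.decomposeOption.symm (w, R'))⁻¹ := by rw [hw, inv_inv]
    have h' : R = (Perm.decomposeOption.symm (w, R'))⁻¹ * swap none u := by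
      rw [← h, mul_assoc, swap_mul_self, mul_one]
    rw [h', insertR, fixNone_inv]
    simp only [Perm.decomposeOption, coe_fn_symm_mk, mul_inv_rev, swap_inv]
    rfl

/-- An invariant predicate of the enlarged pair is an invariant predicate `q` of the old one
together with a value `c` at `none`; the insertion forces `q` to have the value `c` at those of `u`,
`w` that are darts. -/
theorem connected_insert {R L : Perm β} {u w : Option β} :
    Connected (insertR R u w) (insertL L u) ↔
      ∀ q : β → Prop, (∀ x, q (R x) ↔ q x) → (∀ x, q (L x) ↔ q x) → ∀ c : Prop,
        (∀ a, u = some a → (q a ↔ c)) → (∀ b, w = some b → (q b ↔ c)) → ∀ x, q x ↔ c := by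
  have swapInv : ∀ (p : Option β → Prop) (v : Option β), (p v ↔ p none) →
      ∀ z, p (swap none v z) ↔ p z := by
    intro p v hv z
    by_cases h1 : z = none
    · subst h1; simp [hv]
    by_cases h2 : z = v
    · subst h2; simp [hv]
    · rw [swap_apply_of_ne_of_ne h1 h2]
  constructor
  · intro h q hR hL c hu hw x
    let p : Option β → Prop := fun z => z.elim c q
    have hpR : ∀ z, p (fixNone R z) ↔ p z := by
      rintro (_ | z)
      · rfl
      · exact hR z
    have hpL : ∀ z, p (fixNone L z) ↔ p z := by
      rintro (_ | z)
      · rfl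
      · exact hL z
    have hpu : p u ↔ p none := by
      cases u with
      | none => rfl
      | some a => exact hu a rfl
    have hpw : p w ↔ p none := by
      cases w with
      | none => rfl
      | some a => exact hw a rfl
    have key := h p (fun z => by
      rw [insertR, Perm.mul_apply, Perm.mul_apply, hpR, swapInv p w hpw, swapInv p u hpu])
      (fun z => by rw [insertL, Perm.mul_apply, swapInv p u hpu, hpL])
    exact ⟨key (some x) none, key none (some x)⟩
  · intro h p hR hL
    have hpu : p u ↔ p none := by
      have := hL none
      simpa [insertL] using this
    have hpL : ∀ z, p (fixNone L z) ↔ p z := by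
      intro z
      rw [← hL z, insertL, Perm.mul_apply, swapInv p u hpu]
    have hR' : ∀ z, p (fixNone R (swap none w z)) ↔ p z := by
      intro z
      have := hR (swap none u z)
      rw [insertR, Perm.mul_apply, swap_apply_self, Perm.mul_apply] at this
      rw [this, swapInv p u hpu]
    have hpw : p w ↔ p none := by
      have := hR' w
      rw [swap_apply_right] at this
      exact this.symm
    have hpR : ∀ z, p (fixNone R z) ↔ p z := by
      intro z
      have := hR' (swap none w z)
      rw [swap_apply_self] at this
      rw [this, swapInv p w hpw]
    have key := h (fun z => p (some z)) (fun z => hpR (some z)) (fun z => hpL (some z)) (p none)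
      (fun a ha => by rw [← ha]; exact hpu) (fun a ha => by rw [← ha]; exact hpw)
    have key' : ∀ z, p z ↔ p none := by
      rintro (_ | z)
      · rfl
      · exact key z
    intro x y hx
    rw [key'] at hx ⊢
    exact hx

variable [Finite β]

theorem numOrbits_fixNone_mul_swap (σ : Perm β) (b : β) :
    numOrbits (fixNone σ * swap none (some b)) = numOrbits σ := by
  have h1 := numOrbits_mul_swap (not_sameCycle_fixNone_none (σ := σ) (x := b))
  have h2 := numOrbits_fixNone σ
  omega

theorem numOrbits_insertL_none (L : Perm β) : numOrbits (insertL L none) = numOrbits L + 1 := by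
  rw [insertL, swap_self]
  exact numOrbits_fixNone L

theorem numOrbits_insertL_some (L : Perm β) (a : β) :
    numOrbits (insertL L (some a)) = numOrbits L := by
  rw [insertL, fixNone_mul_swap]
  rw [fixNone_some, numOrbits_fixNone_mul_swap]

theorem numOrbits_insertR_mul_insertL_none (R L : Perm β) (u : Option β) :
    numOrbits (insertR R u none * insertL L u) = numOrbits (R * L) + 1 := by
  rw [insertR_mul_insertL]
  rw [fixNone_none, swap_self]
  exact numOrbits_fixNone _

theorem numOrbits_insertR_mul_insertL_some (R L : Perm β) (u : Option β) (b : β) :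
    numOrbits (insertR R u (some b) * insertL L u) = numOrbits (R * L) := by
  rw [insertR_mul_insertL]
  rw [fixNone_some, numOrbits_fixNone_mul_swap]

/-! ### Insertion into one orbit -/

section One

variable {R : Perm β} {b z z' : β}

theorem sameCycle_insertOne_none :
    (fixNone R * swap none (some b)).SameCycle none (some z) ↔ R.SameCycle b z := by
  rw [sameCycle_mul_swap not_sameCycle_fixNone_none, sameCycle_fixNone_some]
  have h1 := not_sameCycle_fixNone_none (σ := R) (x := z)
  have h2 := Perm.SameCycle.refl (fixNone R) none
  tauto

theorem sameCycle_insertOne_some :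
    (fixNone R * swap none (some b)).SameCycle (some z) (some z') ↔ R.SameCycle z z' := by
  rw [sameCycle_mul_swap not_sameCycle_fixNone_none]
  simp only [sameCycle_fixNone_some, not_sameCycle_fixNone_none, false_or]
  exact ⟨fun h => h.elim id fun h => h.1.symm.trans h.2, Or.inl⟩

theorem orbitSize_insertOne_none :
    orbitSize (fixNone R * swap none (some b)) none = orbitSize R b + 1 := by
  rw [orbitSize_mul_swap not_sameCycle_fixNone_none, orbitSize_fixNone_none,
    orbitSize_fixNone_some, add_comm]

theorem orbitSize_insertOne_some (h : ¬R.SameCycle b z) :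
    orbitSize (fixNone R * swap none (some b)) (some z) = orbitSize R z := by
  rw [orbitSize_mul_swap_of_not not_sameCycle_fixNone_none not_sameCycle_fixNone_none
    (by rwa [sameCycle_fixNone_some]), orbitSize_fixNone_some]

end One

/-! ### Insertion joining two orbits -/

section Join

variable {R : Perm β} {a b z z' : β}

theorem not_sameCycle_insertOne (hab : ¬R.SameCycle a b) :
    ¬(fixNone R * swap none (some b)).SameCycle none (some a) := by
  rw [sameCycle_insertOne_none]
  exact fun h => hab h.symm

/-- `swap none (some b)` splices `none` into the orbit of `b`, and `swap none (some a)` then merges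
the result with the orbit of `a`. -/
theorem sameCycle_insertR_none (hab : ¬R.SameCycle a b) :
    (insertR R (some a) (some b)).SameCycle none (some z) ↔
      R.SameCycle a z ∨ R.SameCycle b z := by
  rw [insertR, sameCycle_mul_swap (not_sameCycle_insertOne hab)]
  simp only [sameCycle_insertOne_none, sameCycle_insertOne_some]
  have := Perm.SameCycle.refl (fixNone R * swap none (some b)) none
  tauto

theorem sameCycle_insertR_some (hab : ¬R.SameCycle a b) :
    (insertR R (some a) (some b)).SameCycle (some z) (some z') ↔ R.SameCycle z z' ∨
      (R.SameCycle a z ∨ R.SameCycle b z) ∧ (R.SameCycle a z' ∨ R.SameCycle b z') := by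
  rw [insertR, sameCycle_mul_swap (not_sameCycle_insertOne hab)]
  simp only [sameCycle_insertOne_none, sameCycle_insertOne_some]
  tauto

theorem orbitSize_insertR_none (hab : ¬R.SameCycle a b) :
    orbitSize (insertR R (some a) (some b)) none = orbitSize R a + orbitSize R b + 1 := by
  rw [insertR, orbitSize_mul_swap (not_sameCycle_insertOne hab), orbitSize_insertOne_none]
  have : orbitSize (fixNone R * swap none (some b)) (some a) = orbitSize R a :=
    orbitSize_insertOne_some fun h => hab h.symm
  omega

theorem orbitSize_insertR_some (hab : ¬R.SameCycle a b) (ha : ¬R.SameCycle a z)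
    (hb : ¬R.SameCycle b z) :
    orbitSize (insertR R (some a) (some b)) (some z) = orbitSize R z := by
  rw [insertR, orbitSize_mul_swap_of_not (not_sameCycle_insertOne hab)
    (by rwa [sameCycle_insertOne_none]) (by rwa [sameCycle_insertOne_some]),
    orbitSize_insertOne_some hb]

theorem numOrbits_insertR_of_not_sameCycle (hab : ¬R.SameCycle a b) :
    numOrbits (insertR R (some a) (some b)) + 1 = numOrbits R := by
  rw [insertR, numOrbits_mul_swap (not_sameCycle_insertOne hab), numOrbits_fixNone_mul_swap]

end Join

/-! ### Insertion splitting an orbit -/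

section Split

variable {R : Perm β} {a z z' : β} {k : ℕ}

/-- The new permutation leads from `none` to `R a` and follows `R` up to the dart `(R ^ k) a`, which
it sends back to `none`. -/
theorem insertR_pow_none (hk : k < orbitSize R a) {i : ℕ} (hi : i + 1 ≤ k) :
    (insertR R (some a) (some ((R ^ k) a)) ^ (i + 1)) none = some ((R ^ (i + 1)) a) := by
  have hne : ∀ {i j : ℕ}, i < j → j ≤ k → (R ^ i) a ≠ (R ^ j) a := fun hij hj h => by
    have := pow_injOn (by omega) (by omega) h
    omega
  induction i with
  | zero =>
    have : a ≠ (R ^ k) a := by simpa using hne (i := 0) (j := k) (by omega) le_rfl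
    simp [insertR, swap_apply_of_ne_of_ne, this]
  | succ i ih =>
    rw [pow_succ', Perm.mul_apply, ih (by omega), pow_succ' R (i + 1), Perm.mul_apply]
    have h1 := hne (i := 0) (j := i + 1) (by omega) (by omega)
    have h2 := hne (i := i + 1) (j := k) (by omega) le_rfl
    simp only [pow_zero, Perm.one_apply] at h1
    rw [insertR, Perm.mul_apply, Perm.mul_apply, swap_apply_of_ne_of_ne (x := some _) (by simp)
      (by simpa using h1.symm), swap_apply_of_ne_of_ne (by simp) (by simpa using h2)]
    rfl

theorem insertR_pow_succ_none (hk : k < orbitSize R a) :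
    (insertR R (some a) (some ((R ^ k) a)) ^ (k + 1)) none = none := by
  cases k with
  | zero => simp [insertR]
  | succ k =>
    rw [pow_succ', Perm.mul_apply, insertR_pow_none hk le_rfl]
    have : (R ^ (k + 1)) a ≠ a := by
      intro h
      have := pow_injOn (i := 0) (j := k + 1) (by omega) hk (by simpa using h.symm)
      omega
    rw [insertR, Perm.mul_apply, swap_apply_of_ne_of_ne (by simp) (by simpa using this),
      Perm.mul_apply, swap_apply_right]
    rfl

/-- The iterates of order `1` to `k` are darts of `β`, so the first return to `none` is at `k + 1`.
-/
theorem orbitSize_insertR_pow_none (hk : k < orbitSize R a) :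
    orbitSize (insertR R (some a) (some ((R ^ k) a))) none = k + 1 := by
  have h1 := (pow_apply_eq_iff _ _ _).1 (insertR_pow_succ_none hk)
  have hle := Nat.le_of_dvd (by omega) h1
  by_contra hne
  have hpos := orbitSize_pos (insertR R (some a) (some ((R ^ k) a))) none
  obtain ⟨j, hj⟩ := Nat.exists_eq_add_of_le' hpos
  have h2 := (pow_apply_eq_iff (insertR R (some a) (some ((R ^ k) a))) none _).2 dvd_rfl
  rw [hj, insertR_pow_none hk (by omega)] at h2
  simp at h2

theorem not_sameCycle_insertR_pow (hk : k < orbitSize R a) :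
    ¬(insertR R (some a) (some ((R ^ k) a))).SameCycle none (some a) := by
  intro h
  obtain ⟨j, hj, h⟩ := exists_pow_eq_of_sameCycle h
  rw [orbitSize_insertR_pow_none hk] at hj
  cases j with
  | zero => simp at h
  | succ j =>
    rw [insertR_pow_none hk (by omega), Option.some_inj] at h
    have := pow_injOn (σ := R) (x := a) (i := 0) (j := j + 1) (by omega) (by omega)
      (by simpa using h.symm)
    omega

/-- Splitting is merging read backwards: one more factor `swap none (some a)` reunites the two parts
and leaves `R` with `none` spliced in. -/
theorem sameCycle_iff_insertR_pow (hk : k < orbitSize R a) : R.SameCycle z z' ↔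
    (insertR R (some a) (some ((R ^ k) a))).SameCycle (some z) (some z') ∨
      ((insertR R (some a) (some ((R ^ k) a))).SameCycle none (some z) ∨
        (insertR R (some a) (some ((R ^ k) a))).SameCycle (some a) (some z)) ∧
      ((insertR R (some a) (some ((R ^ k) a))).SameCycle none (some z') ∨
        (insertR R (some a) (some ((R ^ k) a))).SameCycle (some a) (some z')) := by
  rw [← sameCycle_mul_swap (not_sameCycle_insertR_pow hk), insertR_mul_swap,
    sameCycle_insertOne_some]

theorem sameCycle_self_iff_insertR_pow (hk : k < orbitSize R a) : R.SameCycle a z ↔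
    (insertR R (some a) (some ((R ^ k) a))).SameCycle none (some z) ∨
      (insertR R (some a) (some ((R ^ k) a))).SameCycle (some a) (some z) := by
  rw [sameCycle_iff_insertR_pow hk]
  have := Perm.SameCycle.refl (insertR R (some a) (some ((R ^ k) a))) (some a)
  tauto

theorem orbitSize_insertR_pow_self (hk : k < orbitSize R a) :
    orbitSize (insertR R (some a) (some ((R ^ k) a))) (some a) + k = orbitSize R a := by
  have h1 := orbitSize_mul_swap (not_sameCycle_insertR_pow hk)
  rw [insertR_mul_swap, orbitSize_insertOne_none, orbitSize_insertR_pow_none hk] at h1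
  have : orbitSize R ((R ^ k) a) = orbitSize R a :=
    orbitSize_congr (Perm.SameCycle.symm ⟨k, by simp⟩)
  omega

theorem orbitSize_insertR_pow_some (hk : k < orbitSize R a) (h : ¬R.SameCycle a z) :
    orbitSize (insertR R (some a) (some ((R ^ k) a))) (some z) = orbitSize R z := by
  have h' := h
  rw [sameCycle_self_iff_insertR_pow hk, not_or] at h'
  rw [← orbitSize_mul_swap_of_not (not_sameCycle_insertR_pow hk) h'.1 h'.2, insertR_mul_swap,
    orbitSize_insertOne_some]
  exact fun hz => h (Perm.SameCycle.trans ⟨k, by simp⟩ hz)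

theorem numOrbits_insertR_pow (hk : k < orbitSize R a) :
    numOrbits (insertR R (some a) (some ((R ^ k) a))) = numOrbits R + 1 := by
  rw [← numOrbits_mul_swap (not_sameCycle_insertR_pow hk), insertR_mul_swap,
    numOrbits_fixNone_mul_swap]

end Split

end Insertion

/-! ### Connectedness after an insertion, and the two components of a disconnected pair -/

section Components

variable {β : Type*} {R L : Perm β}

theorem connected_iff_forall_iff (a : β) : Connected R L ↔
    ∀ q : β → Prop, (∀ x, q (R x) ↔ q x) → (∀ x, q (L x) ↔ q x) → ∀ x, q x ↔ q a :=
  ⟨fun h q h1 h2 x => ⟨h q h1 h2 x a, h q h1 h2 a x⟩,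
    fun h q h1 h2 x y => by rw [h q h1 h2 x, h q h1 h2 y]; exact id⟩

theorem connected_insert_none_none [DecidableEq β] :
    Connected (insertR R none none) (insertL L none) ↔ IsEmpty β := by
  rw [connected_insert]
  constructor
  · intro h
    refine ⟨fun x => ?_⟩
    have := h (fun _ => True) (by simp) (by simp) False (by simp) (by simp) x
    simp at this
  · intro h _ _ _ _ _ _ x
    exact h.elim x

theorem connected_insert_none_some [DecidableEq β] {b : β} :
    Connected (insertR R none (some b)) (insertL L none) ↔ Connected R L := by
  rw [connected_insert, connected_iff_forall_iff b]
  constructor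
  · exact fun h q h1 h2 => h q h1 h2 (q b) (by simp) (by simp)
  · intro h q h1 h2 c _ hb x
    rw [h q h1 h2 x, hb b rfl]

theorem connected_insert_some_none [DecidableEq β] {a : β} :
    Connected (insertR R (some a) none) (insertL L (some a)) ↔ Connected R L := by
  rw [connected_insert, connected_iff_forall_iff a]
  constructor
  · exact fun h q h1 h2 => h q h1 h2 (q a) (by simp) (by simp)
  · intro h q h1 h2 c ha _ x
    rw [h q h1 h2 x, ha a rfl]

theorem connected_insert_some_some [DecidableEq β] {a b : β} :
    Connected (insertR R (some a) (some b)) (insertL L (some a)) ↔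
      ∀ q : β → Prop, (∀ x, q (R x) ↔ q x) → (∀ x, q (L x) ↔ q x) → (q a ↔ q b) →
        ∀ x, q x ↔ q a := by
  rw [connected_insert]
  constructor
  · exact fun h q h1 h2 hab => h q h1 h2 (q a) (by simp) (by simp [hab])
  · intro h q h1 h2 c ha hb x
    rw [h q h1 h2 ((ha a rfl).trans (hb b rfl).symm), ha a rfl]

theorem Connected.insert [DecidableEq β] {a b : β} (h : Connected R L) :
    Connected (insertR R (some a) (some b)) (insertL L (some a)) :=
  connected_insert_some_some.2 fun q h1 h2 _ => (connected_iff_forall_iff a).1 h q h1 h2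

/-- An invariant predicate already agrees at two darts of one vertex, so the new dart connects
nothing new. -/
theorem connected_insert_of_sameCycle [DecidableEq β] {a b : β} (hab : R.SameCycle a b) :
    Connected (insertR R (some a) (some b)) (insertL L (some a)) ↔ Connected R L := by
  refine ⟨fun h => ?_, fun h => h.insert⟩
  rw [connected_insert_some_some] at h
  exact (connected_iff_forall_iff a).2 fun q h1 h2 => h q h1 h2 (sameCycle_invariant h1 hab)

variable [DecidableEq β] {A : Finset β}

/-- The permutation that acts as `σ` on `A` and as `τ` off `A`. -/
def glue (σ : Perm {x // x ∈ A}) (τ : Perm {x // x ∉ A}) : Perm β := Perm.subtypeCongr σ τ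

theorem glue_left (σ : Perm {x // x ∈ A}) (τ : Perm {x // x ∉ A}) (x : {x // x ∈ A}) :
    ((σ x : {x // x ∈ A}) : β) = glue σ τ x := (Perm.subtypeCongr.left_apply_subtype σ τ x).symm

theorem glue_right (σ : Perm {x // x ∈ A}) (τ : Perm {x // x ∉ A}) (x : {x // x ∉ A}) :
    ((τ x : {x // x ∉ A}) : β) = glue σ τ x := (Perm.subtypeCongr.right_apply_subtype σ τ x).symm

theorem glue_mul (σ σ' : Perm {x // x ∈ A}) (τ τ' : Perm {x // x ∉ A}) :
    glue σ τ * glue σ' τ' = glue (σ * σ') (τ * τ') := by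
  ext1 x
  by_cases h : x ∈ A
  · have h1 := glue_left σ' τ' ⟨x, h⟩
    have h2 := glue_left (σ * σ') (τ * τ') ⟨x, h⟩
    have h3 := glue_left σ τ (σ' ⟨x, h⟩)
    simp only at h1 h2
    rw [Perm.mul_apply, ← h1, ← h2, ← h3, Perm.mul_apply]
  · have h1 := glue_right σ' τ' ⟨x, h⟩
    have h2 := glue_right (σ * σ') (τ * τ') ⟨x, h⟩
    have h3 := glue_right σ τ (τ' ⟨x, h⟩)
    simp only at h1 h2
    rw [Perm.mul_apply, ← h1, ← h2, ← h3, Perm.mul_apply]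

theorem glue_mem_iff (σ : Perm {x // x ∈ A}) (τ : Perm {x // x ∉ A}) (x : β) :
    glue σ τ x ∈ A ↔ x ∈ A := by
  by_cases h : x ∈ A
  · have h1 := glue_left σ τ ⟨x, h⟩
    simp only at h1
    simp [← h1, h]
  · have h1 := glue_right σ τ ⟨x, h⟩
    simp only at h1
    rw [← h1]
    simp only [h, iff_false]
    exact (τ ⟨x, h⟩).2

theorem glue_injective {σ σ' : Perm {x // x ∈ A}} {τ τ' : Perm {x // x ∉ A}}
    (h : glue σ τ = glue σ' τ') : σ = σ' ∧ τ = τ' := by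
  constructor
  · ext1 x
    exact Subtype.ext (by rw [glue_left σ τ, glue_left σ' τ', h])
  · ext1 x
    exact Subtype.ext (by rw [glue_right σ τ, glue_right σ' τ', h])

theorem exists_glue_eq (h : ∀ x, R x ∈ A ↔ x ∈ A) :
    ∃ (σ : Perm {x // x ∈ A}) (τ : Perm {x // x ∉ A}), R = glue σ τ := by
  refine ⟨R.subtypePerm h, R.subtypePerm fun x => not_congr (h x), ?_⟩
  ext1 x
  by_cases hx : x ∈ A
  · exact glue_left (R.subtypePerm h) (R.subtypePerm fun x => not_congr (h x)) ⟨x, hx⟩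
  · exact glue_right (R.subtypePerm h) (R.subtypePerm fun x => not_congr (h x)) ⟨x, hx⟩

theorem sameCycle_glue_left {σ : Perm {x // x ∈ A}} {τ : Perm {x // x ∉ A}} {x y : {x // x ∈ A}} :
    (glue σ τ).SameCycle x y ↔ σ.SameCycle x y :=
  sameCycle_map Subtype.val_injective (glue_left σ τ)

theorem sameCycle_glue_right {σ : Perm {x // x ∈ A}} {τ : Perm {x // x ∉ A}}
    {x y : {x // x ∉ A}} : (glue σ τ).SameCycle x y ↔ τ.SameCycle x y :=
  sameCycle_map Subtype.val_injective (glue_right σ τ)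

theorem mem_iff_of_sameCycle_glue {σ : Perm {x // x ∈ A}} {τ : Perm {x // x ∉ A}} {x y : β}
    (h : (glue σ τ).SameCycle x y) : x ∈ A ↔ y ∈ A :=
  sameCycle_invariant (glue_mem_iff σ τ) h

theorem orbitSize_glue_left (σ : Perm {x // x ∈ A}) (τ : Perm {x // x ∉ A}) (x : {x // x ∈ A}) :
    orbitSize (glue σ τ) x = orbitSize σ x :=
  orbitSize_map Subtype.val_injective (glue_left σ τ) x

theorem orbitSize_glue_right (σ : Perm {x // x ∈ A}) (τ : Perm {x // x ∉ A})
    (x : {x // x ∉ A}) : orbitSize (glue σ τ) x = orbitSize τ x :=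
  orbitSize_map Subtype.val_injective (glue_right σ τ) x

theorem numOrbits_glue [Finite β] (σ : Perm {x // x ∈ A}) (τ : Perm {x // x ∉ A}) :
    numOrbits (glue σ τ) = numOrbits σ + numOrbits τ := by
  refine numOrbits_add (i := Subtype.val) (j := Subtype.val) Subtype.val_injective
    Subtype.val_injective (fun x y h => y.2 (h ▸ x.2)) (fun z => ?_) (glue_left σ τ)
    (glue_right σ τ)
  by_cases h : z ∈ A
  · exact Or.inl ⟨⟨z, h⟩, rfl⟩
  · exact Or.inr ⟨⟨z, h⟩, rfl⟩

theorem connected_insert_glue {σ σ' : Perm {x // x ∈ A}} {τ τ' : Perm {x // x ∉ A}}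
    (hl : Connected σ σ') (hr : Connected τ τ') {a b : β} (ha : a ∈ A) (hb : b ∉ A) :
    Connected (insertR (glue σ τ) (some a) (some b)) (insertL (glue σ' τ') (some a)) := by
  rw [connected_insert_some_some]
  intro q h1 h2 hab x
  by_cases h : x ∈ A
  · exact (connected_iff_forall_iff ⟨a, ha⟩).1 hl (fun z => q z)
      (fun z => by simp only [glue_left σ τ, h1])
      (fun z => by simp only [glue_left σ' τ', h2]) ⟨x, h⟩
  · rw [hab]
    exact (connected_iff_forall_iff ⟨b, hb⟩).1 hr (fun z => q z)
      (fun z => by simp only [glue_right σ τ, h1])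
      (fun z => by simp only [glue_right σ' τ', h2]) ⟨x, h⟩

theorem not_connected_glue {σ σ' : Perm {x // x ∈ A}} {τ τ' : Perm {x // x ∉ A}} {a b : β}
    (ha : a ∈ A) (hb : b ∉ A) : ¬Connected (glue σ τ) (glue σ' τ') := fun h =>
  hb (h (fun x => x ∈ A) (glue_mem_iff σ τ) (glue_mem_iff σ' τ') a b ha)

omit [DecidableEq β] in
theorem invariant_extend {p : β → Prop} (hp : ∀ x, p (R x) ↔ p x) (q : Subtype p → Prop)
    (hq : ∀ x : Subtype p, q ⟨R x, (hp x).2 x.2⟩ ↔ q x) (x : β) :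
    (∃ h : p (R x), q ⟨R x, h⟩) ↔ ∃ h : p x, q ⟨x, h⟩ := by
  constructor
  · rintro ⟨h, h'⟩
    exact ⟨(hp x).1 h, (hq ⟨x, (hp x).1 h⟩).1 h'⟩
  · rintro ⟨h, h'⟩
    exact ⟨(hp x).2 h, (hq ⟨x, h⟩).2 h'⟩

/-- If the insertion of a dart joins a disconnected pair of permutations to a connected one, the
pair has exactly two components. -/
theorem exists_components [Fintype β] {a b : β}
    (hc : Connected (insertR R (some a) (some b)) (insertL L (some a)))
    (hn : ¬Connected R L) :
    ∃ (A : Finset β) (σ σ' : Perm {x // x ∈ A}) (τ τ' : Perm {x // x ∉ A}),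
      a ∈ A ∧ b ∉ A ∧ R = glue σ τ ∧ L = glue σ' τ' ∧ Connected σ σ' ∧ Connected τ τ' := by
  classical
  rw [connected_insert_some_some] at hc
  -- The component of `a`, described by invariant predicates instead of paths.
  let A : Finset β := Finset.univ.filter fun z =>
    ∀ q : β → Prop, (∀ x, q (R x) ↔ q x) → (∀ x, q (L x) ↔ q x) → q a → q z
  have hA : ∀ z, z ∈ A ↔ ∀ q : β → Prop, (∀ x, q (R x) ↔ q x) → (∀ x, q (L x) ↔ q x) →
      q a → q z := fun z => by simp [A]
  have hAR : ∀ x, R x ∈ A ↔ x ∈ A := fun x => by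
    rw [hA, hA]
    exact forall_congr' fun q => forall_congr' fun h1 => by rw [h1]
  have hAL : ∀ x, L x ∈ A ↔ x ∈ A := fun x => by
    rw [hA, hA]
    exact forall_congr' fun q => forall_congr' fun h1 => forall_congr' fun h2 => by rw [h2]
  have ha : a ∈ A := (hA a).2 fun _ _ _ h => h
  have hb : b ∉ A := by
    -- With `b` in `A`, every invariant predicate would agree at `a` and `b`; this is the only extra
    -- condition in `hc`, so `R` and `L` would be connected.
    intro hb
    refine hn ((connected_iff_forall_iff a).2 fun q h1 h2 => hc q h1 h2 ?_)
    refine ⟨(hA b).1 hb q h1 h2, fun h => ?_⟩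
    by_contra h'
    exact (hA b).1 hb (fun z => ¬q z) (fun x => not_congr (h1 x)) (fun x => not_congr (h2 x)) h' h
  obtain ⟨σ, τ, hR⟩ := exists_glue_eq hAR
  obtain ⟨σ', τ', hL⟩ := exists_glue_eq hAL
  have hσ : ∀ x : {x // x ∈ A}, (⟨R x, (hAR x).2 x.2⟩ : {x // x ∈ A}) = σ x := fun x =>
    Subtype.ext ((congrArg (fun ρ : Perm β => ρ x) hR).trans (glue_left σ τ x).symm)
  have hσ' : ∀ x : {x // x ∈ A}, (⟨L x, (hAL x).2 x.2⟩ : {x // x ∈ A}) = σ' x := fun x =>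
    Subtype.ext ((congrArg (fun ρ : Perm β => ρ x) hL).trans (glue_left σ' τ' x).symm)
  have hτ : ∀ x : {x // x ∉ A}, (⟨R x, (not_congr (hAR x)).2 x.2⟩ : {x // x ∉ A}) = τ x :=
    fun x => Subtype.ext ((congrArg (fun ρ : Perm β => ρ x) hR).trans (glue_right σ τ x).symm)
  have hτ' : ∀ x : {x // x ∉ A}, (⟨L x, (not_congr (hAL x)).2 x.2⟩ : {x // x ∉ A}) = τ' x :=
    fun x => Subtype.ext ((congrArg (fun ρ : Perm β => ρ x) hL).trans (glue_right σ' τ' x).symm)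
  refine ⟨A, σ, σ', τ, τ', ha, hb, hR, hL, ?_, ?_⟩
  · have mono : ∀ q : {x // x ∈ A} → Prop, (∀ x, q (σ x) ↔ q x) → (∀ x, q (σ' x) ↔ q x) →
        q ⟨a, ha⟩ → ∀ x, q x := by
      intro q h1 h2 hqa x
      obtain ⟨_, h⟩ := (hA x).1 x.2 (fun z => ∃ h : z ∈ A, q ⟨z, h⟩)
        (invariant_extend hAR q fun x => by rw [hσ, h1])
        (invariant_extend hAL q fun x => by rw [hσ', h2]) ⟨ha, hqa⟩
      exact h
    rw [connected_iff_forall_iff ⟨a, ha⟩]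
    intro q h1 h2 x
    refine ⟨fun hx => ?_, fun h => mono q h1 h2 h x⟩
    by_contra h'
    exact mono (fun z => ¬q z) (fun x => not_congr (h1 x)) (fun x => not_congr (h2 x)) h' x hx
  · rw [connected_iff_forall_iff ⟨b, hb⟩]
    have mono : ∀ q : {x // x ∉ A} → Prop, (∀ x, q (τ x) ↔ q x) → (∀ x, q (τ' x) ↔ q x) →
        ¬q ⟨b, hb⟩ → ∀ x, ¬q x := by
      intro q h1 h2 hqb x hx
      -- Extended by `False` on `A`, the predicate is false at `a`, and at `b` by assumption, so
      -- `hc` makes it false everywhere.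
      have := (hc (fun z => ∃ h : z ∉ A, q ⟨z, h⟩)
        (invariant_extend (p := fun z => z ∉ A) (fun x => not_congr (hAR x)) q
          fun x => by rw [hτ, h1])
        (invariant_extend (p := fun z => z ∉ A) (fun x => not_congr (hAL x)) q
          fun x => by rw [hτ', h2])
        ⟨fun h => (h.1 ha).elim, fun h => (hqb h.2).elim⟩ x).1 ⟨x.2, hx⟩
      exact this.1 ha
    intro q h1 h2 x
    refine ⟨fun hx => ?_, fun h => ?_⟩
    · by_contra h'
      exact mono q h1 h2 h' x hx
    · by_contra h'
      exact mono (fun z => ¬q z) (fun x => not_congr (h1 x)) (fun x => not_congr (h2 x))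
        (not_not.2 h) x h'

end Components

/-! ### The genus is a natural number -/

section Euler

universe u

/-- The genus of a connected pair of permutations is a natural number. -/
theorem exists_genus {α : Type u} [Finite α] [Nonempty α] {R L : Perm α} (h : Connected R L) :
    ∃ g : ℕ, (numOrbits R : ℤ) + numOrbits L + numOrbits (R * L) =
      Nat.card α + 2 * (1 - (g : ℤ)) := by
  classical
  obtain ⟨m, hm⟩ : ∃ m, Nat.card α = m := ⟨_, rfl⟩
  -- Deletion of a dart keeps the genus, lowers it by one if the dart joined two vertices of a still
  -- connected pair, or leaves two components whose genera add up; a single dart has genus `0`.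
  induction m using Nat.strong_induction_on generalizing α with
  | _ m ih =>
  obtain ⟨x₀⟩ := ‹Nonempty α›
  obtain ⟨β, ⟨e⟩⟩ : ∃ β : Type u, Nonempty (α ≃ Option β) :=
    ⟨{x // x ≠ x₀}, ⟨(optionSubtypeNe x₀).symm⟩⟩
  have := Fintype.ofFinite α
  have : Finite β := Finite.of_injective (fun x => e.symm (some x))
    (e.symm.injective.comp (Option.some_injective β))
  have := Fintype.ofFinite β
  obtain ⟨⟨⟨u, w⟩, R', L'⟩, hRL⟩ := insert_bijective.2 (e.permCongr R, e.permCongr L)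
  simp only [Prod.mk.injEq] at hRL
  have hR : ∀ x, e (R x) = insertR R' u w (e x) := fun x => by rw [hRL.1]; simp
  have hL : ∀ x, e (L x) = insertL L' u (e x) := fun x => by rw [hRL.2]; simp
  rw [← numOrbits_map e hR, ← numOrbits_map e hL,
    ← numOrbits_map (τ := insertR R' u w * insertL L' u) e (fun x => by simp [hR, hL])]
  have hc := h.map e hR hL
  have hcard : Nat.card α = Nat.card β + 1 := by
    rw [Nat.card_congr e, Finite.card_option]
  rw [hcard] at hm ⊢
  rcases u with _ | a <;> rcases w with _ | b
  · rw [numOrbits_insertL_none, numOrbits_insertR_mul_insertL_none, insertR_none_none,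
      numOrbits_fixNone]
    rw [connected_insert_none_none] at hc
    rw [numOrbits_of_isEmpty, numOrbits_of_isEmpty, numOrbits_of_isEmpty]
    exact ⟨0, by simp⟩
  · rw [connected_insert_none_some] at hc
    have : Nonempty β := ⟨b⟩
    obtain ⟨g, hg⟩ := ih (Nat.card β) (by omega) hc rfl
    rw [numOrbits_insertL_none, numOrbits_insertR_mul_insertL_some, insertR_none_some,
      numOrbits_fixNone_mul_swap]
    exact ⟨g, by push_cast; linarith⟩
  · rw [connected_insert_some_none] at hc
    have : Nonempty β := ⟨a⟩
    obtain ⟨g, hg⟩ := ih (Nat.card β) (by omega) hc rfl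
    rw [numOrbits_insertL_some, numOrbits_insertR_mul_insertL_none, insertR_some_none,
      numOrbits_fixNone_mul_swap]
    exact ⟨g, by push_cast; linarith⟩
  · rw [numOrbits_insertL_some, numOrbits_insertR_mul_insertL_some]
    have : Nonempty β := ⟨a⟩
    by_cases hab : R'.SameCycle a b
    · rw [connected_insert_of_sameCycle hab] at hc
      obtain ⟨g, hg⟩ := ih (Nat.card β) (by omega) hc rfl
      obtain ⟨k, hk, rfl⟩ := exists_pow_eq_of_sameCycle hab
      rw [numOrbits_insertR_pow hk]
      exact ⟨g, by push_cast; linarith⟩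
    · have hv := numOrbits_insertR_of_not_sameCycle hab
      by_cases hn : Connected R' L'
      · obtain ⟨g, hg⟩ := ih (Nat.card β) (by omega) hn rfl
        exact ⟨g + 1, by push_cast; linarith⟩
      · obtain ⟨A, σ, σ', τ, τ', ha, hb, rfl, rfl, h1, h2⟩ := exists_components hc hn
        have : Nonempty {x // x ∈ A} := ⟨⟨a, ha⟩⟩
        have : Nonempty {x // x ∉ A} := ⟨⟨b, hb⟩⟩
        have hadd : Nat.card {x // x ∈ A} + Nat.card {x // x ∉ A} = Nat.card β := by
          rw [← Nat.card_sum]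
          exact Nat.card_congr (sumCompl (· ∈ A))
        have p1 : 0 < Nat.card {x // x ∈ A} := Nat.card_pos
        have p2 : 0 < Nat.card {x // x ∉ A} := Nat.card_pos
        obtain ⟨g₁, hg₁⟩ := ih _ (by omega) h1 rfl
        obtain ⟨g₂, hg₂⟩ := ih _ (by omega) h2 rfl
        rw [numOrbits_glue] at hv
        rw [glue_mul, numOrbits_glue, numOrbits_glue]
        exact ⟨g₁ + g₂, by push_cast; linarith⟩

end Euler

/-! ### Rooted hypermaps before and after the deletion of the root -/

section Rooted

variable {α β ι κ : Type*}

/-- The family `y` with the entry `a` put in front. -/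
def optCons {γ : Type*} (a : γ) (y : κ → γ) : Option κ → γ := fun i => i.elim a y

@[simp] theorem optCons_none {γ : Type*} (a : γ) (y : κ → γ) : optCons a y none = a := rfl

@[simp] theorem optCons_some {γ : Type*} (a : γ) (y : κ → γ) (i : κ) :
    optCons a y (some i) = y i := rfl

/-- A hypermap of genus `g` with `e` hyperedges and `f` faces, together with a family of darts
with pairwise distinct initial vertices of degrees `d`. -/
structure IsRooted (R L : Perm α) (y : ι → α) (d : ι → ℕ) (g : ℤ) (e f : ℕ) : Prop where
  connected : Connected R L
  inj : ∀ i j, R.SameCycle (y i) (y j) → i = j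
  degree : ∀ i, orbitSize R (y i) = d i
  edges : numOrbits L = e
  faces : numOrbits (R * L) = f
  euler : (numOrbits R : ℤ) + e + f = Nat.card α + 2 * (1 - g)

theorem isRooted_optCons {R L : Perm α} {a : α} {y : κ → α} {n : ℕ} {d : κ → ℕ} {g : ℤ}
    {e f : ℕ} : IsRooted R L (optCons a y) (optCons n d) g e f ↔
      Connected R L ∧ (∀ i, ¬R.SameCycle a (y i)) ∧ (∀ i j, R.SameCycle (y i) (y j) → i = j) ∧
      orbitSize R a = n ∧ (∀ i, orbitSize R (y i) = d i) ∧ numOrbits L = e ∧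
      numOrbits (R * L) = f ∧ (numOrbits R : ℤ) + e + f = Nat.card α + 2 * (1 - g) := by
  constructor
  · intro h
    refine ⟨h.connected, fun i hi => ?_, fun i j hij => ?_, h.degree none, fun i => h.degree i,
      h.edges, h.faces, h.euler⟩
    · simpa using h.inj none (some i) hi
    · simpa using h.inj (some i) (some j) hij
  · rintro ⟨h1, h2, h3, h4, h5, h6, h7, h8⟩
    refine ⟨h1, ?_, ?_, h6, h7, h8⟩
    · rintro (_ | i) (_ | j) h
      · rfl
      · exact (h2 j h).elim
      · exact (h2 i h.symm).elim
      · rw [h3 i j h]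
    · rintro (_ | i)
      · exact h4
      · exact h5 i

theorem IsRooted.map {R L : Perm α} {R' L' : Perm β} {y : ι → α} {d : ι → ℕ} {g : ℤ} {e f : ℕ}
    [Finite β] (φ : α ≃ β) (hR : ∀ x, φ (R x) = R' (φ x)) (hL : ∀ x, φ (L x) = L' (φ x))
    (h : IsRooted R L y d g e f) : IsRooted R' L' (fun i => φ (y i)) d g e f where
  connected := h.connected.map φ hR hL
  inj _ _ hij := h.inj _ _ ((sameCycle_map φ.injective hR).1 hij)
  degree i := by rw [orbitSize_map φ.injective hR, h.degree]
  edges := by rw [numOrbits_map φ hL, h.edges]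
  faces := by
    rw [numOrbits_map (σ := R * L) φ fun x => by simp [hR, hL], h.faces]
  euler := by rw [numOrbits_map φ hR, ← Nat.card_congr φ, h.euler]

theorem IsRooted.reindex {R L : Perm α} {y : ι → α} {d : ι → ℕ} {g : ℤ} {e f : ℕ}
    (ψ : κ ≃ ι) (h : IsRooted R L y d g e f) :
    IsRooted R L (fun i => y (ψ i)) (fun i => d (ψ i)) g e f where
  connected := h.connected
  inj _ _ hij := ψ.injective (h.inj _ _ hij)
  degree _ := h.degree _
  edges := h.edges
  faces := h.faces
  euler := h.euler

/-- Duality exchanges hyperedges and faces. -/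
theorem IsRooted.dual [Finite α] {R L : Perm α} {y : ι → α} {d : ι → ℕ} {g : ℤ} {e f : ℕ}
    (h : IsRooted R L y d g e f) : IsRooted R (R * L)⁻¹ y d g f e where
  connected := connected_mul_inv h.connected
  inj := h.inj
  degree := h.degree
  edges := by rw [numOrbits_inv, h.faces]
  -- `R * (R * L)⁻¹` is `R * L⁻¹ * R⁻¹`, a conjugate of `L⁻¹`.
  faces := by rw [mul_inv_rev, ← mul_assoc, numOrbits_conj, numOrbits_inv, h.edges]
  euler := by have := h.euler; linarith

/-- `IsRooted` takes an integer genus so that `g - 1` needs no case distinction; this excludes the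
negative values. -/
theorem IsRooted.exists_nat_genus [Finite α] [Nonempty α] {R L : Perm α} {y : ι → α} {d : ι → ℕ}
    {g : ℤ} {e f : ℕ} (h : IsRooted R L y d g e f) : ∃ k : ℕ, g = k := by
  obtain ⟨k, hk⟩ := exists_genus h.connected
  have := h.euler
  rw [h.edges, h.faces] at hk
  exact ⟨k, by linarith⟩

variable [DecidableEq β] [Finite β] {R L : Perm β} {y : κ → β} {n : ℕ} {d : κ → ℕ} {g : ℤ}
  {e f : ℕ}

theorem isRooted_insert_none_none :
    IsRooted (insertR R none none) (insertL L none) (optCons none (some ∘ y)) (optCons n d) g e f ↔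
      (IsEmpty β ∧ IsEmpty κ) ∧ n = 1 ∧ g = 0 ∧ e = 1 ∧ f = 1 := by
  rw [isRooted_optCons, numOrbits_insertL_none, numOrbits_insertR_mul_insertL_none,
    insertR_none_none, numOrbits_fixNone, orbitSize_fixNone_none, Finite.card_option,
    ← insertR_none_none, connected_insert_none_none]
  constructor
  · rintro ⟨h, -, -, h4, -, h6, h7, h8⟩
    rw [numOrbits_of_isEmpty] at h6 h7 h8
    rw [Nat.card_of_isEmpty] at h8
    have : IsEmpty κ := ⟨fun i => h.elim (y i)⟩
    push_cast at h8
    subst h6 h7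
    refine ⟨⟨h, this⟩, h4.symm, by push_cast at h8; linarith, rfl, rfl⟩
  · rintro ⟨⟨h, h'⟩, rfl, rfl, rfl, rfl⟩
    rw [numOrbits_of_isEmpty, numOrbits_of_isEmpty, numOrbits_of_isEmpty, Nat.card_of_isEmpty]
    simp [h]

/-- Common core of the two cases in which the new dart is a hyperedge or a face by itself: one
vertex grows by one dart, and by `hef` the extra dart in the Euler relation is balanced by one
hyperedge or face. -/
theorem isRooted_insertOne {R' L' : Perm (Option β)} {b : β} (hn : 1 ≤ n) {e' f' : ℕ}
    (hR : R' = fixNone R * swap none (some b)) (hc : Connected R' L' ↔ Connected R L)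
    (he : numOrbits L' = e ↔ numOrbits L = e') (hf : numOrbits (R' * L') = f ↔
      numOrbits (R * L) = f') (hef : e + f = e' + f' + 1) :
    IsRooted R' L' (optCons none (some ∘ y)) (optCons n d) g e f ↔
      IsRooted R L (optCons b y) (optCons (n - 1) d) g e' f' := by
  rw [isRooted_optCons, isRooted_optCons, hc, he, hf]
  simp only [hR, Function.comp_apply, sameCycle_insertOne_none, sameCycle_insertOne_some,
    orbitSize_insertOne_none, numOrbits_fixNone_mul_swap, Finite.card_option]
  refine and_congr_right fun _ => and_congr_right fun h2 => and_congr_right fun _ =>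
    and_congr ?_ (and_congr ?_ (and_congr_right fun _ => and_congr_right fun _ => ?_))
  · omega
  · exact forall_congr' fun i => by rw [orbitSize_insertOne_some (h2 i)]
  · zify at hef
    push_cast
    constructor <;> intro h <;> linarith

theorem isRooted_insert_none_some {b : β} (hn : 1 ≤ n) :
    IsRooted (insertR R none (some b)) (insertL L none) (optCons none (some ∘ y)) (optCons n d)
        g e f ↔
      1 ≤ e ∧ IsRooted R L (optCons b y) (optCons (n - 1) d) g (e - 1) f := by
  by_cases he : 1 ≤ e
  · rw [isRooted_insertOne hn (insertR_none_some R b) connected_insert_none_some (e' := e - 1)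
      (f' := f)]
    · simp [he]
    · rw [numOrbits_insertL_none]; omega
    · rw [numOrbits_insertR_mul_insertL_some]
    · omega
  · simp only [he, false_and, iff_false]
    intro h
    have := h.edges
    rw [numOrbits_insertL_none] at this
    omega

theorem isRooted_insert_some_none {a : β} (hn : 1 ≤ n) :
    IsRooted (insertR R (some a) none) (insertL L (some a)) (optCons none (some ∘ y)) (optCons n d)
        g e f ↔
      1 ≤ f ∧ IsRooted R L (optCons a y) (optCons (n - 1) d) g e (f - 1) := by
  by_cases hf : 1 ≤ f
  · rw [isRooted_insertOne hn (insertR_some_none R a) connected_insert_some_none (e' := e)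
      (f' := f - 1)]
    · simp [hf]
    · rw [numOrbits_insertL_some]
    · rw [numOrbits_insertR_mul_insertL_none]; omega
    · omega
  · simp only [hf, false_and, iff_false]
    intro h
    have := h.faces
    rw [numOrbits_insertR_mul_insertL_none] at this
    omega

/-- Whether the old pair is connected or not is left open. The Euler relation with `g - 1` also
holds for two components whose genera have sum `g`. -/
theorem isRooted_insert_join {a b : β} (hab : ¬R.SameCycle a b) :
    IsRooted (insertR R (some a) (some b)) (insertL L (some a)) (optCons none (some ∘ y))
        (optCons n d) g e f ↔
      Connected (insertR R (some a) (some b)) (insertL L (some a)) ∧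
      (∀ i, ¬R.SameCycle a (y i) ∧ ¬R.SameCycle b (y i)) ∧
      (∀ i j, R.SameCycle (y i) (y j) → i = j) ∧
      orbitSize R a + orbitSize R b + 1 = n ∧ (∀ i, orbitSize R (y i) = d i) ∧ numOrbits L = e ∧
      numOrbits (R * L) = f ∧
      (numOrbits R : ℤ) + e + f = Nat.card β + 2 * (1 - (g - 1)) := by
  rw [isRooted_optCons, numOrbits_insertL_some, numOrbits_insertR_mul_insertL_some,
    orbitSize_insertR_none hab, Finite.card_option, ← numOrbits_insertR_of_not_sameCycle hab]
  simp only [Function.comp_apply, sameCycle_insertR_none hab, sameCycle_insertR_some hab, not_or]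
  refine and_congr_right fun _ => and_congr_right fun h2 => and_congr ?_
    (and_congr_right fun _ => and_congr ?_ (and_congr_right fun _ => and_congr_right fun _ => ?_))
  · refine forall_congr' fun i => forall_congr' fun j => ?_
    have := h2 i
    tauto
  · exact forall_congr' fun i => by rw [orbitSize_insertR_some hab (h2 i).1 (h2 i).2]
  · push_cast
    constructor <;> intro h <;> linarith

/-- Here `p` is the degree at `b`; the degrees at `a` and `b` are positive with sum `n - 1`, whence
the range of `p`. -/
theorem isRooted_insert_join_connected {a b : β} :
    (¬R.SameCycle a b ∧ Connected R L) ∧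
      IsRooted (insertR R (some a) (some b)) (insertL L (some a)) (optCons none (some ∘ y))
        (optCons n d) g e f ↔
      ∃ p ∈ Finset.Icc 1 (n - 2),
        IsRooted R L (optCons a (optCons b y)) (optCons (n - 1 - p) (optCons p d)) (g - 1) e f := by
  constructor
  · rintro ⟨⟨hab, hc⟩, h⟩
    rw [isRooted_insert_join hab] at h
    obtain ⟨-, h2, h3, h4, h5, h6, h7, h8⟩ := h
    have ha := orbitSize_pos R a
    have hb := orbitSize_pos R b
    refine ⟨orbitSize R b, by rw [Finset.mem_Icc]; omega, hc, ?_, ?_, h6, h7, h8⟩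
    · rintro (_ | _ | i) (_ | _ | j) h
      · rfl
      · exact (hab h).elim
      · exact ((h2 j).1 h).elim
      · exact (hab h.symm).elim
      · rfl
      · exact ((h2 j).2 h).elim
      · exact ((h2 i).1 h.symm).elim
      · exact ((h2 i).2 h.symm).elim
      · rw [h3 i j h]
    · rintro (_ | _ | i)
      · simp only [optCons_none]; omega
      · rfl
      · exact h5 i
  · rintro ⟨p, hp, h⟩
    rw [Finset.mem_Icc] at hp
    have hab : ¬R.SameCycle a b := fun hs => by simpa using h.inj none (some none) hs
    refine ⟨⟨hab, h.connected⟩, (isRooted_insert_join hab).2 ⟨h.connected.insert, fun i =>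
      ⟨fun hs => by simpa using h.inj none (some (some i)) hs,
        fun hs => by simpa using h.inj (some none) (some (some i)) hs⟩,
      fun i j hs => by simpa using h.inj (some (some i)) (some (some j)) hs, ?_,
      fun i => h.degree (some (some i)), h.edges, h.faces, h.euler⟩⟩
    have h1 := h.degree none
    have h2 := h.degree (some none)
    simp only [optCons_none, optCons_some] at h1 h2
    omega

/-- For `b = (R ^ k) a` the split-off root vertex has degree `k + 1`, so `n` determines `b` from
`a`. -/
theorem isRooted_insert_split {a b : β} (hn : 1 ≤ n) :
    R.SameCycle a b ∧ IsRooted (insertR R (some a) (some b)) (insertL L (some a))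
        (optCons none (some ∘ y)) (optCons n d) g e f ↔
      b = (R ^ (n - 1)) a ∧ n ≤ orbitSize R a ∧
        IsRooted (insertR R (some a) (some ((R ^ (n - 1)) a))) (insertL L (some a))
          (optCons none (some ∘ y)) (optCons n d) g e f := by
  constructor
  · rintro ⟨hab, h⟩
    obtain ⟨k, hk, rfl⟩ := exists_pow_eq_of_sameCycle hab
    have h1 := h.degree none
    simp only [optCons_none, orbitSize_insertR_pow_none hk] at h1
    subst h1
    exact ⟨rfl, hk, h⟩
  · rintro ⟨rfl, -, h⟩
    exact ⟨⟨(n - 1 : ℕ), by simp⟩, h⟩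

theorem isRooted_insert_pow {a : β} (hn : 1 ≤ n) (ha : n ≤ orbitSize R a) :
    IsRooted (insertR R (some a) (some ((R ^ (n - 1)) a))) (insertL L (some a))
        (optCons none (some ∘ y)) (optCons n d) g e f ↔
      Connected R L ∧
      (∀ i, ¬(insertR R (some a) (some ((R ^ (n - 1)) a))).SameCycle none (some (y i))) ∧
      (∀ i j, (insertR R (some a) (some ((R ^ (n - 1)) a))).SameCycle (some (y i)) (some (y j)) →
        i = j) ∧
      (∀ i, orbitSize (insertR R (some a) (some ((R ^ (n - 1)) a))) (some (y i)) = d i) ∧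
      numOrbits L = e ∧ numOrbits (R * L) = f ∧
      (numOrbits R : ℤ) + e + f = Nat.card β + 2 * (1 - g) := by
  have hk : n - 1 < orbitSize R a := by omega
  rw [isRooted_optCons, numOrbits_insertL_some, numOrbits_insertR_mul_insertL_some,
    orbitSize_insertR_pow_none hk, Finite.card_option, numOrbits_insertR_pow hk,
    connected_insert_of_sameCycle ⟨(n - 1 : ℕ), by simp⟩]
  have h1 : n - 1 + 1 = n := by omega
  simp only [h1, true_and, Function.comp_apply]
  refine and_congr_right fun _ => and_congr_right fun _ => and_congr_right fun _ =>
    and_congr_right fun _ => and_congr_right fun _ => and_congr_right fun _ => ?_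
  push_cast
  constructor <;> intro h <;> linarith

/-- Neither part of the split vertex carries a mark, so the old vertex of `a` is just the root
vertex, of some degree `p` that is at least `n`. -/
theorem isRooted_insert_pow_unmarked {a : β} (hn : 1 ≤ n) :
    (n ≤ orbitSize R a ∧ IsRooted (insertR R (some a) (some ((R ^ (n - 1)) a)))
        (insertL L (some a)) (optCons none (some ∘ y)) (optCons n d) g e f) ∧
        (¬∃ j, (insertR R (some a) (some ((R ^ (n - 1)) a))).SameCycle (some a) (some (y j))) ↔
      ∃ p ∈ Finset.Icc n (Nat.card β), IsRooted R L (optCons a y) (optCons p d) g e f := by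
  constructor
  · rintro ⟨⟨ha, h⟩, hj⟩
    have hk : n - 1 < orbitSize R a := by omega
    rw [isRooted_insert_pow hn ha] at h
    obtain ⟨h1, h2, h3, h5, h6, h7, h8⟩ := h
    push Not at hj
    have ha' : ∀ i, ¬R.SameCycle a (y i) := fun i => by
      rw [sameCycle_self_iff_insertR_pow hk, not_or]
      exact ⟨h2 i, hj i⟩
    refine ⟨orbitSize R a, Finset.mem_Icc.2 ⟨ha, orbitSize_le R a⟩, isRooted_optCons.2
      ⟨h1, ha', fun i j hij => h3 i j ?_, rfl, fun i => ?_, h6, h7, h8⟩⟩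
    · rw [sameCycle_iff_insertR_pow hk] at hij
      exact hij.resolve_right fun h => h.1.elim (h2 i) (hj i)
    · rw [← h5, orbitSize_insertR_pow_some hk (ha' i)]
  · rintro ⟨p, hp, h⟩
    rw [isRooted_optCons] at h
    obtain ⟨h1, h2, h3, h4, h5, h6, h7, h8⟩ := h
    rw [Finset.mem_Icc] at hp
    have ha : n ≤ orbitSize R a := by omega
    have hk : n - 1 < orbitSize R a := by omega
    have h2' := h2
    simp only [sameCycle_self_iff_insertR_pow hk, not_or] at h2'
    refine ⟨⟨ha, (isRooted_insert_pow hn ha).2 ⟨h1, fun i => (h2' i).1, fun i j hij => h3 i j ?_,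
      fun i => ?_, h6, h7, h8⟩⟩, fun ⟨j, hj⟩ => (h2' j).2 hj⟩
    · rw [sameCycle_iff_insertR_pow hk]
      exact Or.inl hij
    · rw [orbitSize_insertR_pow_some hk (h2 i), h5]

/-- The remainder of the split vertex is the `j`-th marked vertex, so the old root has degree `d j +
n - 1` and the `j`-th mark is dropped. Its position in the remainder stays as a condition on both
sides, to be counted separately. -/
theorem isRooted_insert_pow_marked {a : β} (hn : 1 ≤ n) (j : κ) :
    (n ≤ orbitSize R a ∧ IsRooted (insertR R (some a) (some ((R ^ (n - 1)) a)))
        (insertL L (some a)) (optCons none (some ∘ y)) (optCons n d) g e f) ∧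
        (insertR R (some a) (some ((R ^ (n - 1)) a))).SameCycle (some a) (some (y j)) ↔
      (1 ≤ d j ∧ IsRooted R L (optCons a fun i : {i // i ≠ j} => y i)
        (optCons (d j + n - 1) fun i : {i // i ≠ j} => d i) g e f) ∧
      (insertR R (some a) (some ((R ^ (n - 1)) a))).SameCycle (some a) (some (y j)) := by
  refine and_congr_left fun hj => ?_
  constructor
  · rintro ⟨ha, h⟩
    have hk : n - 1 < orbitSize R a := by omega
    rw [isRooted_insert_pow hn ha] at h
    obtain ⟨h1, h2, h3, h5, h6, h7, h8⟩ := h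
    have hj' : ∀ i, i ≠ j → ¬(insertR R (some a) (some ((R ^ (n - 1)) a))).SameCycle (some a)
        (some (y i)) := fun i hi h => hi (h3 i j (h.symm.trans hj))
    have ha' : ∀ i, i ≠ j → ¬R.SameCycle a (y i) := fun i hi => by
      rw [sameCycle_self_iff_insertR_pow hk, not_or]
      exact ⟨h2 i, hj' i hi⟩
    refine ⟨h5 j ▸ orbitSize_pos _ _, isRooted_optCons.2 ⟨h1, fun i => ha' i i.2,
      fun i i' hij => Subtype.ext (h3 i i' ?_), ?_, fun i => ?_, h6, h7, h8⟩⟩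
    · rw [sameCycle_iff_insertR_pow hk] at hij
      exact hij.resolve_right fun h => h.1.elim (h2 i) (hj' i i.2)
    · have := orbitSize_insertR_pow_self hk
      rw [orbitSize_congr hj, h5] at this
      omega
    · rw [← h5, orbitSize_insertR_pow_some hk (ha' i i.2)]
  · rintro ⟨hd, h⟩
    rw [isRooted_optCons] at h
    obtain ⟨h1, h2, h3, h4, h5, h6, h7, h8⟩ := h
    have hk : n - 1 < orbitSize R a := by omega
    have ha : n ≤ orbitSize R a := by omega
    have h2' := h2
    simp only [sameCycle_self_iff_insertR_pow hk, not_or] at h2'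
    have hnj := not_sameCycle_insertR_pow hk
    refine ⟨ha, (isRooted_insert_pow hn ha).2 ⟨h1, fun i => ?_, fun i i' hij => ?_,
      fun i => ?_, h6, h7, h8⟩⟩
    · by_cases hi : i = j
      · subst hi
        exact fun h => hnj (h.trans hj.symm)
      · exact (h2' ⟨i, hi⟩).1
    · by_cases hi : i = j
      · by_cases hi' : i' = j
        · rw [hi, hi']
        · subst hi
          exact ((h2' ⟨i', hi'⟩).2 (hj.trans hij)).elim
      · by_cases hi' : i' = j
        · subst hi'
          exact ((h2' ⟨i, hi⟩).2 (hj.trans hij.symm)).elim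
        · have := h3 ⟨i, hi⟩ ⟨i', hi'⟩ (by
            rw [sameCycle_iff_insertR_pow hk]
            exact Or.inl hij)
          exact congrArg Subtype.val this
    · by_cases hi : i = j
      · subst hi
        have := orbitSize_insertR_pow_self hk
        rw [← orbitSize_congr hj]
        omega
      · rw [orbitSize_insertR_pow_some hk (h2 ⟨i, hi⟩)]
        exact h5 ⟨i, hi⟩

end Rooted

/-! ### Joining two hypermaps at their roots -/

section Glue

/-- Two permutations with a root dart and a family of marked darts. -/
abbrev RootedData (α κ : Type*) := Perm α × Perm α × (Option κ → α)

/-- The data of the insertion of a dart into a pair of permutations with marked darts. -/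
abbrev InsertionData (β κ : Type*) := (β × β) × Perm β × Perm β × (κ → β)

/-- The data satisfy `IsRooted`. -/
def RootedData.Good {α κ : Type*} (x : RootedData α κ) (n : ℕ) (d : κ → ℕ) (g : ℤ) (e f : ℕ) :
    Prop :=
  IsRooted x.1 x.2.1 x.2.2 (optCons n d) g e f

variable {β κ : Type*} [DecidableEq β] [DecidableEq κ]

/-- The result of the insertion is a rooted hypermap with the given parameters. -/
def InsertionData.Good (x : InsertionData β κ) (n : ℕ) (d : κ → ℕ) (g : ℤ) (e f : ℕ) : Prop :=
  IsRooted (insertR x.2.1 (some x.1.1) (some x.1.2)) (insertL x.2.2.1 (some x.1.1))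
    (optCons none (some ∘ x.2.2.2)) (optCons n d) g e f

/-- The insertion that joins two hypermaps at their roots. -/
def glueData {A : Finset β} {S : Finset κ}
    (x : RootedData {x // x ∈ A} {i // i ∈ S} × RootedData {x // x ∉ A} {i // i ∉ S}) :
    InsertionData β κ :=
  ((x.1.2.2 none, x.2.2.2 none), glue x.1.1 x.2.1, glue x.1.2.1 x.2.2.1,
    fun i => if h : i ∈ S then x.1.2.2 (some ⟨i, h⟩) else x.2.2.2 (some ⟨i, h⟩))

variable {A : Finset β} {S : Finset κ}

theorem glueData_mem
    (x : RootedData {x // x ∈ A} {i // i ∈ S} × RootedData {x // x ∉ A} {i // i ∉ S})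
    {i : κ} (h : i ∈ S) : (glueData x).2.2.2 i = x.1.2.2 (some ⟨i, h⟩) := by
  simp [glueData, h]

theorem glueData_notMem
    (x : RootedData {x // x ∈ A} {i // i ∈ S} × RootedData {x // x ∉ A} {i // i ∉ S})
    {i : κ} (h : i ∉ S) : (glueData x).2.2.2 i = x.2.2.2 (some ⟨i, h⟩) := by
  simp [glueData, h]

theorem glueData_injective : Function.Injective (glueData (A := A) (S := S)) := by
  rintro ⟨⟨σ, σ', y⟩, ⟨τ, τ', z⟩⟩ ⟨⟨σ₂, σ₂', y₂⟩, ⟨τ₂, τ₂', z₂⟩⟩ h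
  have h1 : glue σ τ = glue σ₂ τ₂ := congrArg (fun x => x.2.1) h
  have h2 : glue σ' τ' = glue σ₂' τ₂' := congrArg (fun x => x.2.2.1) h
  obtain ⟨rfl, rfl⟩ := glue_injective h1
  obtain ⟨rfl, rfl⟩ := glue_injective h2
  have hy : y = y₂ := by
    funext i
    rcases i with _ | ⟨i, hi⟩
    · exact Subtype.ext (congrArg (fun x => x.1.1) h)
    · have := congrArg (fun x => x.2.2.2 i) h
      simp only [glueData_mem _ hi] at this
      exact Subtype.ext this
  have hz : z = z₂ := by
    funext i
    rcases i with _ | ⟨i, hi⟩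
    · exact Subtype.ext (congrArg (fun x => x.1.2) h)
    · have := congrArg (fun x => x.2.2.2 i) h
      simp only [glueData_notMem _ hi] at this
      exact Subtype.ext this
  rw [hy, hz]

/-- The hyperedges, faces, degrees of the root and genera of the two hypermaps to be joined, and
the sets of darts and of marked darts of the first. -/
abbrev GlueIndex (β κ : Type*) :=
  Finset β × (ℕ × ℕ) × (ℕ × ℕ) × (ℕ × ℕ) × (ℕ × ℕ) × Finset κ

/-- The insertion joins two hypermaps with the parameters given by `p`. -/
def IsGlued (d : κ → ℕ) (p : GlueIndex β κ) (x : InsertionData β κ) : Prop :=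
  ∃ z : RootedData {x // x ∈ p.1} {i // i ∈ p.2.2.2.2.2} ×
      RootedData {x // x ∉ p.1} {i // i ∉ p.2.2.2.2.2},
    -- The pair of face numbers is stored with the second hypermap first; once the first hypermap is
    -- dualized, this is the order of `f₂ + e₁ = f`.
    (z.1.Good p.2.2.2.2.1.1 (fun i => d i) p.2.1.1 p.2.2.1.1 p.2.2.2.1.2 ∧
      z.2.Good p.2.2.2.2.1.2 (fun i => d i) p.2.1.2 p.2.2.1.2 p.2.2.2.1.1) ∧ glueData z = x

variable [Fintype β] [Fintype κ]

/-- The indices for which the parameters of the two hypermaps add up to the given ones. -/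
def glueIndices (β κ : Type*) [Fintype β] [Fintype κ] (n g e f : ℕ) : Finset (GlueIndex β κ) :=
  Finset.univ ×ˢ Finset.HasAntidiagonal.antidiagonal g ×ˢ
    Finset.HasAntidiagonal.antidiagonal e ×ˢ Finset.HasAntidiagonal.antidiagonal f ×ˢ
    Finset.HasAntidiagonal.antidiagonal (n - 1) ×ˢ Finset.univ

omit [DecidableEq β] [DecidableEq κ] in
theorem mem_glueIndices {n g e f : ℕ} {p : GlueIndex β κ} : p ∈ glueIndices β κ n g e f ↔
    p.2.1.1 + p.2.1.2 = g ∧ p.2.2.1.1 + p.2.2.1.2 = e ∧ p.2.2.2.1.1 + p.2.2.2.1.2 = f ∧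
      p.2.2.2.2.1.1 + p.2.2.2.2.1.2 = n - 1 := by
  simp [glueIndices]

omit [Fintype κ] [DecidableEq κ] in
theorem card_mem_add_card_notMem (A : Finset β) :
    Nat.card {x // x ∈ A} + Nat.card {x // x ∉ A} = Nat.card β := by
  rw [← Nat.card_sum]
  exact Nat.card_congr (sumCompl (· ∈ A))

theorem IsGlued.good {n : ℕ} (hn : 1 ≤ n) {d : κ → ℕ} {g e f : ℕ} {p : GlueIndex β κ}
    (hp : p ∈ glueIndices β κ n g e f) {x : InsertionData β κ} (h : IsGlued d p x) :
    ¬Connected x.2.1 x.2.2.1 ∧ x.Good n d g e f := by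
  obtain ⟨A, ⟨g₁, g₂⟩, ⟨e₁, e₂⟩, ⟨f₂, f₁⟩, ⟨n₁, n₂⟩, S⟩ := p
  rw [mem_glueIndices] at hp
  simp only at hp
  obtain ⟨rfl, rfl, rfl, hn'⟩ := hp
  obtain ⟨⟨⟨σ, σ', y⟩, ⟨τ, τ', z⟩⟩, ⟨h1, h2⟩, rfl⟩ := h
  simp only [RootedData.Good] at h1 h2
  have ha : ((y none : {x // x ∈ A}) : β) ∈ A := (y none).2
  have hb : ((z none : {x // x ∉ A}) : β) ∉ A := (z none).2
  have hab : ¬(glue σ τ).SameCycle (y none) (z none) := fun h =>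
    hb ((mem_iff_of_sameCycle_glue h).1 ha)
  refine ⟨not_connected_glue ha hb, ?_⟩
  refine (isRooted_insert_join hab).2 ⟨connected_insert_glue h1.connected h2.connected ha hb,
    fun i => ?_, fun i j hij => ?_, ?_, fun i => ?_, ?_, ?_, ?_⟩
  · by_cases hi : i ∈ S
    · rw [glueData_mem _ hi]
      refine ⟨fun h => ?_, fun h => hb ((mem_iff_of_sameCycle_glue h).2 (y _).2)⟩
      simpa using h1.inj _ _ (sameCycle_glue_left.1 h)
    · rw [glueData_notMem _ hi]
      refine ⟨fun h => (z _).2 ((mem_iff_of_sameCycle_glue h).1 ha), fun h => ?_⟩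
      simpa using h2.inj _ _ (sameCycle_glue_right.1 h)
  · by_cases hi : i ∈ S
    · by_cases hj : j ∈ S
      · rw [glueData_mem _ hi, glueData_mem _ hj] at hij
        simpa using h1.inj _ _ (sameCycle_glue_left.1 hij)
      · rw [glueData_mem _ hi, glueData_notMem _ hj] at hij
        exact ((z _).2 ((mem_iff_of_sameCycle_glue hij).1 (y _).2)).elim
    · by_cases hj : j ∈ S
      · rw [glueData_notMem _ hi, glueData_mem _ hj] at hij
        exact ((z _).2 ((mem_iff_of_sameCycle_glue hij).2 (y _).2)).elim
      · rw [glueData_notMem _ hi, glueData_notMem _ hj] at hij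
        simpa using h2.inj _ _ (sameCycle_glue_right.1 hij)
  · have h3 := h1.degree none
    have h4 := h2.degree none
    simp only [optCons_none] at h3 h4
    rw [orbitSize_glue_left, orbitSize_glue_right, h3, h4]
    omega
  · by_cases hi : i ∈ S
    · rw [glueData_mem _ hi, orbitSize_glue_left]
      exact h1.degree (some ⟨i, hi⟩)
    · rw [glueData_notMem _ hi, orbitSize_glue_right]
      exact h2.degree (some ⟨i, hi⟩)
  · simp only [glueData]
    rw [numOrbits_glue, h1.edges, h2.edges]
  · simp only [glueData]
    rw [glue_mul, numOrbits_glue, h1.faces, h2.faces, add_comm]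
  · have h3 := h1.euler
    have h4 := h2.euler
    have h5 := card_mem_add_card_notMem A
    rw [numOrbits_glue, ← h5]
    push_cast
    linarith

/-- The parameters are read off the two components of `exists_components`; `exists_genus` puts their
genera in the antidiagonal over `ℕ`. -/
theorem exists_isGlued {n : ℕ} {d : κ → ℕ} {g e f : ℕ} {x : InsertionData β κ}
    (hn : ¬Connected x.2.1 x.2.2.1) (h : x.Good n d g e f) :
    ∃ p ∈ glueIndices β κ n g e f, IsGlued d p x := by
  obtain ⟨⟨a, b⟩, R, L, w⟩ := x
  simp only [InsertionData.Good] at hn h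
  obtain ⟨A, σ, σ', τ, τ', ha, hb, rfl, rfl, hc1, hc2⟩ := exists_components h.connected hn
  have hab : ¬(glue σ τ).SameCycle a b := fun h => hb ((mem_iff_of_sameCycle_glue h).1 ha)
  rw [isRooted_insert_join hab] at h
  obtain ⟨-, h2, h3, h4, h5, h6, h7, h8⟩ := h
  have : Nonempty {x // x ∈ A} := ⟨⟨a, ha⟩⟩
  have : Nonempty {x // x ∉ A} := ⟨⟨b, hb⟩⟩
  obtain ⟨g₁, hg₁⟩ := exists_genus hc1
  obtain ⟨g₂, hg₂⟩ := exists_genus hc2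
  let S : Finset κ := Finset.univ.filter fun i => w i ∈ A
  have hS : ∀ i, i ∈ S ↔ w i ∈ A := fun i => by simp [S]
  let y : {i // i ∈ S} → {x // x ∈ A} := fun i => ⟨w i, (hS i).1 i.2⟩
  let z : {i // i ∉ S} → {x // x ∉ A} := fun i => ⟨w i, (not_congr (hS i)).1 i.2⟩
  have h5' := card_mem_add_card_notMem A
  rw [numOrbits_glue] at h6
  rw [glue_mul, numOrbits_glue] at h7
  have hg : g₁ + g₂ = g := by
    rw [numOrbits_glue, ← h5', ← h6, ← h7] at h8
    push_cast at h8
    zify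
    linarith
  have ha' : orbitSize (glue σ τ) a = orbitSize σ ⟨a, ha⟩ := orbitSize_glue_left σ τ ⟨a, ha⟩
  have hb' : orbitSize (glue σ τ) b = orbitSize τ ⟨b, hb⟩ := orbitSize_glue_right σ τ ⟨b, hb⟩
  refine ⟨(A, (g₁, g₂), (numOrbits σ', numOrbits τ'),
    (numOrbits (τ * τ'), numOrbits (σ * σ')), (orbitSize σ ⟨a, ha⟩, orbitSize τ ⟨b, hb⟩), S),
    mem_glueIndices.2 ⟨hg, h6, by simp only; omega, by simp only; omega⟩,
    ((σ, σ', optCons ⟨a, ha⟩ y), (τ, τ', optCons ⟨b, hb⟩ z)), ⟨?_, ?_⟩, ?_⟩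
  · refine isRooted_optCons.2 ⟨hc1, fun i hi => ?_, fun i j hij => ?_, rfl, fun i => ?_, rfl, rfl,
      hg₁⟩
    · exact (h2 i).1 (sameCycle_glue_left (τ := τ).2 hi)
    · exact Subtype.ext (h3 i j (sameCycle_glue_left (τ := τ).2 hij))
    · simp only
      rw [← h5, ← orbitSize_glue_left σ τ]
  · refine isRooted_optCons.2 ⟨hc2, fun i hi => ?_, fun i j hij => ?_, rfl, fun i => ?_, rfl, rfl,
      hg₂⟩
    · exact (h2 i).2 (sameCycle_glue_right (σ := σ).2 hi)
    · exact Subtype.ext (h3 i j (sameCycle_glue_right (σ := σ).2 hij))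
    · simp only
      rw [← h5, ← orbitSize_glue_right σ τ]
  · simp only [glueData, optCons_none, optCons_some, y, z]
    simp

omit [Fintype β] [Fintype κ] in
-- The set of darts is the component of `x.1.1`, the set of indices belongs to the marks in it, and
-- all numbers are then determined. Hence the sum over indices counts nothing twice.
theorem IsGlued.index_unique {d : κ → ℕ} {x : InsertionData β κ} {p q : GlueIndex β κ}
    (hp : IsGlued d p x) (hq : IsGlued d q x) : p = q := by
  obtain ⟨A, ⟨g₁, g₂⟩, ⟨e₁, e₂⟩, ⟨f₂, f₁⟩, ⟨n₁, n₂⟩, S⟩ := p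
  obtain ⟨B, ⟨g₁', g₂'⟩, ⟨e₁', e₂'⟩, ⟨f₂', f₁'⟩, ⟨n₁', n₂'⟩, S'⟩ := q
  obtain ⟨⟨⟨σ, σ', y⟩, ⟨τ, τ', z⟩⟩, ⟨h1, h2⟩, rfl⟩ := hp
  obtain ⟨⟨⟨ρ, ρ', y'⟩, ⟨π, π', z'⟩⟩, ⟨h1', h2'⟩, hx⟩ := hq
  simp only [RootedData.Good] at *
  -- Membership in `B` is invariant, so a connected part `A` that meets `B` lies inside it.
  have sub : ∀ {A B : Finset β} {σ σ' : Perm {x // x ∈ A}} {τ τ' : Perm {x // x ∉ A}}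
      {ρ ρ' : Perm {x // x ∈ B}} {π π' : Perm {x // x ∉ B}} {a : β}, a ∈ A → a ∈ B →
      Connected σ σ' → glue σ τ = glue ρ π → glue σ' τ' = glue ρ' π' → A ⊆ B := by
    intro A B σ σ' τ τ' ρ ρ' π π' a ha hb hc hR hL x hx
    refine hc (fun z => (z : β) ∈ B) (fun z => ?_) (fun z => ?_) ⟨a, ha⟩ ⟨x, hx⟩ hb
    · rw [glue_left σ τ, hR, glue_mem_iff]
    · rw [glue_left σ' τ', hL, glue_mem_iff]
  have hR : glue ρ π = glue σ τ := congrArg (fun x => x.2.1) hx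
  have hL : glue ρ' π' = glue σ' τ' := congrArg (fun x => x.2.2.1) hx
  have ha : ((y' none : {x // x ∈ B}) : β) = y none := congrArg (fun x => x.1.1) hx
  have hAB : A = B := by
    refine Finset.Subset.antisymm ?_ ?_
    · exact sub (y none).2 (ha ▸ (y' none).2) h1.connected hR.symm hL.symm
    · exact sub (y' none).2 (ha ▸ (y none).2) h1'.connected hR hL
  subst hAB
  have hS : ∀ {S : Finset κ} (w : RootedData {x // x ∈ A} {i // i ∈ S} ×
      RootedData {x // x ∉ A} {i // i ∉ S}) (i : κ), i ∈ S ↔ (glueData w).2.2.2 i ∈ A := by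
    intro S w i
    by_cases hi : i ∈ S
    · rw [glueData_mem _ hi]
      simp only [hi, true_iff]
      exact (w.1.2.2 _).2
    · rw [glueData_notMem _ hi]
      simp only [hi, false_iff]
      exact (w.2.2.2 _).2
  have hSS : S = S' := by
    ext i
    rw [hS ((σ, σ', y), (τ, τ', z)), hS ((ρ, ρ', y'), (π, π', z')), hx]
  subst hSS
  have := glueData_injective hx
  simp only [Prod.mk.injEq] at this
  obtain ⟨⟨rfl, rfl, rfl⟩, rfl, rfl, rfl⟩ := this
  have n1 := (h1.degree none).symm.trans (h1'.degree none)
  have n2 := (h2.degree none).symm.trans (h2'.degree none)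
  have e1 := h1.edges.symm.trans h1'.edges
  have e2 := h2.edges.symm.trans h2'.edges
  have f1 := h1.faces.symm.trans h1'.faces
  have f2 := h2.faces.symm.trans h2'.faces
  simp only [optCons_none] at n1 n2 e1 e2 f1 f2
  subst n1 n2 e1 e2 f1 f2
  have g1 := h1.euler
  have g1' := h1'.euler
  have g2 := h2.euler
  have g2' := h2'.euler
  have hg1 : g₁ = g₁' := by zify; linarith
  have hg2 : g₂ = g₂' := by zify; linarith
  rw [hg1, hg2]

theorem disconnected_iff_isGlued {n : ℕ} (hn : 1 ≤ n) {d : κ → ℕ} {g e f : ℕ}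
    {x : InsertionData β κ} : ¬Connected x.2.1 x.2.2.1 ∧ x.Good n d g e f ↔
      ∃ p ∈ glueIndices β κ n g e f, IsGlued d p x :=
  ⟨fun h => exists_isGlued h.1 h.2, fun ⟨_, hp, h⟩ => h.good hn hp⟩

end Glue

/-! ### Cardinalities of subtypes -/

section Counting

variable {X Y I : Type*}

theorem card_subtype_eq_sum [Finite X] (s : Finset I) {P : X → Prop} {Q : I → X → Prop}
    (h : ∀ x, P x ↔ ∃ i ∈ s, Q i x)
    (hu : ∀ x i j, Q i x → Q j x → i = j) :
    Nat.card {x // P x} = ∑ i ∈ s, Nat.card {x // Q i x} := by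
  rw [← Finset.sum_coe_sort s fun i => Nat.card {x // Q i x}, ← Nat.card_sigma]
  symm
  refine Nat.card_congr (Equiv.ofBijective
    (fun z : Σ i : s, {x // Q i x} => (⟨z.2.1, (h _).2 ⟨z.1, z.1.2, z.2.2⟩⟩ : {x // P x}))
    ⟨?_, ?_⟩)
  · rintro ⟨⟨i, hi⟩, x, hx⟩ ⟨⟨j, hj⟩, y, hy⟩ hxy
    obtain rfl : x = y := congrArg Subtype.val hxy
    obtain rfl := hu x i j hx hy
    rfl
  · rintro ⟨x, hx⟩
    obtain ⟨i, hi, hq⟩ := (h x).1 hx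
    exact ⟨⟨⟨i, hi⟩, x, hq⟩, rfl⟩

theorem card_subtype_split [Finite X] {P : X → Prop} (Q : X → Prop) :
    Nat.card {x // P x} = Nat.card {x // Q x ∧ P x} + Nat.card {x // ¬Q x ∧ P x} := by
  classical
  rw [← Nat.card_sum]
  refine (Nat.card_congr (Equiv.ofBijective (Sum.elim (fun x => ⟨x.1, x.2.2⟩)
    (fun x => ⟨x.1, x.2.2⟩) : {x // Q x ∧ P x} ⊕ {x // ¬Q x ∧ P x} → {x // P x}) ⟨?_, ?_⟩)).symm
  · rintro (⟨x, hx⟩ | ⟨x, hx⟩) (⟨y, hy⟩ | ⟨y, hy⟩) h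
    all_goals obtain rfl : x = y := congrArg Subtype.val h
    · rfl
    · exact (hy.1 hx.1).elim
    · exact (hx.1 hy.1).elim
    · rfl
  · rintro ⟨x, hx⟩
    by_cases h : Q x
    · exact ⟨Sum.inl ⟨x, h, hx⟩, rfl⟩
    · exact ⟨Sum.inr ⟨x, h, hx⟩, rfl⟩

theorem card_subtype_congr {P : X → Prop} {Q : Y → Prop} (e : X ≃ Y) (h : ∀ x, P x ↔ Q (e x)) :
    Nat.card {x // P x} = Nat.card {y // Q y} :=
  Nat.card_congr (e.subtypeEquiv h)

theorem card_subtype_congr_right {P Q : X → Prop} (h : ∀ x, P x ↔ Q x) :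
    Nat.card {x // P x} = Nat.card {x // Q x} :=
  card_subtype_congr (Equiv.refl X) h

theorem card_subtype_and_prop (c : Prop) [Decidable c] (P : X → Prop) :
    Nat.card {x // c ∧ P x} = if c then Nat.card {x // P x} else 0 := by
  split_ifs with h
  · exact card_subtype_congr_right fun x => by simp [h]
  · have : IsEmpty {x // c ∧ P x} := ⟨fun x => h x.2.1⟩
    exact Nat.card_of_isEmpty

theorem card_subtype_prod (P : X → Prop) (Q : Y → Prop) :
    Nat.card {x : X × Y // P x.1 ∧ Q x.2} = Nat.card {x // P x} * Nat.card {y // Q y} := by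
  rw [← Nat.card_prod]
  exact Nat.card_congr Equiv.subtypeProdEquivProd

/-- If each `x` satisfying `P` has `m` partners, the pairs are `m` times as many. -/
theorem card_subtype_fiber [Finite X] [Finite Y] {P : X → Prop} {Q : X → Y → Prop} {m : ℕ}
    (h : ∀ x, P x → Nat.card {y // Q x y} = m) :
    Nat.card {z : X × Y // P z.1 ∧ Q z.1 z.2} = m * Nat.card {x // P x} := by
  have := Fintype.ofFinite {x // P x}
  have e : {z : X × Y // P z.1 ∧ Q z.1 z.2} ≃ Σ x : {x // P x}, {y // Q x y} :=
    { toFun := fun z => ⟨⟨z.1.1, z.2.1⟩, z.1.2, z.2.2⟩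
      invFun := fun z => ⟨(z.1.1, z.2.1), z.1.2, z.2.2⟩
      left_inv := fun _ => rfl
      right_inv := fun _ => rfl }
  rw [Nat.card_congr e, Nat.card_sigma, Finset.sum_congr rfl fun x _ => h x.1 x.2,
    Finset.sum_const, Finset.card_univ, smul_eq_mul, mul_comm, Nat.card_eq_fintype_card]

theorem card_subtype_option_prod [Finite X] [Finite Y]
    (P : (Option X × Option X) × Y → Prop) :
    Nat.card {z // P z} = Nat.card {y // P ((none, none), y)} +
      Nat.card {z : X × Y // P ((none, some z.1), z.2)} +
      Nat.card {z : X × Y // P ((some z.1, none), z.2)} +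
      Nat.card {z : (X × X) × Y // P ((some z.1.1, some z.1.2), z.2)} := by
  rw [← Nat.card_sum, ← Nat.card_sum, ← Nat.card_sum]
  refine (Nat.card_congr (Equiv.ofBijective (Sum.elim (Sum.elim (Sum.elim
    (fun y => ⟨((none, none), y.1), y.2⟩) (fun z => ⟨((none, some z.1.1), z.1.2), z.2⟩))
    (fun z => ⟨((some z.1.1, none), z.1.2), z.2⟩))
    (fun z => ⟨((some z.1.1.1, some z.1.1.2), z.1.2), z.2⟩)) ⟨?_, ?_⟩)).symm
  · rintro (((⟨x, hx⟩ | ⟨⟨a, x⟩, hx⟩) | ⟨⟨a, x⟩, hx⟩) | ⟨⟨⟨a, b⟩, x⟩, hx⟩)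
      (((⟨x', hx'⟩ | ⟨⟨a', x'⟩, hx'⟩) | ⟨⟨a', x'⟩, hx'⟩) | ⟨⟨⟨a', b'⟩, x'⟩, hx'⟩) h <;>
      simp_all
  · rintro ⟨⟨⟨_ | a, _ | b⟩, y⟩, h⟩
    · exact ⟨Sum.inl (Sum.inl (Sum.inl ⟨y, h⟩)), rfl⟩
    · exact ⟨Sum.inl (Sum.inl (Sum.inr ⟨(b, y), h⟩)), rfl⟩
    · exact ⟨Sum.inl (Sum.inr ⟨(a, y), h⟩), rfl⟩
    · exact ⟨Sum.inr ⟨((a, b), y), h⟩, rfl⟩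

/-- Splitting off the root dart. -/
def rootEquiv (α κ : Type*) : α × Perm α × Perm α × (κ → α) ≃ RootedData α κ where
  toFun z := (z.2.1, z.2.2.1, optCons z.1 z.2.2.2)
  invFun x := (x.2.2 none, x.1, x.2.1, fun i => x.2.2 (some i))
  left_inv _ := rfl
  right_inv x := by
    refine Prod.ext rfl (Prod.ext rfl ?_)
    funext i; cases i <;> rfl

/-- Splitting off the root dart and one more dart. -/
def rootEquiv₂ (α κ : Type*) : InsertionData α κ ≃ RootedData α (Option κ) where
  toFun z := (z.2.1, z.2.2.1, optCons z.1.1 (optCons z.1.2 z.2.2.2))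
  invFun x := ((x.2.2 none, x.2.2 (some none)), x.1, x.2.1, fun i => x.2.2 (some (some i)))
  left_inv _ := rfl
  right_inv x := by
    refine Prod.ext rfl (Prod.ext rfl ?_)
    funext i; rcases i with _ | _ | i <;> rfl

/-- Splitting off the root dart and moving the dart with index `j` to the end. -/
def rootEquivAt {κ : Type*} [DecidableEq κ] (α : Type*) (j : κ) :
    α × Perm α × Perm α × (κ → α) ≃ RootedData α {i // i ≠ j} × α where
  toFun z := ((z.2.1, z.2.2.1, optCons z.1 fun i => z.2.2.2 i), z.2.2.2 j)
  invFun x := (x.1.2.2 none, x.1.1, x.1.2.1,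
    fun i => if h : i = j then x.2 else x.1.2.2 (some ⟨i, h⟩))
  left_inv z := by
    refine Prod.ext rfl (Prod.ext rfl (Prod.ext rfl ?_))
    funext i
    by_cases h : i = j <;> simp [h]
  right_inv x := by
    refine Prod.ext (Prod.ext rfl (Prod.ext rfl ?_)) (by simp)
    funext i
    rcases i with _ | i
    · rfl
    · simp [i.2]

end Counting

/-! ### Labelled recurrence with the root fixed at `none` -/

section LabelledCount

/-- The number of rooted hypermaps with further marked darts, on a labelled set of darts. -/
noncomputable def labelledCount (α : Type*) {κ : Type*} (n : ℕ) (d : κ → ℕ) (g : ℤ) (e f : ℕ) : ℕ :=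
  Nat.card {x : RootedData α κ // x.Good n d g e f}

variable {β κ : Type*} {n : ℕ} {d : κ → ℕ} {g e f : ℕ}

/-- A mark at `none` would lie in the root vertex. -/
theorem IsRooted.exists_some {R L : Perm (Option β)} {y : κ → Option β} {g : ℤ}
    (h : IsRooted R L (optCons none y) (optCons n d) g e f) : ∃ z : κ → β, y = some ∘ z := by
  have : ∀ i, ∃ x, y i = some x := fun i => by
    refine Option.ne_none_iff_exists'.1 fun hi => ?_
    have := h.inj none (some i) (by rw [optCons_some, hi]; exact Perm.SameCycle.refl _ _)
    simp at this
  choose z hz using this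
  exact ⟨z, funext hz⟩

variable [DecidableEq β] [Fintype β]

omit [Fintype β] in
theorem card_isRooted_option {g : ℤ} : Nat.card {x : Perm (Option β) × Perm (Option β) ×
      (κ → Option β) // IsRooted x.1 x.2.1 (optCons none x.2.2) (optCons n d) g e f} =
    Nat.card {x : (Option β × Option β) × Perm β × Perm β × (κ → β) //
      IsRooted (insertR x.2.1 x.1.1 x.1.2) (insertL x.2.2.1 x.1.1)
        (optCons none (some ∘ x.2.2.2)) (optCons n d) g e f} := by
  refine (Nat.card_congr (Equiv.ofBijective (fun x =>
    ⟨(insertR x.1.2.1 x.1.1.1 x.1.1.2, insertL x.1.2.2.1 x.1.1.1, some ∘ x.1.2.2.2), x.2⟩)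
    ⟨?_, ?_⟩)).symm
  · rintro ⟨⟨⟨u, w⟩, R, L, y⟩, h⟩ ⟨⟨⟨u', w'⟩, R', L', y'⟩, h'⟩ hxx
    have hxx := congrArg Subtype.val hxx
    simp only [Prod.mk.injEq] at hxx
    have := insert_bijective.1 (a₁ := ((u, w), R, L)) (a₂ := ((u', w'), R', L'))
      (by simp only [hxx])
    simp only [Prod.mk.injEq] at this
    obtain ⟨⟨rfl, rfl⟩, rfl, rfl⟩ := this
    obtain rfl : y = y' := funext fun i => Option.some_injective β (congrFun hxx.2.2 i)
    rfl
  · rintro ⟨⟨R, L, y⟩, h⟩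
    obtain ⟨z, rfl⟩ := h.exists_some
    obtain ⟨⟨⟨u, w⟩, R', L'⟩, hRL⟩ := insert_bijective.2 (R, L)
    simp only [Prod.mk.injEq] at hRL
    obtain ⟨rfl, rfl⟩ := hRL
    exact ⟨⟨((u, w), R', L', z), h⟩, rfl⟩

variable [Fintype κ] [DecidableEq κ]

/-- Since `b` is a function of `a`, only `a`, the old pair and the marks are counted. The remainder
of the split vertex carries no mark or exactly one; a mark `j` there can be any of its `d j` darts.
-/
theorem card_insert_split (hn : 1 ≤ n) :
    Nat.card {x : InsertionData β κ // x.2.1.SameCycle x.1.1 x.1.2 ∧ x.Good n d g e f} =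
      ∑ p ∈ Finset.Icc n (Nat.card β), labelledCount β p d g e f +
      ∑ j, d j * labelledCount β (d j + n - 1) (fun i : {i // i ≠ j} => d i) g e f := by
  let G : β × Perm β × Perm β × (κ → β) → Prop := fun x => n ≤ orbitSize x.2.1 x.1 ∧
    IsRooted (insertR x.2.1 (some x.1) (some ((x.2.1 ^ (n - 1)) x.1))) (insertL x.2.2.1 (some x.1))
          (optCons none (some ∘ x.2.2.2)) (optCons n d) g e f
  let Q : κ → β × Perm β × Perm β × (κ → β) → Prop := fun j x =>
    (insertR x.2.1 (some x.1) (some ((x.2.1 ^ (n - 1)) x.1))).SameCycle (some x.1)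
      (some (x.2.2.2 j))
  have h1 : Nat.card {x : InsertionData β κ // x.2.1.SameCycle x.1.1 x.1.2 ∧ x.Good n d g e f} =
      Nat.card {x // G x} := by
    refine (card_subtype_congr_right fun x : InsertionData β κ =>
      isRooted_insert_split hn).trans ?_
    refine (Nat.card_congr (Equiv.ofBijective (fun x =>
      ⟨((x.1.1, (x.1.2.1 ^ (n - 1)) x.1.1), x.1.2), rfl, x.2⟩) ⟨?_, ?_⟩)).symm
    · rintro ⟨⟨a, x⟩, h⟩ ⟨⟨a', x'⟩, h'⟩ hxx
      have hxx := congrArg Subtype.val hxx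
      simp only [Prod.mk.injEq] at hxx
      exact Subtype.ext (Prod.ext hxx.1.1 hxx.2)
    · rintro ⟨⟨⟨a, b⟩, R, L, y⟩, hb, h⟩
      exact ⟨⟨(a, R, L, y), h⟩, Subtype.ext (Prod.ext (Prod.ext rfl hb.symm) rfl)⟩
  have h2 : Nat.card {x // ¬(∃ j, Q j x) ∧ G x} =
      ∑ p ∈ Finset.Icc n (Nat.card β), labelledCount β p d g e f := by
    rw [card_subtype_eq_sum (Finset.Icc n (Nat.card β))
      (Q := fun p x => IsRooted x.2.1 x.2.2.1 (optCons x.1 x.2.2.2) (optCons p d) g e f)]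
    · exact Finset.sum_congr rfl fun p _ => card_subtype_congr (rootEquiv β κ) fun x => Iff.rfl
    · exact fun x => and_comm.trans (isRooted_insert_pow_unmarked hn)
    · intro x p q hp hq
      exact (hp.degree none).symm.trans (hq.degree none)
  have h3 : Nat.card {x // (∃ j, Q j x) ∧ G x} =
      ∑ j, d j * labelledCount β (d j + n - 1) (fun i : {i // i ≠ j} => d i) g e f := by
    rw [card_subtype_eq_sum Finset.univ (Q := fun j x => G x ∧ Q j x)]
    · refine Finset.sum_congr rfl fun j _ => ?_
      rw [card_subtype_congr_right fun x => isRooted_insert_pow_marked hn j]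
      have key := card_subtype_fiber (X := RootedData β {i // i ≠ j}) (Y := β) (m := d j)
        (P := fun x => 1 ≤ d j ∧ x.Good (d j + n - 1) (fun i : {i // i ≠ j} => d i) g e f)
        (Q := fun x y => (insertR x.1 (some (x.2.2 none))
          (some ((x.1 ^ (n - 1)) (x.2.2 none)))).SameCycle (some (x.2.2 none)) (some y)) (by
          rintro ⟨R, L, y⟩ ⟨hd, h⟩
          have hs := h.degree none
          simp only [optCons_none] at hs
          have hk : n - 1 < orbitSize R (y none) := by omega
          have h1 := orbitSize_insertR_pow_self hk
          have h2 : orbitSize (insertR R (some (y none)) (some ((R ^ (n - 1)) (y none))))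
            (some (y none)) = d j := by omega
          rw [← h2, orbitSize, ← Nat.card_coe_set_eq]
          refine Nat.card_congr (Equiv.ofBijective (fun z => ⟨some z.1, z.2⟩) ⟨?_, ?_⟩)
          · rintro ⟨z, hz⟩ ⟨z', hz'⟩ h
            exact Subtype.ext (Option.some_injective β (congrArg Subtype.val h))
          · rintro ⟨_ | z, hz⟩
            -- `none` lies in the other part of the split vertex, so all `d j` elements of this
            -- orbit are darts of `β`.
            · exact (not_sameCycle_insertR_pow hk (Perm.SameCycle.symm hz)).elim
            · exact ⟨⟨z, hz⟩, rfl⟩)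
      rw [card_subtype_and_prop] at key
      refine (card_subtype_congr (rootEquivAt β j) (fun x => Iff.rfl)).trans (key.trans ?_)
      split_ifs with hd
      · rfl
      · have : d j = 0 := by omega
        simp [this]
    · intro x
      simp only [Finset.mem_univ, true_and]
      exact ⟨fun ⟨⟨j, hj⟩, h⟩ => ⟨j, h, hj⟩, fun ⟨j, h, hj⟩ => ⟨⟨j, hj⟩, h⟩⟩
    · rintro x i j ⟨h, hi⟩ ⟨-, hj⟩
      simpa using h.2.inj (some i) (some j) (hi.symm.trans hj)
  rw [h1, card_subtype_split fun x => ∃ j, Q j x, h2, h3, add_comm]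

theorem card_insert_glued (hn : 1 ≤ n) :
    Nat.card {x : InsertionData β κ // ¬Connected x.2.1 x.2.2.1 ∧ x.Good n d g e f} =
      ∑ p ∈ glueIndices β κ n g e f,
        labelledCount {x // x ∈ p.1} p.2.2.2.2.1.1 (fun i : {i // i ∈ p.2.2.2.2.2} => d i)
          p.2.1.1 p.2.2.1.1 p.2.2.2.1.2 *
        labelledCount {x // x ∉ p.1} p.2.2.2.2.1.2 (fun i : {i // i ∉ p.2.2.2.2.2} => d i)
          p.2.1.2 p.2.2.1.2 p.2.2.2.1.1 := by
  rw [card_subtype_eq_sum (glueIndices β κ n g e f) (fun x => disconnected_iff_isGlued hn)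
    (fun x p q hp hq => hp.index_unique hq)]
  refine Finset.sum_congr rfl fun p _ => ?_
  rw [labelledCount, labelledCount, ← card_subtype_prod]
  refine (Nat.card_congr (Equiv.ofBijective (fun z => ⟨glueData z.1, z.1, z.2, rfl⟩)
    ⟨?_, ?_⟩)).symm
  · intro z z' h
    exact Subtype.ext (glueData_injective (congrArg Subtype.val h))
  · rintro ⟨x, z, hz, rfl⟩
    exact ⟨⟨z, hz⟩, rfl⟩

omit [DecidableEq κ] in
theorem card_insert_join_connected :
    Nat.card {x : InsertionData β κ //
      (¬x.2.1.SameCycle x.1.1 x.1.2 ∧ Connected x.2.1 x.2.2.1) ∧ x.Good n d g e f} =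
      ∑ p ∈ Finset.Icc 1 (n - 2), labelledCount β (n - 1 - p) (optCons p d) (g - 1) e f := by
  refine (card_subtype_eq_sum (Finset.Icc 1 (n - 2))
    (fun x => isRooted_insert_join_connected) ?_).trans ?_
  rotate_left
  · exact Finset.sum_congr rfl fun p _ => card_subtype_congr (rootEquiv₂ β κ) fun x => Iff.rfl
  · intro x p q hp hq
    exact (hp.degree (some none)).symm.trans (hq.degree (some none))

open Classical in
/-- The recurrence for labelled rooted hypermaps whose root is the dart `none`. -/
theorem card_isRooted_option_eq (hn : 1 ≤ n) : Nat.card {x : Perm (Option β) × Perm (Option β) ×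
      (κ → Option β) // IsRooted x.1 x.2.1 (optCons none x.2.2) (optCons n d) g e f} =
    (if (IsEmpty β ∧ IsEmpty κ) ∧ n = 1 ∧ g = 0 ∧ e = 1 ∧ f = 1 then 1 else 0) +
    (if 1 ≤ e then labelledCount β (n - 1) d g (e - 1) f else 0) +
    (if 1 ≤ f then labelledCount β (n - 1) d g e (f - 1) else 0) +
    (∑ p ∈ Finset.Icc n (Nat.card β), labelledCount β p d g e f +
      ∑ j, d j * labelledCount β (d j + n - 1) (fun i : {i // i ≠ j} => d i) g e f +
      (∑ p ∈ Finset.Icc 1 (n - 2), labelledCount β (n - 1 - p) (optCons p d) (g - 1) e f +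
      ∑ p ∈ glueIndices β κ n g e f,
        labelledCount {x // x ∈ p.1} p.2.2.2.2.1.1 (fun i : {i // i ∈ p.2.2.2.2.2} => d i)
          p.2.1.1 p.2.2.1.1 p.2.2.2.1.2 *
        labelledCount {x // x ∉ p.1} p.2.2.2.2.1.2 (fun i : {i // i ∉ p.2.2.2.2.2} => d i)
          p.2.1.2 p.2.2.1.2 p.2.2.2.1.1)) := by
  rw [card_isRooted_option, card_subtype_option_prod]
  congr 1
  · congr 1
    · congr 1
      · rw [card_subtype_congr_right fun x => isRooted_insert_none_none]
        split_ifs with h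
        · obtain ⟨⟨h1, h2⟩, h⟩ := h
          rw [Nat.card_eq_one_iff_unique]
          exact ⟨inferInstance, ⟨⟨(1, 1, fun i => h2.elim i), ⟨h1, h2⟩, by simpa using h⟩⟩⟩
        · have : IsEmpty {x : Perm β × Perm β × (κ → β) // (IsEmpty β ∧ IsEmpty κ) ∧ n = 1 ∧
              (g : ℤ) = 0 ∧ e = 1 ∧ f = 1} := ⟨fun x => h (by simpa using x.2)⟩
          exact Nat.card_of_isEmpty
      · rw [card_subtype_congr_right fun x => isRooted_insert_none_some hn, card_subtype_and_prop]
        split_ifs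
        · exact card_subtype_congr (rootEquiv β κ) fun x => Iff.rfl
        · rfl
    · rw [card_subtype_congr_right fun x => isRooted_insert_some_none hn, card_subtype_and_prop]
      split_ifs
      · exact card_subtype_congr (rootEquiv β κ) fun x => Iff.rfl
      · rfl
  -- Both positions are darts: in one vertex (split), in two vertices of a connected pair (genus
  -- drop), or in two components.
  · rw [← card_insert_split hn, ← card_insert_glued hn, ← card_insert_join_connected]
    rw [card_subtype_split fun x : InsertionData β κ => x.2.1.SameCycle x.1.1 x.1.2]
    congr 1
    rw [card_subtype_split fun x : InsertionData β κ => Connected x.2.1 x.2.2.1]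
    congr 1
    · refine card_subtype_congr_right fun x => ?_
      rw [← and_assoc, and_comm (a := Connected _ _)]
      rfl
    · refine card_subtype_congr_right fun x => and_congr_right fun hc => ?_
      -- A disconnected pair automatically has its two positions in different vertices.
      refine ⟨fun h => h.2, fun h => ⟨fun hs => hc ?_, h⟩⟩
      exact (connected_insert_of_sameCycle hs).1 h.connected

end LabelledCount

/-! ### Symmetries of the labelled count: relabelling, duality, choice of the root -/

section RootedCount

variable {α β ι κ : Type*}

/-- The number of hypermaps with marked darts on the labelled set `α` of darts. -/
noncomputable def rootedCount (α : Type*) {ι : Type*} (d : ι → ℕ) (g : ℤ) (e f : ℕ) : ℕ :=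
  Nat.card {x : Perm α × Perm α × (ι → α) // IsRooted x.1 x.2.1 x.2.2 d g e f}

theorem labelledCount_eq {n : ℕ} {d : κ → ℕ} {g : ℤ} {e f : ℕ} :
    labelledCount α n d g e f = rootedCount α (optCons n d) g e f := rfl

/-- Neither the names of the darts nor the order of the marks matters; this allows lists of degrees
to be compared as multisets. -/
theorem rootedCount_congr [Finite α] [Finite β] (φ : α ≃ β) (ψ : κ ≃ ι) {d : ι → ℕ} {d' : κ → ℕ}
    (hd : ∀ i, d (ψ i) = d' i) {g : ℤ} {e f : ℕ} :
    rootedCount α d g e f = rootedCount β d' g e f := by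
  refine card_subtype_congr (Equiv.prodCongr φ.permCongr (Equiv.prodCongr φ.permCongr
    (Equiv.arrowCongr ψ.symm φ))) ?_
  rintro ⟨R, L, y⟩
  obtain rfl : d' = fun i => d (ψ i) := funext fun i => (hd i).symm
  constructor
  · intro h
    exact (h.map φ (fun x => by simp) (fun x => by simp)).reindex ψ
  · intro h
    have := (h.map φ.symm (R' := R) (L' := L) (fun x => by simp) (fun x => by simp)).reindex
      ψ.symm
    simpa using this

theorem rootedCount_dual [Finite α] [Finite ι] {d : ι → ℕ} {g : ℤ} {e f : ℕ} :
    rootedCount α d g e f = rootedCount α d g f e := by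
  have key : ∀ e f, rootedCount α d g e f ≤ rootedCount α d g f e := by
    intro e f
    refine Nat.card_le_card_of_injective (fun x => ⟨(x.1.1, (x.1.1 * x.1.2.1)⁻¹, x.1.2.2),
      x.2.dual⟩) ?_
    rintro ⟨⟨R, L, y⟩, h⟩ ⟨⟨R', L', y'⟩, h'⟩ hx
    have hx := congrArg Subtype.val hx
    simp only [Prod.mk.injEq, inv_inj] at hx
    obtain ⟨rfl, h2, rfl⟩ := hx
    obtain rfl := mul_left_cancel h2
    rfl
  exact le_antisymm (key e f) (key f e)

theorem rootedCount_of_isEmpty [IsEmpty α] [Nonempty ι] {d : ι → ℕ} {g : ℤ} {e f : ℕ} :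
    rootedCount α d g e f = 0 := by
  obtain ⟨i⟩ := ‹Nonempty ι›
  have : IsEmpty {x : Perm α × Perm α × (ι → α) // IsRooted x.1 x.2.1 x.2.2 d g e f} :=
    ⟨fun x => isEmptyElim (x.1.2.2 i)⟩
  exact Nat.card_of_isEmpty

theorem rootedCount_of_neg [Finite α] [Nonempty ι] {d : ι → ℕ} {g : ℤ} {e f : ℕ} (hg : g < 0) :
    rootedCount α d g e f = 0 := by
  obtain ⟨i⟩ := ‹Nonempty ι›
  have : IsEmpty {x : Perm α × Perm α × (ι → α) // IsRooted x.1 x.2.1 x.2.2 d g e f} := by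
    refine ⟨fun x => ?_⟩
    have : Nonempty α := ⟨x.1.2.2 i⟩
    obtain ⟨k, hk⟩ := x.2.exists_nat_genus
    omega
  exact Nat.card_of_isEmpty

/-- Conjugation by `swap none r` moves a root `r` to `none`, so every dart is the root equally
often. -/
theorem labelledCount_option [Fintype β] [DecidableEq β] {κ : Type*} [Finite κ] {n : ℕ}
    {d : κ → ℕ} {g : ℤ} {e f : ℕ} :
    labelledCount (Option β) n d g e f = Nat.card {x : Perm (Option β) × Perm (Option β) ×
      (κ → Option β) // IsRooted x.1 x.2.1 (optCons none x.2.2) (optCons n d) g e f} *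
        (Nat.card β + 1) := by
  have key := card_subtype_fiber (X := Option β)
    (Y := Perm (Option β) × Perm (Option β) × (κ → Option β)) (P := fun _ => True)
    (Q := fun r x => IsRooted x.1 x.2.1 (optCons r x.2.2) (optCons n d) g e f)
    (m := Nat.card {x : Perm (Option β) × Perm (Option β) ×
      (κ → Option β) // IsRooted x.1 x.2.1 (optCons none x.2.2) (optCons n d) g e f}) (by
      intro r _
      let φ := swap none r
      have hφ : ∀ x, φ (φ x) = x := swap_apply_self none r
      refine card_subtype_congr (Equiv.prodCongr φ.permCongr (Equiv.prodCongr φ.permCongr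
        (Equiv.arrowCongr (Equiv.refl κ) φ))) ?_
      rintro ⟨R, L, y⟩
      have h1 : ∀ (y : κ → Option β) s, (fun i => φ (optCons s y i)) =
          optCons (φ s) fun i => φ (y i) := fun y s => by
        funext i; cases i <;> rfl
      have hs : φ.symm = φ := symm_swap none r
      constructor
      · intro h
        have := h.map φ (R' := φ.permCongr R) (L' := φ.permCongr L) (fun x => by simp)
          (fun x => by simp)
        rw [h1, swap_apply_right] at this
        exact this
      · intro h
        have := h.map φ (R' := R) (L' := L) (fun x => by simp [hs, hφ]) (fun x => by simp [hs, hφ])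
        rw [h1, swap_apply_left] at this
        simpa [hφ, Function.comp_def] using this)
  have hc : Nat.card {_r : Option β // True} = Nat.card β + 1 := by
    rw [← Finite.card_option]
    exact Nat.card_congr (Equiv.subtypeUnivEquiv fun _ => trivial)
  rw [hc] at key
  rw [← key]
  refine (card_subtype_congr (rootEquiv (Option β) κ) fun x => ?_).symm
  simp only [true_and]
  exact Iff.rfl

end RootedCount

/-! ### From labelled objects to isomorphism classes -/

section Quotients

/-- Each point is reached from the chosen representative of its class by exactly one `g`. No group
structure on `G` is needed for this. -/
theorem card_eq_card_mul_card_quotient {X G : Type*} (s : Setoid X) (act : G → X → X)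
    (h : ∀ x y, s x y ↔ ∃ g, act g x = y) (free : ∀ x g g', act g x = act g' x → g = g') :
    Nat.card X = Nat.card G * Nat.card (Quotient s) := by
  rw [← Nat.card_prod]
  refine (Nat.card_congr (Equiv.ofBijective (fun z : G × Quotient s => act z.1 z.2.out)
    ⟨?_, ?_⟩)).symm
  · rintro ⟨g, q⟩ ⟨g', q'⟩ hq
    have hr : ∀ (g : G) (q : Quotient s), (⟦act g q.out⟧ : Quotient s) = q := fun g q => by
      rw [← Quotient.sound ((h _ _).2 ⟨g, rfl⟩), Quotient.out_eq]
    have : q = q' := by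
      rw [← hr g q, ← hr g' q']
      exact congrArg _ hq
    subst this
    exact Prod.ext (free _ _ _ hq) rfl
  · intro x
    obtain ⟨g, hg⟩ := (h _ _).1 (Quotient.mk_out x)
    exact ⟨(g, ⟦x⟧), hg⟩

variable {α : Type*}

theorem hypermap_connected (M : Hypermap α) : Connected M.R M.L :=
  connected_iff_transitive.2 M.transitive

/-- Transport of a hypermap along a bijection of the darts. -/
def mapHypermap (φ : Perm α) (M : Hypermap α) : Hypermap α where
  R := φ.permCongr M.R
  L := φ.permCongr M.L
  transitive := connected_iff_transitive.1
    ((hypermap_connected M).map φ (fun x => by simp) (fun x => by simp))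

theorem isIso_iff_eq_mapHypermap {φ : Perm α} {M M' : Hypermap α} :
    M.IsIso M' φ ↔ M' = mapHypermap φ M := by
  constructor
  · rintro ⟨hR, hL⟩
    have hR' : M'.R = φ.permCongr M.R := by
      ext1 x; simp [hR]
    have hL' : M'.L = φ.permCongr M.L := by
      ext1 x; simp [hL]
    cases M'
    simp only at hR' hL'
    subst hR' hL'
    rfl
  · rintro rfl
    exact ⟨fun x => by simp [mapHypermap], fun x => by simp [mapHypermap]⟩

/-- The darts at which `φ` and `ψ` agree form an invariant set, since both carry `R` and `L` to the
same permutations; connectedness makes it everything. -/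
theorem mapHypermap_rigid {φ ψ : Perm α} {M : Hypermap α}
    (h : mapHypermap φ M = mapHypermap ψ M) {x : α} (hx : φ x = ψ x) : φ = ψ := by
  have key : ∀ {σ : Perm α}, φ.permCongr σ = ψ.permCongr σ →
      ∀ z, φ (σ z) = ψ (σ z) ↔ φ z = ψ z := by
    intro σ hσ z
    have h1 : φ.permCongr σ (φ z) = φ (σ z) := by simp
    have h2 : φ.permCongr σ (ψ z) = ψ (σ z) := by rw [hσ]; simp
    rw [← h1, ← h2, EmbeddingLike.apply_eq_iff_eq]
  ext1 y
  exact hypermap_connected M (fun z => φ z = ψ z) (key (congrArg Hypermap.R h))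
    (key (congrArg Hypermap.L h)) x y hx

theorem vertexOf_mapHypermap (φ : Perm α) (M : Hypermap α) (x : α) :
    (mapHypermap φ M).vertexOf (φ x) = φ '' M.vertexOf x :=
  permOrbit_map (fun x => by simp [mapHypermap]) x

variable [Finite α]

theorem numVertices_mapHypermap (φ : Perm α) (M : Hypermap α) :
    (mapHypermap φ M).numVertices = M.numVertices := by
  have : numOrbits (mapHypermap φ M).R = numOrbits M.R :=
    numOrbits_map φ fun x => by simp [mapHypermap]
  simp only [Hypermap.numVertices, Hypermap.vertices]
  split_ifs
  · rfl
  · exact this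

theorem numHyperedges_mapHypermap (φ : Perm α) (M : Hypermap α) :
    (mapHypermap φ M).numHyperedges = M.numHyperedges :=
  numOrbits_map φ fun x => by simp [mapHypermap]

theorem numFaces_mapHypermap (φ : Perm α) (M : Hypermap α) :
    (mapHypermap φ M).numFaces = M.numFaces := by
  have : numOrbits ((mapHypermap φ M).R * (mapHypermap φ M).L) = numOrbits (M.R * M.L) :=
    numOrbits_map φ fun x => by simp [mapHypermap]
  simp only [Hypermap.numFaces, Hypermap.faces]
  split_ifs
  · rfl
  · exact this

theorem hasGenus_mapHypermap (φ : Perm α) (M : Hypermap α) (g : ℕ) :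
    (mapHypermap φ M).HasGenus g ↔ M.HasGenus g := by
  rw [Hypermap.HasGenus, Hypermap.HasGenus, numVertices_mapHypermap, numHyperedges_mapHypermap,
    numFaces_mapHypermap]

omit [Finite α] in
theorem multirooted_ext {M M' : MultirootedHypermap α} (h : M.toHypermap = M'.toHypermap)
    (hd : M.darts = M'.darts) : M = M' := by
  cases M; cases M'; simp only at h hd; subst h hd; rfl

omit [Finite α] in
theorem sequenced_ext {M M' : SequencedHypermap α} (h : M.toHypermap = M'.toHypermap)
    (hr : M.root = M'.root) (hd : M.marked = M'.marked) : M = M' := by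
  cases M; cases M'; simp only at h hr hd; subst h hr hd; rfl

/-- Transport of a multirooted hypermap along a bijection of the darts. -/
def mapMultirooted (φ : Perm α) (M : MultirootedHypermap α) : MultirootedHypermap α where
  toHypermap := mapHypermap φ M.toHypermap
  darts := M.darts.map φ
  darts_ne_nil h := by simpa using M.darts_ne_nil h
  darts_pairwise := by
    rw [List.pairwise_map]
    refine M.darts_pairwise.imp fun h h' => h ?_
    rw [vertexOf_mapHypermap, vertexOf_mapHypermap] at h'
    exact φ.injective.image_injective h'

omit [Finite α] in
theorem degrees_mapMultirooted (φ : Perm α) (M : MultirootedHypermap α) :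
    (mapMultirooted φ M).degrees = M.degrees := by
  unfold MultirootedHypermap.degrees
  split_ifs
  · rfl
  simp only [mapMultirooted, List.map_map]
  refine List.map_congr_left fun x _ => ?_
  rw [Function.comp_apply, vertexOf_mapHypermap, Set.ncard_image_of_injective _ φ.injective]

theorem numMultirooted_mul_factorial (g t f e : ℕ) (D : List ℕ) :
    Nat.card {M : MultirootedHypermap (Fin t) // M.HasGenus g ∧ M.numFaces = f ∧
      M.numHyperedges = e ∧ M.degrees = D} = t.factorial * numMultirooted g t f e D := by
  have hc : Nat.card (Perm (Fin t)) = t.factorial := by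
    rw [Nat.card_perm, Nat.card_fin]
  rw [numMultirooted, ← hc]
  refine card_eq_card_mul_card_quotient _ (fun φ M => ⟨mapMultirooted φ M.1,
    (hasGenus_mapHypermap φ _ g).2 M.2.1, (numFaces_mapHypermap φ _).trans M.2.2.1,
    (numHyperedges_mapHypermap φ _).trans M.2.2.2.1,
    (degrees_mapMultirooted φ _).trans M.2.2.2.2⟩) ?_ ?_
  · rintro ⟨M, hM⟩ ⟨M', hM'⟩
    refine exists_congr fun φ => ?_
    rw [Subtype.mk.injEq, isIso_iff_eq_mapHypermap]
    constructor
    · rintro ⟨h1, h2⟩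
      exact multirooted_ext h1.symm h2.symm
    · intro h
      exact ⟨congrArg MultirootedHypermap.toHypermap h.symm,
        congrArg MultirootedHypermap.darts h.symm⟩
  · rintro ⟨M, hM⟩ φ ψ h
    have h := congrArg Subtype.val h
    by_cases ht : IsEmpty (Fin t)
    -- Without darts there is only one permutation, so the action is free for a trivial reason.
    · exact Subsingleton.elim _ _
    · rw [not_isEmpty_iff] at ht
      obtain ⟨x, hx⟩ := List.exists_mem_of_ne_nil _ (M.darts_ne_nil ht)
      refine mapHypermap_rigid (congrArg MultirootedHypermap.toHypermap h) (x := x) ?_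
      exact List.map_inj_left.1 (congrArg MultirootedHypermap.darts h) x hx

/-- Transport of a sequenced hypermap along a bijection of the darts. -/
def mapSequenced (φ : Perm α) (M : SequencedHypermap α) : SequencedHypermap α where
  toHypermap := mapHypermap φ M.toHypermap
  root := M.root.map φ
  root_isSome h := by simpa using M.root_isSome h
  marked := M.marked.map fun v => φ '' v
  marked_vertex := by
    intro v hv
    obtain ⟨w, hw, rfl⟩ := List.mem_map.1 hv
    obtain ⟨x, rfl⟩ := M.marked_vertex w hw
    exact ⟨φ x, vertexOf_mapHypermap φ _ x⟩
  marked_nodup := M.marked_nodup.map φ.injective.image_injective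
  marked_ne_root := by
    intro r hr hmem
    obtain ⟨x, hx, rfl⟩ := Option.mem_map.1 hr
    rw [vertexOf_mapHypermap] at hmem
    obtain ⟨w, hw, hw'⟩ := List.mem_map.1 hmem
    exact M.marked_ne_root x hx (φ.injective.image_injective hw' ▸ hw)

omit [Finite α] in
theorem rootDegree_mapSequenced (φ : Perm α) (M : SequencedHypermap α) :
    (mapSequenced φ M).rootDegree = M.rootDegree := by
  simp only [SequencedHypermap.rootDegree, mapSequenced]
  cases M.root with
  | none => rfl
  | some r =>
    simp only [Option.map_some, Option.elim_some]
    rw [vertexOf_mapHypermap, Set.ncard_image_of_injective _ φ.injective]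

omit [Finite α] in
theorem degrees_mapSequenced (φ : Perm α) (M : SequencedHypermap α) :
    (mapSequenced φ M).degrees = M.degrees := by
  simp only [SequencedHypermap.degrees, mapSequenced, List.map_map]
  exact List.map_congr_left fun x _ => Set.ncard_image_of_injective _ φ.injective

theorem numSequenced_mul_factorial (g t f e n : ℕ) (D : List ℕ) :
    Nat.card {S : SequencedHypermap (Fin t) // S.HasGenus g ∧ S.numFaces = f ∧
      S.numHyperedges = e ∧ S.rootDegree = n ∧ S.degrees = D} =
        t.factorial * numSequenced g t f e n D := by
  have hc : Nat.card (Perm (Fin t)) = t.factorial := by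
    rw [Nat.card_perm, Nat.card_fin]
  rw [numSequenced, ← hc]
  refine card_eq_card_mul_card_quotient _ (fun φ M => ⟨mapSequenced φ M.1,
    (hasGenus_mapHypermap φ _ g).2 M.2.1, (numFaces_mapHypermap φ _).trans M.2.2.1,
    (numHyperedges_mapHypermap φ _).trans M.2.2.2.1,
    (rootDegree_mapSequenced φ _).trans M.2.2.2.2.1,
    (degrees_mapSequenced φ _).trans M.2.2.2.2.2⟩) ?_ ?_
  · rintro ⟨M, hM⟩ ⟨M', hM'⟩
    refine exists_congr fun φ => ?_
    rw [Subtype.mk.injEq, isIso_iff_eq_mapHypermap]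
    constructor
    · rintro ⟨h1, h2, h3⟩
      exact sequenced_ext h1.symm h2.symm h3.symm
    · intro h
      exact ⟨congrArg SequencedHypermap.toHypermap h.symm,
        congrArg SequencedHypermap.root h.symm, congrArg SequencedHypermap.marked h.symm⟩
  · rintro ⟨M, hM⟩ φ ψ h
    have h := congrArg Subtype.val h
    by_cases ht : IsEmpty (Fin t)
    · exact Subsingleton.elim _ _
    · rw [not_isEmpty_iff] at ht
      obtain ⟨x, hx⟩ := Option.isSome_iff_exists.1 (M.root_isSome ht)
      refine mapHypermap_rigid (congrArg SequencedHypermap.toHypermap h) (x := x) ?_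
      have : M.root.map φ = M.root.map ψ := congrArg SequencedHypermap.root h
      simpa [hx] using this

end Quotients

/-! ### Families and lists of degrees as multisets -/

section Lists

variable {ι κ : Type*} [Fintype ι] [Fintype κ]

/-- Both families take each value equally often, so their fibres can be matched. -/
theorem exists_equiv_of_map_univ_eq {d : ι → ℕ} {d' : κ → ℕ}
    (h : Finset.univ.val.map d = Finset.univ.val.map d') : ∃ ψ : κ ≃ ι, ∀ i, d (ψ i) = d' i := by
  classical
  have hc : ∀ v, Nonempty ({k // d' k = v} ≃ {i // d i = v}) := by
    intro v
    rw [← Fintype.card_eq, Fintype.card_subtype, Fintype.card_subtype]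
    have := congrArg (Multiset.count v) h
    rw [Multiset.count_map, Multiset.count_map] at this
    rw [Finset.card_def, Finset.card_def, Finset.filter_val, Finset.filter_val]
    simp only [eq_comm (b := v)]
    exact this.symm
  have e := fun v => (hc v).some
  let ψ := (sigmaFiberEquiv d').symm.trans ((sigmaCongrRight e).trans (sigmaFiberEquiv d))
  exact ⟨ψ, fun i => (e (d' i) ⟨i, rfl⟩).2⟩

omit [Fintype ι] in
theorem map_univ_option {γ : Type*} (d : Option κ → γ) :
    Finset.univ.val.map d = d none ::ₘ Finset.univ.val.map fun i => d (some i) := by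
  have : (Finset.univ : Finset (Option κ)) = Finset.insertNone Finset.univ := rfl
  rw [this]
  simp [Finset.insertNone]

omit [Fintype ι] in
theorem map_univ_subtype {γ : Type*} (p : κ → Prop) [DecidablePred p] (d : κ → γ) :
    (Finset.univ.val.map fun i : {i // p i} => d i) = (Finset.univ.filter p).val.map d := by
  rw [← Finset.subtype_univ, ← Finset.subtype_map, Finset.map_val, Multiset.map_map]
  rfl

theorem coe_subAt (D : List ℕ) (S : Finset (Fin D.length)) :
    ((subAt D S : List ℕ) : Multiset ℕ) = (Finset.univ.filter (· ∈ S)).val.map D.get := by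
  rw [subAt, ← Multiset.map_coe, ← Multiset.filter_coe, Finset.filter_val]
  rfl

theorem subAt_eq_nil_iff {D : List ℕ} {S : Finset (Fin D.length)} : subAt D S = [] ↔ S = ∅ := by
  rw [← Multiset.coe_eq_zero, coe_subAt, Multiset.map_eq_zero, Finset.val_eq_zero]
  simp

theorem coe_subAt_univ (D : List ℕ) : ((subAt D Finset.univ : List ℕ) : Multiset ℕ) = D := by
  rw [coe_subAt]
  simp

theorem map_univ_ne (D : List ℕ) (j : Fin D.length) :
    (Finset.univ.val.map fun i : {i // i ≠ j} => D.get i) = (D.eraseIdx j : List ℕ) := by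
  have h1 := List.getElem_cons_eraseIdx_perm j.2
  have h2 : ((D : List ℕ) : Multiset ℕ) = D.get j ::ₘ (D.eraseIdx j : List ℕ) := by
    rw [Multiset.cons_coe, Multiset.coe_eq_coe]
    exact h1.symm
  have h3 : ((D : List ℕ) : Multiset ℕ) = Finset.univ.val.map D.get := by simp
  have h4 : (Finset.univ : Finset (Fin D.length)).val =
      j ::ₘ (Finset.univ.filter (· ≠ j)).val := by
    rw [← Finset.cons_val (by simp)]
    congr 1
    ext i
    simp [eq_or_ne]
  rw [map_univ_subtype (· ≠ j) D.get]
  rw [h3, h4, Multiset.map_cons, Multiset.cons_inj_right] at h2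
  exact h2

end Lists

/-! ### Multirooted and sequenced hypermaps as families of marks -/

section Link

theorem exists_ofFn_eq {γ : Type*} {n : ℕ} (l : List γ) (h : l.length = n) :
    ∃ y : Fin n → γ, List.ofFn y = l := by
  subst h
  exact ⟨l.get, List.ofFn_get l⟩

variable {α : Type*} [Finite α] [Nonempty α]

omit [Finite α] in
theorem numVertices_eq (M : Hypermap α) : M.numVertices = numOrbits M.R :=
  if_neg (not_isEmpty_iff.2 ‹_›)

omit [Finite α] in
theorem numFaces_eq (M : Hypermap α) : M.numFaces = numOrbits (M.R * M.L) :=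
  if_neg (not_isEmpty_iff.2 ‹_›)

/-- The multirooted hypermap given by two permutations and a family of darts. -/
def IsRooted.toMultirooted {R L : Perm α} {m : ℕ} {y : Fin m → α} {d : Fin m → ℕ} {g : ℤ}
    {e f : ℕ} (h : IsRooted R L y d g e f) (hm : m ≠ 0) : MultirootedHypermap α where
  R := R
  L := L
  transitive := connected_iff_transitive.1 h.connected
  darts := List.ofFn y
  darts_ne_nil _ := by simpa using hm
  darts_pairwise := List.pairwise_ofFn.2 fun i j hij h' =>
    hij.ne (h.inj i j (permOrbit_eq_iff.1 h'))

omit [Finite α] in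
theorem multirooted_degrees_eq (M : MultirootedHypermap α) :
    M.degrees = M.darts.map fun x => (M.vertexOf x).ncard :=
  if_neg (not_isEmpty_iff.2 ‹_›)

omit [Finite α] in
theorem card_multirooted (g f e : ℕ) {l : List ℕ} (hl : l ≠ []) :
    Nat.card {M : MultirootedHypermap α // M.HasGenus g ∧ M.numFaces = f ∧
      M.numHyperedges = e ∧ M.degrees = l} = rootedCount α l.get g e f := by
  have hl' : l.length ≠ 0 := by simpa using hl
  have hgood : ∀ x : {x : Perm α × Perm α × (Fin l.length → α) //
      IsRooted x.1 x.2.1 x.2.2 l.get g e f}, (x.2.toMultirooted hl').HasGenus g ∧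
      (x.2.toMultirooted hl').numFaces = f ∧ (x.2.toMultirooted hl').numHyperedges = e ∧
      (x.2.toMultirooted hl').degrees = l := by
    rintro ⟨⟨R, L, y⟩, h⟩
    refine ⟨?_, (numFaces_eq _).trans h.faces, h.edges, ?_⟩
    · rw [Hypermap.HasGenus, numVertices_eq, numFaces_eq]
      have := h.euler
      rw [← h.edges, ← h.faces] at this
      exact this
    · rw [multirooted_degrees_eq]
      simp only [IsRooted.toMultirooted, List.map_ofFn]
      refine Eq.trans (congrArg List.ofFn ?_) (List.ofFn_get l)
      exact funext h.degree
  refine (Nat.card_congr (Equiv.ofBijective (fun x => ⟨x.2.toMultirooted hl', hgood x⟩)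
    ⟨?_, ?_⟩)).symm
  · rintro ⟨⟨R, L, y⟩, h⟩ ⟨⟨R', L', y'⟩, h'⟩ hxx
    have hxx := congrArg Subtype.val hxx
    simp only [IsRooted.toMultirooted, MultirootedHypermap.mk.injEq, Hypermap.mk.injEq,
      List.ofFn_inj] at hxx
    obtain ⟨⟨rfl, rfl⟩, rfl⟩ := hxx
    rfl
  · rintro ⟨M, h1, h2, h3, h4⟩
    rw [multirooted_degrees_eq] at h4
    obtain ⟨y, hy⟩ := exists_ofFn_eq (n := l.length) M.darts (by rw [← h4, List.length_map])
    rw [Hypermap.HasGenus, h3, h2, numVertices_eq] at h1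
    rw [numFaces_eq] at h2
    refine ⟨⟨(M.R, M.L, y), hypermap_connected _, fun i j hij => ?_, fun i => ?_, h3, h2, h1⟩,
      Subtype.ext (multirooted_ext rfl hy)⟩
    · have hp := M.darts_pairwise
      rw [← hy, List.pairwise_ofFn] at hp
      rcases lt_trichotomy i j with h | h | h
      · exact (hp h (permOrbit_eq_iff.2 hij)).elim
      · exact h
      · exact (hp h (permOrbit_eq_iff.2 hij.symm)).elim
    · rw [← hy, List.map_ofFn] at h4
      have : List.ofFn _ = List.ofFn l.get := h4.trans (List.ofFn_get l).symm
      exact congrFun (List.ofFn_injective this) i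

/-- The bridge between labelled families over any index type and the numbers of the theorem: only
the multiset of degrees matters. -/
theorem rootedCount_eq {ι : Type*} [Fintype ι] {d : ι → ℕ} {l : List ℕ} (hl : l ≠ [])
    (h : Finset.univ.val.map d = (l : Multiset ℕ)) (g e f : ℕ) :
    rootedCount α d g e f = (Nat.card α).factorial * numMultirooted g (Nat.card α) f e l := by
  have : Nonempty (Fin (Nat.card α)) := ⟨⟨0, Nat.card_pos⟩⟩
  rw [← numMultirooted_mul_factorial, card_multirooted g f e hl]
  obtain ⟨ψ, hψ⟩ := exists_equiv_of_map_univ_eq (d := d) (d' := l.get) (by rw [h]; simp)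
  exact rootedCount_congr (Finite.equivFin α) ψ hψ

theorem rootedCount_eq_dual {ι : Type*} [Fintype ι] {d : ι → ℕ} {l : List ℕ} (hl : l ≠ [])
    (h : Finset.univ.val.map d = (l : Multiset ℕ)) (g e f : ℕ) :
    rootedCount α d g e f = (Nat.card α).factorial * numMultirooted g (Nat.card α) e f l := by
  rw [rootedCount_dual, rootedCount_eq hl h]

/-- Hypermaps with a root dart and a family of further vertices. -/
structure IsSequenced {κ : Type*} (R L : Perm α) (r : α) (v : κ → Set α) (n : ℕ) (d : κ → ℕ)
    (g : ℤ) (e f : ℕ) : Prop where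
  connected : Connected R L
  vertex : ∀ i, v i ∈ Set.range (permOrbit R)
  inj : Function.Injective v
  ne_root : ∀ i, permOrbit R r ≠ v i
  rootDegree : orbitSize R r = n
  degree : ∀ i, (v i).ncard = d i
  edges : numOrbits L = e
  faces : numOrbits (R * L) = f
  euler : (numOrbits R : ℤ) + e + f = Nat.card α + 2 * (1 - g)

/-- The sequenced hypermap given by two permutations, a root and a family of vertices. -/
def IsSequenced.toSequenced {R L : Perm α} {r : α} {m : ℕ} {v : Fin m → Set α} {n : ℕ}
    {d : Fin m → ℕ} {g : ℤ} {e f : ℕ} (h : IsSequenced R L r v n d g e f) :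
    SequencedHypermap α where
  R := R
  L := L
  transitive := connected_iff_transitive.1 h.connected
  root := some r
  root_isSome _ := rfl
  marked := List.ofFn v
  marked_vertex := List.forall_mem_ofFn_iff.2 h.vertex
  marked_nodup := List.nodup_ofFn.2 h.inj
  marked_ne_root r hr hm := by
    obtain rfl := Option.some_injective _ hr
    obtain ⟨i, hi⟩ := (List.mem_ofFn' _ _).1 hm
    exact h.ne_root i hi.symm

omit [Finite α] in
theorem card_sequenced (g f e n : ℕ) (D : List ℕ) :
    Nat.card {S : SequencedHypermap α // S.HasGenus g ∧ S.numFaces = f ∧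
      S.numHyperedges = e ∧ S.rootDegree = n ∧ S.degrees = D} =
    Nat.card {x : Perm α × Perm α × α × (Fin D.length → Set α) //
      IsSequenced x.1 x.2.1 x.2.2.1 x.2.2.2 n D.get g e f} := by
  have hgood : ∀ x : {x : Perm α × Perm α × α × (Fin D.length → Set α) //
      IsSequenced x.1 x.2.1 x.2.2.1 x.2.2.2 n D.get g e f}, x.2.toSequenced.HasGenus g ∧
      x.2.toSequenced.numFaces = f ∧ x.2.toSequenced.numHyperedges = e ∧
      x.2.toSequenced.rootDegree = n ∧ x.2.toSequenced.degrees = D := by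
    rintro ⟨⟨R, L, r, v⟩, h⟩
    refine ⟨?_, (numFaces_eq _).trans h.faces, h.edges, h.rootDegree, ?_⟩
    · rw [Hypermap.HasGenus, numVertices_eq, numFaces_eq]
      have := h.euler
      rw [← h.edges, ← h.faces] at this
      exact this
    · simp only [SequencedHypermap.degrees, IsSequenced.toSequenced, List.map_ofFn]
      refine Eq.trans (congrArg List.ofFn ?_) (List.ofFn_get D)
      exact funext h.degree
  refine (Nat.card_congr (Equiv.ofBijective (fun x => ⟨x.2.toSequenced, hgood x⟩)
    ⟨?_, ?_⟩)).symm
  · rintro ⟨⟨R, L, r, v⟩, h⟩ ⟨⟨R', L', r', v'⟩, h'⟩ hxx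
    have hxx := congrArg Subtype.val hxx
    simp only [IsSequenced.toSequenced, SequencedHypermap.mk.injEq, Hypermap.mk.injEq,
      List.ofFn_inj, Option.some_inj]
      at hxx
    obtain ⟨⟨rfl, rfl⟩, rfl, rfl⟩ := hxx
    rfl
  · rintro ⟨M, h1, h2, h3, h4, h5⟩
    rw [SequencedHypermap.degrees] at h5
    obtain ⟨v, hv⟩ := exists_ofFn_eq (n := D.length) M.marked (by rw [← h5, List.length_map])
    obtain ⟨r, hr⟩ := Option.isSome_iff_exists.1 (M.root_isSome ‹_›)
    rw [Hypermap.HasGenus, h3, h2, numVertices_eq] at h1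
    rw [numFaces_eq] at h2
    have hmem : ∀ i, v i ∈ M.marked := fun i => by rw [← hv]; exact (List.mem_ofFn' _ _).2 ⟨i, rfl⟩
    refine ⟨⟨(M.R, M.L, r, v), hypermap_connected _, fun i => M.marked_vertex _ (hmem i), ?_,
      fun i hi => M.marked_ne_root r hr (by rw [Hypermap.vertexOf, hi]; exact hmem i), ?_,
      fun i => ?_, h3, h2, h1⟩, Subtype.ext (sequenced_ext rfl hr.symm hv)⟩
    · rw [← List.nodup_ofFn, hv]
      exact M.marked_nodup
    · rw [SequencedHypermap.rootDegree, hr] at h4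
      exact h4
    · rw [← hv, List.map_ofFn] at h5
      have : List.ofFn _ = List.ofFn D.get := h5.trans (List.ofFn_get D).symm
      exact congrFun (List.ofFn_injective this) i

omit [Nonempty α] in
-- Marks are chosen independently, one among the `d i` darts of each distinguished vertex. This is
-- the labelled form of the first assertion.
theorem labelledCount_eq_prod_mul {κ : Type*} [Fintype κ] {n : ℕ} {d : κ → ℕ} {g : ℤ} {e f : ℕ} :
    labelledCount α n d g e f = (∏ i, d i) * Nat.card {x : Perm α × Perm α × α × (κ → Set α) //
      IsSequenced x.1 x.2.1 x.2.2.1 x.2.2.2 n d g e f} := by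
  rw [← card_subtype_fiber (X := Perm α × Perm α × α × (κ → Set α)) (Y := κ → α)
    (Q := fun x y => ∀ i, x.2.2.2 i = permOrbit x.1 (y i))]
  · have hgood : ∀ x : {x : RootedData α κ // x.Good n d g e f},
        IsSequenced x.1.1 x.1.2.1 (x.1.2.2 none) (fun i => permOrbit x.1.1 (x.1.2.2 (some i)))
          n d g e f := by
      rintro ⟨⟨R, L, y⟩, h⟩
      exact ⟨h.connected, fun i => ⟨_, rfl⟩,
        fun i j hij => by simpa using h.inj _ _ (permOrbit_eq_iff.1 hij),
        fun i hi => by simpa using h.inj _ _ (permOrbit_eq_iff.1 hi),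
        h.degree none, fun i => h.degree (some i), h.edges, h.faces, h.euler⟩
    refine Nat.card_congr (Equiv.ofBijective (fun x =>
      ⟨((x.1.1, x.1.2.1, x.1.2.2 none, fun i => permOrbit x.1.1 (x.1.2.2 (some i))),
        fun i => x.1.2.2 (some i)), hgood x, fun i => rfl⟩) ⟨?_, ?_⟩)
    · rintro ⟨⟨R, L, y⟩, h⟩ ⟨⟨R', L', y'⟩, h'⟩ hxx
      have hxx := congrArg Subtype.val hxx
      simp only [Prod.mk.injEq] at hxx
      obtain ⟨⟨rfl, rfl, h1, -⟩, h2⟩ := hxx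
      obtain rfl : y = y' := by
        funext i
        cases i with
        | none => exact h1
        | some i => exact congrFun h2 i
      rfl
    · rintro ⟨⟨⟨R, L, r, v⟩, y⟩, h, hv⟩
      obtain rfl : v = fun i => permOrbit R (y i) := funext hv
      simp only at h
      exact ⟨⟨(R, L, optCons r y), isRooted_optCons.2 ⟨h.connected,
        fun i hi => h.ne_root i (permOrbit_eq_iff.2 hi),
        fun i j hij => h.inj (permOrbit_eq_iff.2 hij), h.rootDegree, h.degree, h.edges, h.faces,
        h.euler⟩⟩, rfl⟩
  · rintro ⟨R, L, r, v⟩ h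
    simp only at h
    have hc : ∀ y : κ → α, (∀ i, v i = permOrbit R (y i)) ↔ ∀ i, y i ∈ v i := by
      refine fun y => forall_congr' fun i => ?_
      obtain ⟨x, hx⟩ := h.vertex i
      rw [← hx, permOrbit_eq_iff]
      rfl
    rw [card_subtype_congr_right hc, Nat.card_congr (Equiv.subtypePiEquivPi), Nat.card_pi]
    refine Finset.prod_congr rfl fun i _ => ?_
    rw [← h.degree i, ← Nat.card_coe_set_eq]

end Link

/-! ### The empty hypermap -/

section Empty

theorem card_subtype_of_subsingleton {X : Type*} [Subsingleton X] (x : X) (P : X → Prop)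
    [Decidable (P x)] : Nat.card {x // P x} = if P x then 1 else 0 := by
  split_ifs with h
  · rw [Nat.card_eq_one_iff_unique]
    exact ⟨inferInstance, ⟨⟨x, h⟩⟩⟩
  · have : IsEmpty {x // P x} := ⟨fun y => h (Subsingleton.elim y.1 x ▸ y.2)⟩
    exact Nat.card_of_isEmpty

variable {α : Type*} [IsEmpty α]

theorem hypermap_eq_of_isEmpty (M M' : Hypermap α) : M = M' := by
  obtain ⟨R, L, h⟩ := M
  obtain ⟨R', L', h'⟩ := M'
  obtain rfl : R = R' := Subsingleton.elim _ _
  obtain rfl : L = L' := Subsingleton.elim _ _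
  rfl

theorem list_eq_nil_of_isEmpty (l : List α) : l = [] :=
  List.eq_nil_iff_forall_not_mem.2 fun x => isEmptyElim x

instance : Subsingleton (MultirootedHypermap α) :=
  ⟨fun _ _ => multirooted_ext (hypermap_eq_of_isEmpty _ _)
    ((list_eq_nil_of_isEmpty _).trans (list_eq_nil_of_isEmpty _).symm)⟩

theorem marked_eq_nil_of_isEmpty (M : SequencedHypermap α) : M.marked = [] :=
  List.eq_nil_iff_forall_not_mem.2 fun v hv => by
    obtain ⟨x, -⟩ := M.marked_vertex v hv
    exact isEmptyElim x

instance : Subsingleton (SequencedHypermap α) :=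
  ⟨fun M M' => sequenced_ext (hypermap_eq_of_isEmpty _ _) (Subsingleton.elim _ _)
    ((marked_eq_nil_of_isEmpty M).trans (marked_eq_nil_of_isEmpty M').symm)⟩

variable (α) in
/-- The empty hypermap. -/
def emptyHypermap : Hypermap α := ⟨1, 1, fun x => isEmptyElim x⟩

variable (α) in
/-- The empty hypermap as a multirooted hypermap. -/
def emptyMultirooted : MultirootedHypermap α where
  toHypermap := emptyHypermap α
  darts := []
  darts_ne_nil h := isEmptyElim h.some
  darts_pairwise := List.Pairwise.nil

variable (α) in
/-- The empty hypermap as a sequenced hypermap. -/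
def emptySequenced : SequencedHypermap α where
  toHypermap := emptyHypermap α
  root := none
  root_isSome h := isEmptyElim h.some
  marked := []
  marked_vertex := by simp
  marked_nodup := List.nodup_nil
  marked_ne_root := by simp

variable (M : Hypermap α)

theorem numVertices_of_isEmpty : M.numVertices = 1 := if_pos ‹_›

theorem numFaces_of_isEmpty : M.numFaces = 1 := if_pos ‹_›

theorem numHyperedges_of_isEmpty : M.numHyperedges = 0 := numOrbits_of_isEmpty M.L

theorem hasGenus_iff_of_isEmpty (g : ℕ) : M.HasGenus g ↔ g = 0 := by
  rw [Hypermap.HasGenus, numVertices_of_isEmpty, numFaces_of_isEmpty, numHyperedges_of_isEmpty,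
    Nat.card_of_isEmpty]
  push_cast
  omega

theorem numMultirooted_zero (g f e : ℕ) (l : List ℕ) :
    numMultirooted g 0 f e l = if g = 0 ∧ f = 1 ∧ e = 0 ∧ l = [0] then 1 else 0 := by
  classical
  have h := numMultirooted_mul_factorial g 0 f e l
  rw [Nat.factorial_zero, one_mul] at h
  rw [← h, card_subtype_of_subsingleton (emptyMultirooted (Fin 0)), hasGenus_iff_of_isEmpty,
    numFaces_of_isEmpty, numHyperedges_of_isEmpty]
  have : (emptyMultirooted (Fin 0)).degrees = [0] := if_pos (inferInstance : IsEmpty (Fin 0))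
  rw [this]
  simp only [eq_comm]

theorem numSequenced_zero (g f e n : ℕ) (D : List ℕ) :
    numSequenced g 0 f e n D = if g = 0 ∧ f = 1 ∧ e = 0 ∧ n = 0 ∧ D = [] then 1 else 0 := by
  classical
  have h := numSequenced_mul_factorial g 0 f e n D
  rw [Nat.factorial_zero, one_mul] at h
  rw [← h, card_subtype_of_subsingleton (emptySequenced (Fin 0)), hasGenus_iff_of_isEmpty,
    numFaces_of_isEmpty, numHyperedges_of_isEmpty]
  have h1 : (emptySequenced (Fin 0)).degrees = [] := rfl
  have h2 : (emptySequenced (Fin 0)).rootDegree = 0 := rfl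
  rw [h1, h2]
  simp only [eq_comm]

end Empty

theorem map_univ_optCons (n : ℕ) (D : List ℕ) :
    Finset.univ.val.map (optCons n D.get) = ((n :: D : List ℕ) : Multiset ℕ) := by
  rw [map_univ_option]
  simp

/-- For `t ≥ 1` this is the labelled identity divided by `t!`; without darts only `D = []`
contributes, and its product is `1`. -/
theorem numMultirooted_eq_numSequenced_mul (g t f e n : ℕ) (D : List ℕ) :
    numMultirooted g t f e (n :: D) = numSequenced g t f e n D * D.prod := by
  cases t with
  | zero =>
    rw [numMultirooted_zero, numSequenced_zero]
    simp only [List.cons.injEq]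
    split_ifs with h
    · rw [h.2.2.2.2, List.prod_nil, mul_one]
    · rw [zero_mul]
  | succ t =>
    have h1 := rootedCount_eq (α := Fin (t + 1)) (List.cons_ne_nil n D) (map_univ_optCons n D) g e f
    rw [← labelledCount_eq, labelledCount_eq_prod_mul, ← card_sequenced, numSequenced_mul_factorial,
      Nat.card_fin] at h1
    have h2 : ∏ i, D.get i = D.prod := by
      rw [← List.prod_ofFn, List.ofFn_get]
    rw [h2] at h1
    refine Nat.eq_of_mul_eq_mul_left (Nat.factorial_pos (t + 1)) ?_
    rw [← h1]
    ring

/-! ### Assembling the recurrence -/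

section Recurrence

variable {g e f n : ℕ} {D : List ℕ}

/-- The contribution to the recurrence of the pairs of hypermaps with `t₁` and `t₂` darts. -/
noncomputable def pairSum (g e f n : ℕ) (D : List ℕ) (t₁ t₂ : ℕ) : ℕ :=
  ∑ q ∈ Finset.HasAntidiagonal.antidiagonal g ×ˢ Finset.HasAntidiagonal.antidiagonal e ×ˢ
      Finset.HasAntidiagonal.antidiagonal f ×ˢ Finset.HasAntidiagonal.antidiagonal (n - 1) ×ˢ
      (Finset.univ : Finset (Finset (Fin D.length))),
    numMultirooted q.1.1 t₁ q.2.1.1 q.2.2.1.2 (q.2.2.2.1.1 :: subAt D q.2.2.2.2) *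
      numMultirooted q.1.2 t₂ q.2.2.1.1 q.2.1.2 (q.2.2.2.1.2 :: subAt D q.2.2.2.2ᶜ)

theorem pairSum_zero_zero (hn : 1 ≤ n) : pairSum g e f n D 0 0 =
    if D.length = 0 ∧ n = 1 ∧ g = 0 ∧ e = 1 ∧ f = 1 then 1 else 0 := by
  split_ifs with h
  · obtain ⟨hD, rfl, rfl, rfl, rfl⟩ := h
    obtain rfl := List.length_eq_zero_iff.1 hD
    -- Each empty hypermap has one face and no hyperedge; the pairs are `(f₁, e₂)` and `(f₂, e₁)`.
    rw [pairSum, Finset.sum_eq_single ((0, 0), (1, 0), (1, 0), (0, 0), ∅)]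
    · simp [numMultirooted_zero, subAt]
    · rintro ⟨⟨g₁, g₂⟩, ⟨f₁, e₂⟩, ⟨f₂, e₁⟩, ⟨n₁, n₂⟩, S⟩ hq hne
      simp only [Finset.mem_product, Finset.HasAntidiagonal.mem_antidiagonal, Finset.mem_univ] at hq
      by_contra h0
      obtain ⟨h1, h2⟩ := mul_ne_zero_iff.1 h0
      simp only [numMultirooted_zero, ne_eq, ite_eq_right_iff, one_ne_zero, imp_false, not_not,
        List.cons.injEq, subAt_eq_nil_iff] at h1 h2
      exact hne (by simp [h1, h2])
    · intro h
      exact absurd (by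
        simp only [Finset.mem_product, Finset.HasAntidiagonal.mem_antidiagonal, Finset.mem_univ,
          and_self]) h
  · refine Finset.sum_eq_zero ?_
    rintro ⟨⟨g₁, g₂⟩, ⟨f₁, e₂⟩, ⟨f₂, e₁⟩, ⟨n₁, n₂⟩, S⟩ hq
    simp only [Finset.mem_product, Finset.HasAntidiagonal.mem_antidiagonal, Finset.mem_univ] at hq
    by_contra h0
    obtain ⟨h1, h2⟩ := mul_ne_zero_iff.1 h0
    simp only [numMultirooted_zero, ne_eq, ite_eq_right_iff, one_ne_zero, imp_false, not_not,
      List.cons.injEq, subAt_eq_nil_iff] at h1 h2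
    obtain ⟨_, _, _, _, hS⟩ := h1
    obtain ⟨_, _, _, _, hS'⟩ := h2
    refine h ⟨?_, by omega, by omega, by omega, by omega⟩
    rw [hS, Finset.compl_empty] at hS'
    have := congrArg Finset.card hS'
    simpa using this

/-- Because `f₁` is added to `e₂`, the face of the empty first factor plays the part of the
hyperedge formed by the root alone. -/
theorem pairSum_zero_left (t : ℕ) : pairSum g e f n D 0 t =
    if 1 ≤ e then numMultirooted g t f (e - 1) ((n - 1) :: subAt D Finset.univ) else 0 := by
  have key : ∀ q ∈ Finset.HasAntidiagonal.antidiagonal g ×ˢ Finset.HasAntidiagonal.antidiagonal e ×ˢ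
      Finset.HasAntidiagonal.antidiagonal f ×ˢ Finset.HasAntidiagonal.antidiagonal (n - 1) ×ˢ
      (Finset.univ : Finset (Finset (Fin D.length))),
      numMultirooted q.1.1 0 q.2.1.1 q.2.2.1.2 (q.2.2.2.1.1 :: subAt D q.2.2.2.2) *
        numMultirooted q.1.2 t q.2.2.1.1 q.2.1.2 (q.2.2.2.1.2 :: subAt D q.2.2.2.2ᶜ) ≠ 0 →
      1 ≤ e ∧ q = ((0, g), (1, e - 1), (f, 0), (0, n - 1), ∅) := by
    rintro ⟨⟨g₁, g₂⟩, ⟨f₁, e₂⟩, ⟨f₂, e₁⟩, ⟨n₁, n₂⟩, S⟩ hq h0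
    simp only [Finset.mem_product, Finset.HasAntidiagonal.mem_antidiagonal, Finset.mem_univ] at hq
    have h1 := (mul_ne_zero_iff.1 h0).1
    simp only [numMultirooted_zero, ne_eq, ite_eq_right_iff, one_ne_zero, imp_false, not_not,
      List.cons.injEq, subAt_eq_nil_iff] at h1
    obtain ⟨rfl, rfl, rfl, rfl, rfl⟩ := h1
    simp only [Prod.mk.injEq, true_and, and_true]
    omega
  split_ifs with he
  · rw [pairSum, Finset.sum_eq_single ((0, g), (1, e - 1), (f, 0), (0, n - 1), ∅)]
    · simp [numMultirooted_zero, subAt_eq_nil_iff]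
    · intro q hq hne
      by_contra h0
      exact hne (key q hq h0).2
    · intro h
      exact absurd (by simp [Finset.HasAntidiagonal.mem_antidiagonal, he]) h
  · refine Finset.sum_eq_zero fun q hq => ?_
    by_contra h0
    exact he (key q hq h0).1

/-- The face of the empty second factor plays the part of the face formed by the root alone; the
first factor appears dualized. -/
theorem pairSum_zero_right (t : ℕ) : pairSum g e f n D t 0 =
    if 1 ≤ f then numMultirooted g t e (f - 1) ((n - 1) :: subAt D Finset.univ) else 0 := by
  have key : ∀ q ∈ Finset.HasAntidiagonal.antidiagonal g ×ˢ Finset.HasAntidiagonal.antidiagonal e ×ˢ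
      Finset.HasAntidiagonal.antidiagonal f ×ˢ Finset.HasAntidiagonal.antidiagonal (n - 1) ×ˢ
      (Finset.univ : Finset (Finset (Fin D.length))),
      numMultirooted q.1.1 t q.2.1.1 q.2.2.1.2 (q.2.2.2.1.1 :: subAt D q.2.2.2.2) *
        numMultirooted q.1.2 0 q.2.2.1.1 q.2.1.2 (q.2.2.2.1.2 :: subAt D q.2.2.2.2ᶜ) ≠ 0 →
      1 ≤ f ∧ q = ((g, 0), (e, 0), (1, f - 1), (n - 1, 0), Finset.univ) := by
    rintro ⟨⟨g₁, g₂⟩, ⟨f₁, e₂⟩, ⟨f₂, e₁⟩, ⟨n₁, n₂⟩, S⟩ hq h0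
    simp only [Finset.mem_product, Finset.HasAntidiagonal.mem_antidiagonal, Finset.mem_univ] at hq
    have h1 := (mul_ne_zero_iff.1 h0).2
    simp only [numMultirooted_zero, ne_eq, ite_eq_right_iff, one_ne_zero, imp_false, not_not,
      List.cons.injEq, subAt_eq_nil_iff, Finset.compl_eq_empty_iff] at h1
    obtain ⟨rfl, rfl, rfl, rfl, rfl⟩ := h1
    simp only [Prod.mk.injEq, true_and, and_true]
    omega
  split_ifs with hf
  · rw [pairSum, Finset.sum_eq_single ((g, 0), (e, 0), (1, f - 1), (n - 1, 0), Finset.univ)]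
    · simp [numMultirooted_zero, subAt_eq_nil_iff]
    · intro q hq hne
      by_contra h0
      exact hne (key q hq h0).2
    · intro h
      exact absurd (by simp [Finset.HasAntidiagonal.mem_antidiagonal, hf]) h
  · refine Finset.sum_eq_zero fun q hq => ?_
    by_contra h0
    exact hf (key q hq h0).1

theorem map_univ_optCons_subtype (n : ℕ) (D : List ℕ) (S : Finset (Fin D.length)) :
    Finset.univ.val.map (optCons n fun i : {i // i ∈ S} => D.get i) =
      ((n :: subAt D S : List ℕ) : Multiset ℕ) := by
  rw [map_univ_option, ← Multiset.cons_coe, coe_subAt, ← map_univ_subtype]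
  congr!

theorem map_univ_optCons_compl (n : ℕ) (D : List ℕ) (S : Finset (Fin D.length)) :
    Finset.univ.val.map (optCons n fun i : {i // i ∉ S} => D.get i) =
      ((n :: subAt D Sᶜ : List ℕ) : Multiset ℕ) := by
  rw [map_univ_option, ← Multiset.cons_coe, coe_subAt]
  simp only [Finset.mem_compl]
  rw [← map_univ_subtype]
  rfl

/-- The inner sum depends only on the size `t` of the set of darts, and `m.choose t * t! * (m - t)!
= m!`. Parts without darts contribute nothing here, as they have no root dart, whereas `pairSum`
admits empty factors; hence the `if`. -/
theorem sum_glueIndices (m : ℕ) :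
    ∑ p ∈ glueIndices (Fin m) (Fin D.length) n g e f,
        labelledCount {x // x ∈ p.1} p.2.2.2.2.1.1 (fun i : {i // i ∈ p.2.2.2.2.2} => D.get i)
          p.2.1.1 p.2.2.1.1 p.2.2.2.1.2 *
        labelledCount {x // x ∉ p.1} p.2.2.2.2.1.2 (fun i : {i // i ∉ p.2.2.2.2.2} => D.get i)
          p.2.1.2 p.2.2.1.2 p.2.2.2.1.1 =
      m.factorial * ∑ T ∈ Finset.HasAntidiagonal.antidiagonal m,
        if T.1 = 0 ∨ T.2 = 0 then 0 else pairSum g e f n D T.1 T.2 := by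
  let Φ : ℕ → ℕ := fun t => if t = 0 ∨ m - t = 0 then 0 else
    t.factorial * (m - t).factorial * pairSum g e f n D t (m - t)
  rw [glueIndices, Finset.sum_product, ← Finset.powerset_univ]
  have hA : ∀ A : Finset (Fin m), ∑ q ∈ Finset.HasAntidiagonal.antidiagonal g ×ˢ
      Finset.HasAntidiagonal.antidiagonal e ×ˢ
      Finset.HasAntidiagonal.antidiagonal f ×ˢ Finset.HasAntidiagonal.antidiagonal (n - 1) ×ˢ
      (Finset.univ : Finset (Finset (Fin D.length))),
        labelledCount {x // x ∈ A} q.2.2.2.1.1 (fun i : {i // i ∈ q.2.2.2.2} => D.get i)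
          q.1.1 q.2.1.1 q.2.2.1.2 *
        labelledCount {x // x ∉ A} q.2.2.2.1.2 (fun i : {i // i ∉ q.2.2.2.2} => D.get i)
          q.1.2 q.2.1.2 q.2.2.1.1 = Φ A.card := by
    intro A
    have h1 : Nat.card {x // x ∈ A} = A.card := by simp
    have h2 := card_mem_add_card_notMem A
    rw [h1, Nat.card_fin] at h2
    have h3 : Nat.card {x // x ∉ A} = m - A.card := by omega
    simp only [Φ]
    split_ifs with h
    · refine Finset.sum_eq_zero fun q _ => ?_
      rcases h with h | h
      · have : IsEmpty {x // x ∈ A} := by rw [← Finite.card_eq_zero_iff, h1, h]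
        rw [labelledCount_eq, rootedCount_of_isEmpty, zero_mul]
      · have : IsEmpty {x // x ∉ A} := by rw [← Finite.card_eq_zero_iff, h3, h]
        rw [labelledCount_eq (α := {x // x ∉ A}), rootedCount_of_isEmpty, mul_zero]
    · push Not at h
      have : Nonempty {x // x ∈ A} := by
        rw [← Finite.card_pos_iff, h1]; omega
      have : Nonempty {x // x ∉ A} := by
        rw [← Finite.card_pos_iff, h3]; omega
      rw [pairSum, Finset.mul_sum]
      refine Finset.sum_congr rfl fun q _ => ?_
      -- Duality is applied to the first factor only, which crosses the hyperedge and face indices.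
      rw [labelledCount_eq, labelledCount_eq,
        rootedCount_eq_dual (List.cons_ne_nil _ _) (map_univ_optCons_subtype _ D _),
        rootedCount_eq (List.cons_ne_nil _ _) (map_univ_optCons_compl _ D _), h1, h3]
      ring
  refine (Finset.sum_congr rfl fun A _ => hA A).trans ?_
  rw [Finset.sum_powerset_apply_card, Finset.mul_sum,
    Finset.Nat.sum_antidiagonal_eq_sum_range_succ_mk, Finset.card_univ, Fintype.card_fin]
  refine Finset.sum_congr rfl fun t ht => ?_
  have ht' : t ≤ m := by simpa [Nat.lt_succ_iff] using ht
  simp only [Φ, smul_eq_mul]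
  split_ifs
  · simp
  · rw [← Nat.choose_mul_factorial_mul_factorial ht']
    ring

theorem sum_antidiagonal_pairSum {m : ℕ} (hm : m ≠ 0) :
    ∑ T ∈ Finset.HasAntidiagonal.antidiagonal m, pairSum g e f n D T.1 T.2 =
      pairSum g e f n D 0 m + pairSum g e f n D m 0 +
        ∑ T ∈ Finset.HasAntidiagonal.antidiagonal m,
          if T.1 = 0 ∨ T.2 = 0 then 0 else pairSum g e f n D T.1 T.2 := by
  have h : ∀ T ∈ Finset.HasAntidiagonal.antidiagonal m, pairSum g e f n D T.1 T.2 =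
      ((if T = (0, m) then pairSum g e f n D 0 m else 0) +
        (if T = (m, 0) then pairSum g e f n D m 0 else 0)) +
        if T.1 = 0 ∨ T.2 = 0 then 0 else pairSum g e f n D T.1 T.2 := by
    rintro ⟨a, b⟩ hT
    rw [Finset.HasAntidiagonal.mem_antidiagonal] at hT
    simp only at hT
    simp only [Prod.mk.injEq]
    by_cases ha : a = 0
    · subst ha
      obtain rfl : b = m := by omega
      simp [Ne.symm hm, hm]
    · by_cases hb : b = 0
      · subst hb
        obtain rfl : a = m := by omega
        simp [ha]
      · simp [ha, hb]
  rw [Finset.sum_congr rfl h, Finset.sum_add_distrib, Finset.sum_add_distrib,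
    Finset.sum_ite_eq', Finset.sum_ite_eq']
  simp

theorem sum_antidiagonal_pairSum_eq (t : ℕ) :
    ∑ G ∈ Finset.HasAntidiagonal.antidiagonal g, ∑ T ∈ Finset.HasAntidiagonal.antidiagonal t,
          ∑ f₁e₂ ∈ Finset.HasAntidiagonal.antidiagonal e,
          ∑ f₂e₁ ∈ Finset.HasAntidiagonal.antidiagonal f,
          ∑ N ∈ Finset.HasAntidiagonal.antidiagonal (n - 1), ∑ S : Finset (Fin D.length),
            numMultirooted G.1 T.1 f₁e₂.1 f₂e₁.2 (N.1 :: subAt D S) *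
              numMultirooted G.2 T.2 f₂e₁.1 f₁e₂.2 (N.2 :: subAt D Sᶜ) =
      ∑ T ∈ Finset.HasAntidiagonal.antidiagonal t, pairSum g e f n D T.1 T.2 := by
  rw [Finset.sum_comm]
  simp only [pairSum, Finset.sum_product]

theorem labelledCount_eq_factorial_mul {m : ℕ} (hm : m ≠ 0) (n g e f : ℕ) (D : List ℕ) :
    labelledCount (Fin m) n D.get g e f = m.factorial * numMultirooted g m f e (n :: D) := by
  have : Nonempty (Fin m) := ⟨⟨0, by omega⟩⟩
  rw [labelledCount_eq, rootedCount_eq (List.cons_ne_nil _ _) (map_univ_optCons n D), Nat.card_fin]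

/-- Duality on isomorphism classes. It fails for `m = 0`, as the empty hypermap has one face but no
hyperedge. -/
theorem numMultirooted_swap {m : ℕ} (hm : m ≠ 0) (g e f n : ℕ) (D : List ℕ) :
    numMultirooted g m f e (n :: D) = numMultirooted g m e f (n :: D) := by
  have h1 := labelledCount_eq_factorial_mul hm n g e f D
  rw [labelledCount_eq, rootedCount_dual, ← labelledCount_eq, labelledCount_eq_factorial_mul hm]
    at h1
  exact (Nat.eq_of_mul_eq_mul_left (Nat.factorial_pos m) h1).symm

theorem numMultirooted_perm {m : ℕ} (hm : m ≠ 0) (g e f : ℕ) {l l' : List ℕ} (hl : l ≠ [])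
    (h : (l : Multiset ℕ) = l') : numMultirooted g m f e l = numMultirooted g m f e l' := by
  have : Nonempty (Fin m) := ⟨⟨0, by omega⟩⟩
  have hl' : l' ≠ [] := by
    rintro rfl
    rw [Multiset.coe_eq_coe, List.perm_nil] at h
    exact hl h
  have h1 := rootedCount_eq (α := Fin m) (d := l.get) hl (by simp) g e f
  rw [rootedCount_eq (l := l') hl' (by rw [← h]; simp)] at h1
  rw [Nat.card_fin] at h1
  exact (Nat.eq_of_mul_eq_mul_left (Nat.factorial_pos m) h1).symm

open Classical in
/-- The terms of the recurrence in which the removal of the root dart disconnects the hypermap or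
leaves it empty on one side. -/
theorem sum_pairs_eq (hn : 1 ≤ n) (m : ℕ) :
    ((if (IsEmpty (Fin m) ∧ IsEmpty (Fin D.length)) ∧ n = 1 ∧ g = 0 ∧ e = 1 ∧ f = 1
        then 1 else 0) +
      (if 1 ≤ e then labelledCount (Fin m) (n - 1) D.get g (e - 1) f else 0) +
      (if 1 ≤ f then labelledCount (Fin m) (n - 1) D.get g e (f - 1) else 0)) +
      m.factorial * (∑ T ∈ Finset.HasAntidiagonal.antidiagonal m,
        if T.1 = 0 ∨ T.2 = 0 then 0 else pairSum g e f n D T.1 T.2) =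
    m.factorial * ∑ T ∈ Finset.HasAntidiagonal.antidiagonal m, pairSum g e f n D T.1 T.2 := by
  simp only [← not_nonempty_iff (α := Fin _), ← Fin.pos_iff_nonempty, not_lt, Nat.le_zero]
  by_cases hm : m = 0
  · subst hm
    simp [labelledCount_eq, rootedCount_of_isEmpty, pairSum_zero_zero hn]
  · rw [sum_antidiagonal_pairSum hm, pairSum_zero_left, pairSum_zero_right,
      if_neg (by simp [hm]), zero_add, labelledCount_eq_factorial_mul hm,
      labelledCount_eq_factorial_mul hm, numMultirooted_swap hm g e (f - 1)]
    have hc : ((((n - 1) :: D : List ℕ)) : Multiset ℕ) =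
        ((n - 1) :: subAt D Finset.univ : List ℕ) := by
      rw [← Multiset.cons_coe, ← Multiset.cons_coe, coe_subAt_univ]
    rw [numMultirooted_perm hm _ _ _ (List.cons_ne_nil _ _) hc,
      numMultirooted_perm hm _ _ _ (List.cons_ne_nil _ _) hc]
    split_ifs <;> ring

theorem sum_genus_eq (m : ℕ) :
    ∑ p ∈ Finset.Icc 1 (n - 2), labelledCount (Fin m) (n - 1 - p) (optCons p D.get)
        ((g : ℤ) - 1) e f =
      m.factorial * if 3 ≤ n ∧ 1 ≤ g then
        ∑ p ∈ Finset.Icc 1 (n - 2), numMultirooted (g - 1) m e f ((n - 1 - p) :: p :: D)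
      else 0 := by
  split_ifs with h
  · rw [Finset.mul_sum]
    refine Finset.sum_congr rfl fun p _ => ?_
    by_cases hm : m = 0
    · subst hm
      rw [labelledCount_eq, rootedCount_of_isEmpty, numMultirooted_zero, if_neg (by simp), mul_zero]
    · have : Nonempty (Fin m) := ⟨⟨0, by omega⟩⟩
      have hg : (g : ℤ) - 1 = ((g - 1 : ℕ) : ℤ) := by omega
      rw [hg, labelledCount_eq, rootedCount_eq_dual (l := (n - 1 - p) :: p :: D)
        (List.cons_ne_nil _ _), Nat.card_fin]
      rw [map_univ_option, ← Multiset.cons_coe, ← map_univ_optCons p D]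
      rfl
  -- A nonempty range forces `n ≥ 3`, so here `g = 0`, and no hypermap has genus `-1`.
  · rw [mul_zero]
    refine Finset.sum_eq_zero fun p hp => ?_
    rw [Finset.mem_Icc] at hp
    exact rootedCount_of_neg (by omega)

theorem sum_unmarked_eq (hn : 1 ≤ n) (m : ℕ) :
    ∑ p ∈ Finset.Icc n m, labelledCount (Fin m) p D.get g e f =
      m.factorial * ∑ p ∈ Finset.Icc n m, numMultirooted g m e f (p :: D) := by
  rw [Finset.mul_sum]
  refine Finset.sum_congr rfl fun p hp => ?_
  rw [Finset.mem_Icc] at hp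
  rw [labelledCount_eq_factorial_mul (by omega), numMultirooted_swap (by omega)]

theorem sum_marked_eq (hn : 1 ≤ n) (m : ℕ) :
    ∑ j, D.get j * labelledCount (Fin m) (D.get j + n - 1)
        (fun i : {i // i ≠ j} => D.get i) g e f =
      m.factorial * ∑ j : Fin D.length,
          D.get j * numMultirooted g m e f ((D.get j + n - 1) :: D.eraseIdx j) := by
  rw [Finset.mul_sum]
  refine Finset.sum_congr rfl fun j _ => ?_
  by_cases hm : m = 0
  · subst hm
    rw [labelledCount_eq, rootedCount_of_isEmpty, numMultirooted_zero]
    -- Without darts the count on the right can be `1`, but then `D.get j = 0` and the factor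
    -- removes the term.
    split_ifs with h
    · have h1 := (List.cons.inj h.2.2.2).1
      have : D.get j = 0 := by omega
      rw [this]
      simp
    · simp
  · have : Nonempty (Fin m) := ⟨⟨0, by omega⟩⟩
    rw [labelledCount_eq, rootedCount_eq_dual (l := (D.get j + n - 1) :: D.eraseIdx j)
        (List.cons_ne_nil _ _), Nat.card_fin]
    · ring
    · rw [map_univ_option, ← Multiset.cons_coe, ← map_univ_ne]
      rfl

theorem numMultirooted_recurrence (g t f e n : ℕ) (D : List ℕ) (ht : 1 ≤ t) (hn : 1 ≤ n) :
    numMultirooted g t f e (n :: D) =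
      ∑ T ∈ Finset.HasAntidiagonal.antidiagonal (t - 1), pairSum g e f n D T.1 T.2 +
        (if 3 ≤ n ∧ 1 ≤ g then
          ∑ p ∈ Finset.Icc 1 (n - 2),
            numMultirooted (g - 1) (t - 1) e f ((n - 1 - p) :: p :: D)
        else 0) +
        (∑ p ∈ Finset.Icc n (t - 1), numMultirooted g (t - 1) e f (p :: D)) +
        ∑ j : Fin D.length,
          D.get j * numMultirooted g (t - 1) e f ((D.get j + n - 1) :: D.eraseIdx j) := by
  obtain ⟨m, rfl⟩ := Nat.exists_eq_add_of_le' ht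
  rw [Nat.add_sub_cancel]
  have h1 := labelledCount_option (β := Fin m) (n := n) (d := D.get) (g := g) (e := e) (f := f)
  rw [labelledCount_eq, rootedCount_eq (List.cons_ne_nil _ _) (map_univ_optCons n D),
    Finite.card_option, Nat.card_fin, Nat.factorial_succ, mul_comm _ (m + 1), mul_assoc] at h1
  -- The factor `m + 1` of `(m + 1)!` is the number of choices of the root.
  have h2 := Nat.eq_of_mul_eq_mul_left (Nat.succ_pos m) h1
  rw [card_isRooted_option_eq hn, sum_glueIndices, sum_genus_eq, Nat.card_fin, sum_unmarked_eq hn,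
    sum_marked_eq hn] at h2
  refine Nat.eq_of_mul_eq_mul_left (Nat.factorial_pos m) ?_
  have h3 := sum_pairs_eq (g := g) (e := e) (f := f) (D := D) hn m
  rw [h2, mul_add, mul_add, mul_add, ← h3]
  abel

end Recurrence

end HypermapCount

theorem mainTheorem5 :
    (∀ (g t f e n : ℕ) (D : List ℕ),
      numMultirooted g t f e (n :: D) = numSequenced g t f e n D * D.prod) ∧
    numMultirooted 0 0 1 0 [0] = 1 ∧
    (∀ (g t f e n : ℕ) (D : List ℕ), 1 ≤ t → 1 ≤ n →
      numMultirooted g t f e (n :: D) =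
        (∑ G ∈ Finset.HasAntidiagonal.antidiagonal g, ∑ T ∈ Finset.HasAntidiagonal.antidiagonal (t - 1),
          ∑ f₁e₂ ∈ Finset.HasAntidiagonal.antidiagonal e, ∑ f₂e₁ ∈ Finset.HasAntidiagonal.antidiagonal f,
          ∑ N ∈ Finset.HasAntidiagonal.antidiagonal (n - 1), ∑ S : Finset (Fin D.length),
            numMultirooted G.1 T.1 f₁e₂.1 f₂e₁.2 (N.1 :: subAt D S) *
              numMultirooted G.2 T.2 f₂e₁.1 f₁e₂.2 (N.2 :: subAt D Sᶜ)) +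
        (if 3 ≤ n ∧ 1 ≤ g then
          ∑ p ∈ Finset.Icc 1 (n - 2),
            numMultirooted (g - 1) (t - 1) e f ((n - 1 - p) :: p :: D)
        else 0) +
        (∑ p ∈ Finset.Icc n (t - 1), numMultirooted g (t - 1) e f (p :: D)) +
        ∑ j : Fin D.length,
          D.get j * numMultirooted g (t - 1) e f ((D.get j + n - 1) :: D.eraseIdx j)) := by
  refine ⟨HypermapCount.numMultirooted_eq_numSequenced_mul, ?_, fun g t f e n D ht hn => ?_⟩
  · rw [HypermapCount.numMultirooted_zero]
    simp
  · rw [HypermapCount.sum_antidiagonal_pairSum_eq]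
    exact HypermapCount.numMultirooted_recurrence g t f e n D ht hn
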